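/- Let $\mathring T,\mathring R,\beta>0$ and put $\kappa=\left(2\pi/\mathring T\right)^2$. For $\alpha\in\mathbb R$ consider the reduced Lichnerowicz equation $$F(\phi,\alpha):=\kappa\,\frac{d^2\phi}{d\psi^2}+\frac18\left(\beta^2\phi^5+\alpha^2\phi^{-7}-\mathring R\,\phi\right)=0 \qquad (\ast)$$ for positive, $2\pi$-periodic $C^2$ functions $\phi$ of $\psi$; let $C^2_{\rm even}(S^1)$ be the space of even $2\pi$-periodic $C^2$ functions with the $C^2$ norm. Put $\alpha_{\max}=\frac{2}{3\sqrt3\,\beta^2}\mathring R^{3/2}$ and, for $|\alpha|\le\alpha_{\max}$, let $\phi_+(\alpha)\ge\phi_-(\alpha)\ge 0$ be the fourth roots of the largest and the smallest non-negative root $X$ of $\beta^2X^3-\mathring R X^2+\alpha^2=0$. For $k\ge1$ with $\kappa k^2<\mathring R/2$ put $$\alpha_{k,\pm}=\pm\frac{2}{3\sqrt3\,\beta^2}\left(\mathring R+\kappa k^2\right)\sqrt{\mathring R-2\kappa k^2}.$$ The index of a non-constant solution $\phi$ of $(\ast)$ is the number of turns that the closed curve $\psi\mapsto\left(\phi(\psi),\tfrac{2\pi}{\mathring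 T}\phi'(\psi)\right)$, $0\le\psi\le2\pi$, makes about $(\phi_+(\alpha),0)$, counted positively clockwise. A pair $(\alpha_0,\phi_0)$ with $\phi_0\in C^2_{\rm even}(S^1)$, $\phi_0>0$, is a bifurcation point if there are $\alpha_i\to\alpha_0$ and even positive solutions $\phi_i^1\ne\phi_i^2$ of $(\ast)$ with $\alpha=\alpha_i$, both converging to $\phi_0$ in $C^2$. **Proposition.** For each $k\ge1$ with $\kappa k^2<\mathring R/2$ there are two continuous curves $$(\alpha_{k,-},\alpha_{k,+})\ni\alpha\mapsto\phi_{k,\pm}(\alpha)\in C^2_{\rm even}(S^1)$$ of positive solutions of $(\ast)$, with $\phi_{k,+}(\alpha)\neq\phi_{k,-}(\alpha)$, that are $2\pi/k$-periodic and of index $k$, and $\phi_{k,-}(\alpha)(\psi)=\phi_{k,+}(\alpha)\left(\psi+\tfrac{\pi}{k}\right)$ for all $\psi$. For no $\alpha\in(\alpha_{k,-},\alpha_{k,+})$ is $(\alpha,\phi_{k,\pm}(\alpha))$ a bifurcation point, while as $\alpha\to\alpha_{k,+}$ or $\alpha\to\alpha_{k,-}$ both curves converge in $C^2$ to the constant $\phi_+(\alpha_{k,+})$,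 respectively $\phi_+(\alpha_{k,-})$, and $(\alpha_{k,\pm},\phi_+(\alpha_{k,\pm}))$ are bifurcation points. For each $\alpha\in\mathbb R$, the positive solutions of $(\ast)$ in $C^2_{\rm even}(S^1)$ are exactly: the constant $\phi_+(\alpha)$ if $|\alpha|\le\alpha_{\max}$; the constant $\phi_-(\alpha)$ if $0<|\alpha|\le\alpha_{\max}$; and $\phi_{k,\pm}(\alpha)$ for all $k\ge1$ with $\kappa k^2<\mathring R/2$ and $\alpha_{k,-}<\alpha<\alpha_{k,+}$. Every positive $2\pi$-periodic $C^2$ solution of $(\ast)$ is a translate in $\psi$ of an even one. -/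

import Mathlib

open Real Set Filter Topology
open scoped BoundedContinuousFunction

/-! ### The space of even `C²` functions on the circle -/

/-- Even, `2π`-periodic, twice continuously differentiable functions of `ψ ∈ ℝ`. -/
def c2EvenSubmodule : Submodule ℝ (ℝ → ℝ) where
  carrier := {f | ContDiff ℝ 2 f ∧ Function.Periodic f (2 * π) ∧ Function.Even f}
  add_mem' := fun {_ _} hf hg => ⟨hf.1.add hg.1, hf.2.1.add hg.2.1, hf.2.2.add hg.2.2⟩
  zero_mem' := ⟨contDiff_const, fun _ => rfl, fun _ => rfl⟩
  smul_mem' := fun c _ hf => ⟨contDiff_const.smul hf.1, hf.2.1.smul c, hf.2.2.const_smul c⟩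

/-- The space `C²_even(S¹, ℝ)`, where `S¹` carries the `2π`-periodic coordinate `ψ`. -/
def C2Even : Type := c2EvenSubmodule

namespace C2Even

noncomputable instance : AddCommGroup C2Even := inferInstanceAs (AddCommGroup c2EvenSubmodule)

noncomputable instance : Module ℝ C2Even := inferInstanceAs (Module ℝ c2EvenSubmodule)

instance : CoeFun C2Even (fun _ => ℝ → ℝ) := ⟨fun φ => φ.1⟩

theorem contDiff (φ : C2Even) : ContDiff ℝ 2 φ := φ.2.1

theorem periodic (φ : C2Even) : Function.Periodic φ (2 * π) := φ.2.2.1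

theorem even (φ : C2Even) : Function.Even φ := φ.2.2.2

theorem contDiff_deriv (φ : C2Even) : ContDiff ℝ 1 (deriv φ) := by
  have h : ContDiff ℝ (1 + 1) (φ : ℝ → ℝ) := by
    have := φ.contDiff
    norm_num
    exact this
  exact (contDiff_succ_iff_deriv.1 h).2.2

theorem continuous_deriv_deriv (φ : C2Even) : Continuous (deriv (deriv φ)) :=
  (contDiff_one_iff_deriv.1 φ.contDiff_deriv).2

theorem periodic_deriv {f : ℝ → ℝ} (hf : Function.Periodic f (2 * π)) :
    Function.Periodic (deriv f) (2 * π) := fun x => by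
  rw [← deriv_comp_add_const, funext hf]

/-- A continuous `2π`-periodic function as a bounded continuous function on `ℝ`. -/
noncomputable def periodicBCF (f : ℝ → ℝ) (hc : Continuous f)
    (hp : Function.Periodic f (2 * π)) : ℝ →ᵇ ℝ :=
  BoundedContinuousFunction.mkOfBound ⟨f, hc⟩ (Metric.diam (range f)) fun x y =>
    Metric.dist_le_diam_of_mem (hp.compact_of_continuous two_pi_pos.ne' hc).isBounded
      (mem_range_self x) (mem_range_self y)

/-- `φ ↦ (φ, φ', φ'')`, with values in triples of bounded continuous functions. -/
noncomputable def jet : C2Even →ₗ[ℝ] (ℝ →ᵇ ℝ) × (ℝ →ᵇ ℝ) × (ℝ →ᵇ ℝ) where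
  toFun φ :=
    (periodicBCF φ φ.contDiff.continuous φ.periodic,
      periodicBCF (deriv φ) φ.contDiff_deriv.continuous (periodic_deriv φ.periodic),
      periodicBCF (deriv (deriv φ)) φ.continuous_deriv_deriv
        (periodic_deriv (periodic_deriv φ.periodic)))
  map_add' φ χ := by
    have d : ∀ φ : C2Even, Differentiable ℝ (φ : ℝ → ℝ) :=
      fun φ => φ.contDiff.differentiable (by norm_num)
    have d' : ∀ φ : C2Even, Differentiable ℝ (deriv (φ : ℝ → ℝ)) :=
      fun φ => φ.contDiff_deriv.differentiable (by norm_num)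
    have h1 : deriv (φ + χ : C2Even) = deriv φ + deriv χ :=
      funext fun x => deriv_add (d φ x) (d χ x)
    have h2 : deriv (deriv (φ + χ : C2Even)) = deriv (deriv φ) + deriv (deriv χ) := by
      rw [h1]
      exact funext fun x => deriv_add (d' φ x) (d' χ x)
    refine Prod.ext (by ext x; rfl) (Prod.ext ?_ ?_)
    · ext x; exact congrFun h1 x
    · ext x; exact congrFun h2 x
  map_smul' c φ := by
    have d : Differentiable ℝ (φ : ℝ → ℝ) := φ.contDiff.differentiable (by norm_num)
    have d' : Differentiable ℝ (deriv (φ : ℝ → ℝ)) :=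
      φ.contDiff_deriv.differentiable (by norm_num)
    have h1 : deriv (c • φ : C2Even) = c • deriv φ :=
      funext fun x => deriv_const_smul c (d x)
    have h2 : deriv (deriv (c • φ : C2Even)) = c • deriv (deriv φ) := by
      rw [h1]
      exact funext fun x => deriv_const_smul c (d' x)
    refine Prod.ext (by ext x; rfl) (Prod.ext ?_ ?_)
    · ext x; exact congrFun h1 x
    · ext x; exact congrFun h2 x

theorem jet_injective : Function.Injective jet := fun φ χ h => by
  apply Subtype.ext
  funext x
  exact DFunLike.congr_fun (congrArg Prod.fst h) x

/-- The `C²` norm `max (sup |φ|) (sup |φ'|) (sup |φ''|)`. -/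
noncomputable instance : NormedAddCommGroup C2Even :=
  NormedAddCommGroup.induced C2Even ((ℝ →ᵇ ℝ) × (ℝ →ᵇ ℝ) × (ℝ →ᵇ ℝ)) jet jet_injective

noncomputable instance : NormedSpace ℝ C2Even :=
  NormedSpace.induced ℝ C2Even ((ℝ →ᵇ ℝ) × (ℝ →ᵇ ℝ) × (ℝ →ᵇ ℝ)) jet

/-- Constant functions. -/
def const (c : ℝ) : C2Even := ⟨fun _ => c, contDiff_const, fun _ => rfl, fun _ => rfl⟩

end C2Even

/-! ### The reduced equation

The length `T` of the circle, the scalar curvature `R` and the coupling `β` are fixed;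
`α` is the bifurcation parameter. -/

/-- `F(φ, α) = (2π/T)² φ'' + (β² φ⁵ + α² φ⁻⁷ - R φ) / 8`, as a function of `ψ`. -/
noncomputable def lichOp (T R β α : ℝ) (φ : ℝ → ℝ) : ℝ → ℝ := fun ψ =>
  (2 * π / T) ^ 2 * deriv (deriv φ) ψ
    + (β ^ 2 * φ ψ ^ 5 + α ^ 2 * φ ψ ^ (-7 : ℤ) - R * φ ψ) / 8

/-- Positive `C²` solutions on the circle (not necessarily even). -/
def IsCircleSolution (T R β α : ℝ) (φ : ℝ → ℝ) : Prop :=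
  ContDiff ℝ 2 φ ∧ Function.Periodic φ (2 * π) ∧ (∀ ψ, 0 < φ ψ) ∧ lichOp T R β α φ = 0

/-- The open set `{φ > 0}` of `C²_even`, the domain of the operator. -/
def positiveC2Even : Set C2Even := {φ | ∀ ψ, 0 < φ ψ}

/-- Positive even solutions on the circle. -/
def IsEvenSolution (T R β α : ℝ) (φ : C2Even) : Prop :=
  φ ∈ positiveC2Even ∧ lichOp T R β α φ = 0

/-- `(lam₀, x₀)` is a bifurcation point of the equation `F lam x = 0`, `lam ∈ I`, `x ∈ Ω`:
there are `lam i → lam₀` and `x i ≠ y i`, both converging to `x₀`, with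
`F (lam i) (x i) = F (lam i) (y i) = 0`. -/
def IsBifurcationPoint {A B : Type*} [TopologicalSpace A] [Zero B] (I : Set ℝ) (Ω : Set A)
    (F : ℝ → A → B) (lam₀ : ℝ) (x₀ : A) : Prop :=
  lam₀ ∈ I ∧ x₀ ∈ Ω ∧ ∃ (lam : ℕ → ℝ) (x y : ℕ → A),
    (∀ i, lam i ∈ I ∧ x i ∈ Ω ∧ y i ∈ Ω) ∧ Tendsto lam atTop (𝓝 lam₀) ∧
    (∀ i, x i ≠ y i) ∧ Tendsto x atTop (𝓝 x₀) ∧ Tendsto y atTop (𝓝 x₀) ∧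
    ∀ i, F (lam i) (x i) = 0 ∧ F (lam i) (y i) = 0

/-- Bifurcation points of the reduced equation in `ℝ × (C²_even ∩ {φ > 0})`. -/
def IsLichBifurcation (T R β α : ℝ) (φ : C2Even) : Prop :=
  IsBifurcationPoint (univ : Set ℝ) positiveC2Even
    (fun a (χ : C2Even) => lichOp T R β a χ) α φ

/-! ### Constant solutions and bifurcation values -/

/-- `α_max = 2 R^{3/2} / (3 √3 β²)`. -/
noncomputable def alphaMax (R β : ℝ) : ℝ := 2 / (3 * √3 * β ^ 2) * R ^ (3 / 2 : ℝ)

/-- `α_{k,+}`; the value `α_{k,-}` is its opposite. -/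
noncomputable def alphaBif (T R β : ℝ) (k : ℕ) : ℝ :=
  2 / (3 * √3 * β ^ 2) * (R + (2 * π / T) ^ 2 * (k : ℝ) ^ 2)
    * √(R - 2 * ((2 * π / T) ^ 2 * (k : ℝ) ^ 2))

/-- The angle in Cardano's formula for the cubic `β² X³ - R X² + α² = 0` in `X = φ⁴`
satisfied by the constant solutions (casus irreducibilis, `|α| ≤ α_max`). -/
noncomputable def cardanoAngle (R β α : ℝ) : ℝ :=
  arccos (1 - 27 * α ^ 2 * β ^ 4 / (2 * R ^ 3)) / 3

/-- The larger constant solution `φ_+(α)`. -/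
noncomputable def phiPlus (R β α : ℝ) : ℝ :=
  (R / (3 * β ^ 2) * (1 + 2 * cos (cardanoAngle R β α))) ^ (1 / 4 : ℝ)

/-- The smaller constant solution `φ_-(α)` (it vanishes at `α = 0`). -/
noncomputable def phiMinus (R β α : ℝ) : ℝ :=
  (R / (3 * β ^ 2) * (1 - 2 * cos (cardanoAngle R β α + π / 3))) ^ (1 / 4 : ℝ)

/-- The closed curve `ψ ↦ (φ(ψ), φ̇(ψ))`, `0 ≤ ψ ≤ 2π`, where `φ̇ = (2π/T) dφ/dψ`, avoids the
point `(c, 0)` and its class in `π₁(ℝ² \ {(c, 0)}) ≅ ℤ` is `k`. The class is read off from a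
continuous polar angle about `(c, 0)`; orbits of `φ̈ = -V'(φ)` run clockwise in the
`(φ, φ̇)` plane, and the generator of `π₁` is the clockwise circle. -/
def HasIndex (T c : ℝ) (φ : ℝ → ℝ) (k : ℤ) : Prop :=
  ∃ r θ : ℝ → ℝ, Continuous θ ∧
    (∀ ψ, 0 < r ψ ∧ φ ψ - c = r ψ * cos (θ ψ) ∧
      2 * π / T * deriv φ ψ = -(r ψ * sin (θ ψ))) ∧
    θ (2 * π) - θ 0 = 2 * π * k

/-! ### The normalised potential well

With `φ = φ_+ y` the reduced equation becomes `y'' = -force q y` up to a rescaling of time, where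
`q` ranges over `[0, 1/3)`. The coordinate `amp q y`, a signed square root of twice the potential,
turns the orbits into circles, so that they and their periods are given by explicit integrals. -/

namespace LichWell

/-! Dividing a solution by φ_+ and rescaling ψ turns the equation into y'' = -`force q y` with
equilibrium y = 1. The dependence on α sits in the single parameter q = `shape R β α`, which
increases with |α| and lies in [0, 1/3) when |α| < α_max. Since twice the potential is `amp q y ^
2`, orbits in the coordinates (`amp q y`, y') are circles of signed radius r, and the angle moves at
speed `ampD`. The time for half a turn is therefore the explicit integral `half q r` of `rate`, the
derivative of the inverse of `amp`. A non-constant 2π-periodic solution, seen from a critical point,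
is the same thing as r ≠ 0 together with an integer k ≥ 1 such that k * half q r = π * freq T R.

The count of solutions rests on three facts about r ↦ `half q r` for r ≥ 0. It is strictly
increasing (`half_strictMono`): by Chicone's criterion this follows from convexity of pot / force²,
which reduces to Schaaf's inequality 5 f''² > 3 f' f''' where f' > 0. At r = 0 it has the value π /
√(4 - 12q) of the linearised equation (`rate_zero`). It is unbounded towards the orbit homoclinic to
the lower equilibrium (`exists_half_gt`). Hence for each k there is exactly one r > 0 if the linear
half period is short enough, which means |α| < α_{k,+}, and none otherwise. The radii r and -r give
the two even phases, starting at a maximum and at a minimum.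

Monotonicity also makes r continuous in α (`continuous_of_half_eq`). Near a point of a curve the
amplitude, its sign and the integer k are all determined, so no other even solution is close
(`eventually_eq_curve`). At the ends r = 0 and both curves meet the constant φ_+. Completeness is
`circle_solution_cases`: at its minimum a solution is either an equilibrium, or lies between the two
equilibria and has the Cauchy data of one of these orbits. -/

/-- The normalised force; the equilibrium `φ_+` corresponds to `y = 1`. -/
noncomputable def force (q y : ℝ) : ℝ := (1 - q) * y ^ 5 + q / y ^ 7 - y

/-- The potential of `force`, vanishing at `y = 1`. -/
noncomputable def pot (q y : ℝ) : ℝ :=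
  (1 - q) * (y ^ 6 - 1) / 6 - q * (1 / y ^ 6 - 1) / 6 - (y ^ 2 - 1) / 2

/-- The factor of the force which is positive between the smaller equilibrium and infinity. -/
def quart (q y : ℝ) : ℝ := (1 - q) * y ^ 8 - q * y ^ 4 - q

/-- Twice the potential divided by `(y ^ 2 - 1) ^ 2`. -/
noncomputable def kap (q y : ℝ) : ℝ :=
  ((1 - q) * y ^ 8 + 2 * (1 - q) * y ^ 6 - 3 * q * y ^ 4 - 2 * q * y ^ 2 - q) / (3 * y ^ 6)

/-- The signed square root of twice the potential. -/
noncomputable def amp (q y : ℝ) : ℝ := (y ^ 2 - 1) * √(kap q y)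

/-- The derivative of `amp`. -/
noncomputable def ampD (q y : ℝ) : ℝ := (y ^ 2 + 1) * quart q y / (y ^ 7 * √(kap q y))

/-- The interval from the smaller equilibrium to infinity. -/
def dom (q : ℝ) : Set ℝ := {y | 0 < y ∧ 0 < quart q y}

theorem force_eq {q y : ℝ} (hy : y ≠ 0) : force q y = (y ^ 4 - 1) * quart q y / y ^ 7 := by
  unfold force quart
  field_simp
  ring

/-- In Y = y⁴ the factor `quart` is the quadratic (1-q)Y² - qY - q. Where it is positive, q <
(1-q)Y, and from there on it increases. -/
theorem dom_upward {q y y' : ℝ} (hq : q ∈ Ico (0 : ℝ) (1 / 3)) (hy : y ∈ dom q) (h : y ≤ y') :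
    y' ∈ dom q := by
  obtain ⟨h0, h1⟩ := hy
  obtain ⟨hq0, hq1⟩ := hq
  refine ⟨h0.trans_le h, ?_⟩
  unfold quart at *
  have a : 0 < y ^ 4 := by positivity
  have b : y ^ 4 ≤ y' ^ 4 := by gcongr
  have e : y ^ 8 = (y ^ 4) ^ 2 := by ring
  have e' : y' ^ 8 = (y' ^ 4) ^ 2 := by ring
  rw [e] at h1
  rw [e']
  set Y := y ^ 4
  set Z := y' ^ 4
  have hp : q < (1 - q) * Y := by
    by_contra hc
    push Not at hc
    nlinarith
  nlinarith [mul_nonneg (sub_nonneg.2 b) (sub_nonneg.2 hp.le),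
    mul_nonneg (sub_nonneg.2 b) (by nlinarith : 0 ≤ (1 - q) * Z)]

theorem one_mem_dom {q : ℝ} (hq : q ∈ Ico (0 : ℝ) (1 / 3)) : (1 : ℝ) ∈ dom q := by
  refine ⟨one_pos, ?_⟩
  have := hq.2
  unfold quart
  linarith

/-- With u = y², the numerator exceeds `quart` by 2u((1-q)u² - qu - q), so it suffices that this
bracket is nonnegative. For u ≤ 1, u² times the bracket is at least `quart`, because (u+1)u² ≤ u²+1.
-/
theorem kap_pos {q y : ℝ} (hq : q ∈ Ico (0 : ℝ) (1 / 3)) (hy : y ∈ dom q) : 0 < kap q y := by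
  obtain ⟨h0, h1⟩ := hy
  obtain ⟨hq0, hq1⟩ := hq
  unfold kap
  apply div_pos _ (by positivity)
  unfold quart at h1
  have hu : 0 < y ^ 2 := by positivity
  have e4 : y ^ 4 = (y ^ 2) ^ 2 := by ring
  have e6 : y ^ 6 = (y ^ 2) ^ 3 := by ring
  have e8 : y ^ 8 = (y ^ 2) ^ 4 := by ring
  rw [e4, e8] at h1
  rw [e4, e6, e8]
  set u := y ^ 2
  suffices h : 0 ≤ (1 - q) * u ^ 2 - q * u - q by nlinarith [mul_nonneg hu.le h]
  rcases le_total u 1 with hu1 | hu1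
  · have h2 : q * (u + 1) * u ^ 2 ≤ q * (u ^ 2 + 1) := by
      have : (u + 1) * u ^ 2 ≤ u ^ 2 + 1 := by
        have : u ^ 3 ≤ 1 := pow_le_one₀ hu.le hu1
        nlinarith
      nlinarith
    have h3 : 0 < ((1 - q) * u ^ 2 - q * u - q) * u ^ 2 := by nlinarith
    exact (pos_of_mul_pos_left h3 (by positivity)).le
  · nlinarith

/-- Keeps √`kap` away from zero to the right of 1, so that `amp` is unbounded above. -/
theorem kap_lower {q y : ℝ} (hq : q ∈ Ico (0 : ℝ) (1 / 3)) (hy : 1 ≤ y) :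
    1 - 3 * q ≤ kap q y := by
  obtain ⟨hq0, hq1⟩ := hq
  unfold kap
  have h0 : 0 < y := by linarith
  rw [le_div_iff₀ (by positivity)]
  have hu : 1 ≤ y ^ 2 := one_le_pow₀ hy
  have e4 : y ^ 4 = (y ^ 2) ^ 2 := by ring
  have e6 : y ^ 6 = (y ^ 2) ^ 3 := by ring
  have e8 : y ^ 8 = (y ^ 2) ^ 4 := by ring
  rw [e4, e6, e8]
  set u := y ^ 2
  have h1 : u ≤ u ^ 3 := le_self_pow₀ hu (by norm_num)
  have h2 : u ^ 2 ≤ u ^ 3 := pow_le_pow_right₀ hu (by norm_num)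
  have h3 : u ^ 3 ≤ u ^ 4 := pow_le_pow_right₀ hu (by norm_num)
  have h4 : 1 ≤ u ^ 3 := one_le_pow₀ hu
  nlinarith [mul_nonneg hq0 (sub_nonneg.2 h1), mul_nonneg hq0 (sub_nonneg.2 h2),
    mul_nonneg hq0 (sub_nonneg.2 h4)]

theorem amp_sq {q y : ℝ} (hq : q ∈ Ico (0 : ℝ) (1 / 3)) (hy : y ∈ dom q) :
    amp q y ^ 2 = 2 * pot q y := by
  have h0 := hy.1.ne'
  unfold amp
  rw [mul_pow, sq_sqrt (kap_pos hq hy).le]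
  unfold kap pot
  field_simp
  ring

theorem ampD_pos {q y : ℝ} (hq : q ∈ Ico (0 : ℝ) (1 / 3)) (hy : y ∈ dom q) : 0 < ampD q y := by
  have := sqrt_pos.2 (kap_pos hq hy)
  have := hy.1
  have := hy.2
  unfold ampD
  positivity

theorem amp_mul_ampD {q y : ℝ} (hq : q ∈ Ico (0 : ℝ) (1 / 3)) (hy : y ∈ dom q) :
    amp q y * ampD q y = force q y := by
  have := (sqrt_pos.2 (kap_pos hq hy)).ne'
  have h0 := hy.1.ne'
  rw [force_eq h0]
  unfold amp ampD
  field_simp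
  ring

theorem hasDerivAt_pot {q y : ℝ} (hy : y ≠ 0) : HasDerivAt (pot q) (force q y) y := by
  have h6 : HasDerivAt (fun y : ℝ => y ^ 6) (6 * y ^ 5) y := by simpa using hasDerivAt_pow 6 y
  have h2 : HasDerivAt (fun y : ℝ => y ^ 2) (2 * y) y := by simpa using hasDerivAt_pow 2 y
  have h := ((((h6.sub_const 1).const_mul (1 - q)).div_const 6).sub
    (((((hasDerivAt_const y (1 : ℝ)).div h6 (by positivity)).sub_const 1).const_mul q).div_const
      6)).sub ((h2.sub_const 1).div_const 2)
  refine h.congr_deriv ?_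
  unfold force
  field_simp
  ring

theorem hasDerivAt_amp {q y : ℝ} (hq : q ∈ Ico (0 : ℝ) (1 / 3)) (hy : y ∈ dom q) :
    HasDerivAt (amp q) (ampD q y) y := by
  have h0 := hy.1.ne'
  have hk := kap_pos hq hy
  have p (n : ℕ) : HasDerivAt (fun y : ℝ => y ^ n) (n * y ^ (n - 1)) y := hasDerivAt_pow n y
  have hkd := (((((((p 8).const_mul (1 - q)).add ((p 6).const_mul (2 * (1 - q)))).sub
    ((p 4).const_mul (3 * q))).sub ((p 2).const_mul (2 * q))).sub_const q).div
    ((p 6).const_mul 3) (by positivity))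
  have hkd' : HasDerivAt (kap q) _ y := hkd
  have h := ((p 2).sub_const 1).mul (hkd'.sqrt hk.ne')
  refine h.congr_deriv ?_
  have hs := (sqrt_pos.2 hk).ne'
  have hs2 := sq_sqrt hk.le
  unfold ampD
  -- The final identity treats the square root as an unknown; this is the only relation on it that
  -- is needed.
  have e : (√(kap q y)) ^ 2 * (3 * y ^ 6) = ((1 - q) * y ^ 8 + 2 * (1 - q) * y ^ 6
      - 3 * q * y ^ 4 - 2 * q * y ^ 2 - q) := by
    rw [hs2]; unfold kap; field_simp
  unfold quart
  simp only [Pi.add_apply, Pi.sub_apply]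
  generalize √(kap q y) = s at *
  field_simp
  push_cast
  linear_combination (4 * y ^ 7) * e

theorem isOpen_pdom : IsOpen {z : ℝ × ℝ | z.2 ∈ dom z.1} := by
  have h : {z : ℝ × ℝ | z.2 ∈ dom z.1} = {z | 0 < z.2} ∩ {z | 0 < quart z.1 z.2} := rfl
  rw [h]
  refine (isOpen_lt continuous_const continuous_snd).inter (isOpen_lt continuous_const ?_)
  unfold quart
  fun_prop

theorem isOpen_dom (q : ℝ) : IsOpen (dom q) :=
  isOpen_pdom.preimage (by fun_prop : Continuous fun y : ℝ => (q, y))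

theorem continuousAt_kap {z : ℝ × ℝ} (hz : z.2 ≠ 0) :
    ContinuousAt (fun z : ℝ × ℝ => kap z.1 z.2) z := by
  unfold kap
  exact ContinuousAt.div (by fun_prop) (by fun_prop) (by positivity)

theorem continuousAt_amp {z : ℝ × ℝ} (hz : z.2 ≠ 0) :
    ContinuousAt (fun z : ℝ × ℝ => amp z.1 z.2) z := by
  unfold amp
  exact ContinuousAt.mul (by fun_prop) (continuousAt_kap hz).sqrt

theorem continuousAt_ampD {z : ℝ × ℝ} (hq : z.1 ∈ Ico (0 : ℝ) (1 / 3)) (hz : z.2 ∈ dom z.1) :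
    ContinuousAt (fun z : ℝ × ℝ => ampD z.1 z.2) z := by
  have hs := (sqrt_pos.2 (kap_pos hq hz)).ne'
  have h0 := hz.1.ne'
  unfold ampD quart
  exact ContinuousAt.div (by fun_prop) (ContinuousAt.mul (by fun_prop)
    (continuousAt_kap h0).sqrt) (by positivity)

theorem convex_dom {q : ℝ} (hq : q ∈ Ico (0 : ℝ) (1 / 3)) : Convex ℝ (dom q) :=
  OrdConnected.convex ⟨fun _ hx _ _ _ hz => dom_upward hq hx hz.1⟩

theorem strictMonoOn_amp {q : ℝ} (hq : q ∈ Ico (0 : ℝ) (1 / 3)) : StrictMonoOn (amp q) (dom q) := by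
  refine strictMonoOn_of_deriv_pos (convex_dom hq)
    (fun y hy => (hasDerivAt_amp hq hy).continuousAt.continuousWithinAt) fun y hy => ?_
  rw [(isOpen_dom q).interior_eq] at hy
  rw [(hasDerivAt_amp hq hy).deriv]
  exact ampD_pos hq hy

theorem amp_one (q : ℝ) : amp q 1 = 0 := by simp [amp]

theorem tendsto_amp_atTop {q : ℝ} (hq : q ∈ Ico (0 : ℝ) (1 / 3)) :
    Tendsto (amp q) atTop atTop := by
  have h1 : 0 < √(1 - 3 * q) := sqrt_pos.2 (by linarith [hq.2])
  have h : Tendsto (fun y : ℝ => (y ^ 2 - 1) * √(1 - 3 * q)) atTop atTop :=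
    (tendsto_atTop_add_const_right atTop (-1 : ℝ)
      (tendsto_pow_atTop (two_ne_zero (α := ℕ)))).atTop_mul_const h1
  refine tendsto_atTop_mono' atTop ?_ h
  filter_upwards [eventually_ge_atTop 1] with y hy
  unfold amp
  have : 0 ≤ y ^ 2 - 1 := by nlinarith
  have := sqrt_le_sqrt (kap_lower hq hy)
  gcongr

/-! ### The image of the amplitude coordinate and its inverse. -/

/-- The values of `amp`. -/
def range (q : ℝ) : Set ℝ := amp q '' dom q

theorem range_upward {q x x' : ℝ} (hq : q ∈ Ico (0 : ℝ) (1 / 3)) (hx : x ∈ range q) (h : x ≤ x') :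
    x' ∈ range q := by
  obtain ⟨y, hy, rfl⟩ := hx
  obtain ⟨y', h1, h2⟩ := ((tendsto_amp_atTop hq).eventually_ge_atTop x').and
    (eventually_ge_atTop y) |>.exists
  have hc : ContinuousOn (amp q) (Icc y y') := fun z hz =>
    (hasDerivAt_amp hq (dom_upward hq hy hz.1)).continuousAt.continuousWithinAt
  obtain ⟨z, hz, rfl⟩ := intermediate_value_Icc h2 hc ⟨h, h1⟩
  exact ⟨z, dom_upward hq hy hz.1, rfl⟩

/-- The inverse of `amp q` on `dom q`. -/
noncomputable def inv (q x : ℝ) : ℝ := Function.invFunOn (amp q) (dom q) x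

theorem inv_mem {q x : ℝ} (hx : x ∈ range q) : inv q x ∈ dom q := Function.invFunOn_mem hx

theorem amp_inv {q x : ℝ} (hx : x ∈ range q) : amp q (inv q x) = x := Function.invFunOn_eq hx

theorem inv_amp {q y : ℝ} (hq : q ∈ Ico (0 : ℝ) (1 / 3)) (hy : y ∈ dom q) :
    inv q (amp q y) = y :=
  (strictMonoOn_amp hq).injOn (inv_mem ⟨y, hy, rfl⟩) hy (amp_inv ⟨y, hy, rfl⟩)

theorem inv_lt_iff {q x y : ℝ} (hq : q ∈ Ico (0 : ℝ) (1 / 3)) (hx : x ∈ range q)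
    (hy : y ∈ dom q) : inv q x < y ↔ x < amp q y := by
  rw [← (strictMonoOn_amp hq).lt_iff_lt (inv_mem hx) hy, amp_inv hx]

theorem lt_inv_iff {q x y : ℝ} (hq : q ∈ Ico (0 : ℝ) (1 / 3)) (hx : x ∈ range q)
    (hy : y ∈ dom q) : y < inv q x ↔ amp q y < x := by
  rw [← (strictMonoOn_amp hq).lt_iff_lt hy (inv_mem hx), amp_inv hx]

theorem eventually_mem_dom {q y : ℝ} (hy : y ∈ dom q) : ∀ᶠ r in 𝓝 q, y ∈ dom r := by
  have hc : ContinuousAt (fun r : ℝ => (r, y)) q := by fun_prop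
  have h1 : {z : ℝ × ℝ | z.2 ∈ dom z.1} ∈ 𝓝 (q, y) := isOpen_pdom.mem_nhds (by exact hy)
  exact hc.preimage_mem_nhds h1

theorem continuousAt_amp_left {q y : ℝ} (hy : y ≠ 0) : ContinuousAt (fun r => amp r y) q := by
  have hc : ContinuousAt (fun r : ℝ => (r, y)) q := by fun_prop
  exact ContinuousAt.comp (f := fun r : ℝ => (r, y)) (continuousAt_amp (z := (q, y)) hy) hc

theorem eventually_lt_amp {q x y : ℝ} (hy : y ∈ dom q) (h : x < amp q y) :
    ∀ᶠ w : ℝ × ℝ in 𝓝 (q, x), y ∈ dom w.1 ∧ w.2 < amp w.1 y := by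
  have h1 : Tendsto (fun w : ℝ × ℝ => w.1) (𝓝 (q, x)) (𝓝 q) := continuousAt_fst
  have h2 : Tendsto (fun w : ℝ × ℝ => w.2) (𝓝 (q, x)) (𝓝 x) := continuousAt_snd
  have h3 := (continuousAt_amp_left (q := q) hy.1.ne').tendsto.comp h1
  exact (h1.eventually (eventually_mem_dom hy)).and (h2.eventually_lt h3 h)

theorem eventually_amp_lt {q x y : ℝ} (hy : y ∈ dom q) (h : amp q y < x) :
    ∀ᶠ w : ℝ × ℝ in 𝓝 (q, x), y ∈ dom w.1 ∧ amp w.1 y < w.2 := by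
  have h1 : Tendsto (fun w : ℝ × ℝ => w.1) (𝓝 (q, x)) (𝓝 q) := continuousAt_fst
  have h2 : Tendsto (fun w : ℝ × ℝ => w.2) (𝓝 (q, x)) (𝓝 x) := continuousAt_snd
  have h3 := (continuousAt_amp_left (q := q) hy.1.ne').tendsto.comp h1
  exact (h1.eventually (eventually_mem_dom hy)).and (h3.eventually_lt h2 h)

theorem exists_lt_mem_dom {q y a : ℝ} (hy : y ∈ dom q) (ha : a < y) :
    ∃ b ∈ dom q, a < b ∧ b < y := by
  have h1 : ∀ᶠ b in 𝓝[<] y, b ∈ dom q :=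
    nhdsWithin_le_nhds ((isOpen_dom q).mem_nhds hy)
  have h2 : ∀ᶠ b in 𝓝[<] y, b ∈ Ioo a y := Ioo_mem_nhdsLT ha
  obtain ⟨b, hb, hb'⟩ := (h1.and h2).exists
  exact ⟨b, hb, hb'⟩

/-- The pairs `(q, x)` for which `inv q x` is meaningful. -/
def invDom : Set (ℝ × ℝ) := {z | z.1 ∈ Ico (0 : ℝ) (1 / 3) ∧ z.2 ∈ range z.1}

/-- The domain of the inverse moves with q, so continuity is tested through the order. A bound on
`inv q x` is witnessed by a fixed y with `amp q y` < x or x < `amp q y`, and these conditions are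
open in (q, x). -/
theorem continuousOn_inv : ContinuousOn (fun z : ℝ × ℝ => inv z.1 z.2) invDom := by
  rintro ⟨q, x⟩ ⟨hq, hx⟩
  refine tendsto_order.2 ⟨fun a ha => ?_, fun b hb => ?_⟩
  · obtain ⟨y, hy, hay, hyz⟩ := exists_lt_mem_dom (inv_mem hx) ha
    filter_upwards [nhdsWithin_le_nhds (eventually_amp_lt hy ((lt_inv_iff hq hx hy).1 hyz)),
      self_mem_nhdsWithin] with w hw hw'
    exact hay.trans ((lt_inv_iff hw'.1 hw'.2 hw.1).2 hw.2)
  · have hy := dom_upward hq (inv_mem hx) hb.le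
    filter_upwards [nhdsWithin_le_nhds (eventually_lt_amp hy ((inv_lt_iff hq hx hy).1 hb)),
      self_mem_nhdsWithin] with w hw hw'
    exact (inv_lt_iff hw'.1 hw'.2 hw.1).2 hw.2

theorem range_mem_nhds {q x : ℝ} (hq : q ∈ Ico (0 : ℝ) (1 / 3)) (hx : x ∈ range q) :
    range q ∈ 𝓝 x := by
  obtain ⟨y, hy, hyx⟩ := exists_lt_mem_dom (inv_mem hx) (sub_one_lt (inv q x))
  refine Filter.mem_of_superset (Ioi_mem_nhds ((lt_inv_iff hq hx hy).1 hyx.2)) fun w hw => ?_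
  exact range_upward hq ⟨y, hy, rfl⟩ (le_of_lt hw)

theorem hasDerivAt_inv {q x : ℝ} (hq : q ∈ Ico (0 : ℝ) (1 / 3)) (hx : x ∈ range q) :
    HasDerivAt (inv q) (ampD q (inv q x))⁻¹ x := by
  have hn := range_mem_nhds hq hx
  have hc : ContinuousAt (inv q) x := by
    have h : ContinuousOn ((fun z : ℝ × ℝ => inv z.1 z.2) ∘ fun x => (q, x)) (range q) :=
      continuousOn_inv.comp (by fun_prop) fun x hx => ⟨hq, hx⟩
    exact h.continuousAt hn
  refine HasDerivAt.of_local_left_inverse hc (hasDerivAt_amp hq (inv_mem hx))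
    (ampD_pos hq (inv_mem hx)).ne' ?_
  filter_upwards [hn] with w hw using amp_inv hw

theorem inv_zero {q : ℝ} (hq : q ∈ Ico (0 : ℝ) (1 / 3)) : inv q 0 = 1 := by
  conv_lhs => rw [← amp_one q]
  exact inv_amp hq (one_mem_dom hq)

theorem zero_mem_range {q : ℝ} (hq : q ∈ Ico (0 : ℝ) (1 / 3)) : (0 : ℝ) ∈ range q :=
  ⟨1, one_mem_dom hq, amp_one q⟩

theorem strictMonoOn_inv {q : ℝ} (hq : q ∈ Ico (0 : ℝ) (1 / 3)) :
    StrictMonoOn (inv q) (range q) := fun x hx x' hx' h => by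
  rw [inv_lt_iff hq hx (inv_mem hx'), amp_inv hx']
  exact h

end LichWell

namespace LichWell

/-! ### Convexity of `pot / force ^ 2` -/

noncomputable def forceD (q y : ℝ) : ℝ := 5 * (1 - q) * y ^ 4 - 7 * q / y ^ 8 - 1

noncomputable def forceDD (q y : ℝ) : ℝ := 20 * (1 - q) * y ^ 3 + 56 * q / y ^ 9

noncomputable def forceDDD (q y : ℝ) : ℝ := 60 * (1 - q) * y ^ 2 - 504 * q / y ^ 10

theorem hasDerivAt_inv_pow {y : ℝ} (hy : y ≠ 0) (c : ℝ) (n : ℕ) :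
    HasDerivAt (fun y : ℝ => c / y ^ n) (-(c * n) / y ^ (n + 1)) y := by
  have h := (hasDerivAt_const y c).div (hasDerivAt_pow n y) (by positivity)
  refine h.congr_deriv ?_
  rcases n with _ | n
  · simp
  · have : y ^ (n + 1) ≠ 0 := by positivity
    simp only [add_tsub_cancel_right]
    field_simp
    ring

theorem hasDerivAt_force {q y : ℝ} (hy : y ≠ 0) : HasDerivAt (force q) (forceD q y) y := by
  have h := (((hasDerivAt_pow 5 y).const_mul (1 - q)).add (hasDerivAt_inv_pow hy q 7)).sub
    (hasDerivAt_id y)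
  refine h.congr_deriv ?_
  unfold forceD
  push_cast
  field_simp
  ring

theorem hasDerivAt_forceD {q y : ℝ} (hy : y ≠ 0) : HasDerivAt (forceD q) (forceDD q y) y := by
  have h := (((hasDerivAt_pow 4 y).const_mul (5 * (1 - q))).sub
    (hasDerivAt_inv_pow hy (7 * q) 8)).sub_const 1
  refine h.congr_deriv ?_
  unfold forceDD
  push_cast
  field_simp
  ring

theorem hasDerivAt_forceDD {q y : ℝ} (hy : y ≠ 0) : HasDerivAt (forceDD q) (forceDDD q y) y := by
  have h := ((hasDerivAt_pow 3 y).const_mul (20 * (1 - q))).add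
    (hasDerivAt_inv_pow hy (56 * q) 9)
  refine h.congr_deriv ?_
  unfold forceDDD
  push_cast
  field_simp
  ring

theorem forceD_mono {q y y' : ℝ} (hq : q ∈ Ico (0 : ℝ) (1 / 3)) (hy : 0 < y) (h : y ≤ y') :
    forceD q y ≤ forceD q y' := by
  obtain ⟨hq0, hq1⟩ := hq
  have hp : 0 ≤ 1 - q := by linarith
  unfold forceD
  gcongr

theorem forceD_one_pos {q : ℝ} (hq : q ∈ Ico (0 : ℝ) (1 / 3)) : 0 < forceD q 1 := by
  have := hq.2
  unfold forceD
  norm_num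
  linarith

theorem forceDD_pos {q y : ℝ} (hq : q ∈ Ico (0 : ℝ) (1 / 3)) (hy : 0 < y) : 0 < forceDD q y := by
  obtain ⟨hq0, hq1⟩ := hq
  have hp : 0 < 1 - q := by linarith
  unfold forceDD
  positivity

theorem force_pos {q y : ℝ} (hq : q ∈ Ico (0 : ℝ) (1 / 3)) (hy : 1 < y) : 0 < force q y := by
  have h := dom_upward hq (one_mem_dom hq) hy.le
  have h0 := h.1
  have h2 := h.2
  rw [force_eq h0.ne']
  have : 0 < y ^ 4 - 1 := sub_pos.2 (one_lt_pow₀ hy (by norm_num))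
  positivity

theorem force_neg {q y : ℝ} (hy : y ∈ dom q) (hy1 : y < 1) : force q y < 0 := by
  have h0 := hy.1
  have h2 := hy.2
  rw [force_eq h0.ne']
  have : y ^ 4 - 1 < 0 := sub_neg.2 (pow_lt_one₀ h0.le hy1 (by norm_num))
  exact div_neg_of_neg_of_pos (mul_neg_of_neg_of_pos this h2) (by positivity)

theorem force_one (q : ℝ) : force q 1 = 0 := by simp [force]

theorem pot_one (q : ℝ) : pot q 1 = 0 := by simp [pot]

theorem pot_pos {q y : ℝ} (hq : q ∈ Ico (0 : ℝ) (1 / 3)) (hy : y ∈ dom q) (h1 : y ≠ 1) :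
    0 < pot q y := by
  have h := amp_sq hq hy
  have hk := sqrt_pos.2 (kap_pos hq hy)
  have : y ^ 2 - 1 ≠ 0 := fun h => h1 (by nlinarith [hy.1])
  have : 0 < amp q y ^ 2 := by unfold amp; positivity
  linarith

/-- Schaaf's condition for monotone periods. The only negative term is -378 q y⁸, and `forceD` > 0
bounds y⁸ by 5(1-q)y¹² - 7q, so the mixed term 5005(1-q)q y¹² absorbs it. -/
theorem schaaf_pos {q y : ℝ} (hq : q ∈ Ico (0 : ℝ) (1 / 3)) (hy : 0 < y) (h : 0 < forceD q y) :
    0 < 5 * forceDD q y ^ 2 - 3 * forceD q y * forceDDD q y := by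
  obtain ⟨hq0, hq1⟩ := hq
  have hp : 0 < 1 - q := by linarith
  have e : 5 * forceDD q y ^ 2 - 3 * forceD q y * forceDDD q y =
      4 * (275 * (1 - q) ^ 2 * y ^ 24 + 5005 * (1 - q) * q * y ^ 12 + 1274 * q ^ 2
        + 45 * (1 - q) * y ^ 20 - 378 * q * y ^ 8) / y ^ 18 := by
    unfold forceD forceDD forceDDD
    field_simp
    ring
  have h8 : y ^ 8 < 5 * (1 - q) * y ^ 12 - 7 * q := by
    have : forceD q y * y ^ 8 = 5 * (1 - q) * y ^ 12 - 7 * q - y ^ 8 := by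
      unfold forceD
      field_simp
    have := mul_pos h (pow_pos hy 8)
    linarith
  rw [e]
  apply div_pos _ (by positivity)
  have a1 : 0 < (1 - q) ^ 2 * y ^ 24 := by positivity
  have a2 : 0 ≤ (1 - q) * q * y ^ 12 := by positivity
  have a3 : 0 < (1 - q) * y ^ 20 := by positivity
  nlinarith [mul_le_mul_of_nonneg_left h8.le hq0]

/-- Controls the denominator of `schaaf`. To the left of 1 the signs of `force` and `forceDD`
suffice. -/
theorem three_forceD_sq_sub_pos {q y : ℝ} (hq : q ∈ Ico (0 : ℝ) (1 / 3)) (hy : y ∈ dom q)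
    (h : 0 < forceD q y) : 0 < 3 * forceD q y ^ 2 - force q y * forceDD q y := by
  rcases le_or_gt y 1 with h1 | h1
  · have hf : force q y ≤ 0 := by
      rcases h1.eq_or_lt with rfl | h1
      · exact (force_one q).le
      · exact (force_neg hy h1).le
    have := mul_nonneg (neg_nonneg.2 hf) (forceDD_pos hq hy.1).le
    have : 0 < forceD q y ^ 2 := by positivity
    linarith
  · have h0 := hy.1
    have e : 3 * forceD q y ^ 2 - force q y * forceDD q y =
        (55 * (1 - q) ^ 2 * y ^ 24 + 91 * q ^ 2 + 3 * y ^ 16 - 286 * (1 - q) * q * y ^ 12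
          - 10 * (1 - q) * y ^ 20 + 98 * q * y ^ 8) / y ^ 16 := by
      unfold force forceD forceDD
      field_simp
      ring
    rw [e]
    apply div_pos _ (by positivity)
    -- Expanding about the degenerate corner y = 1, q = 1/3 leaves only positive coefficients.
    obtain ⟨d, hd⟩ : ∃ d, y ^ 4 = 1 + d := ⟨y ^ 4 - 1, by ring⟩
    obtain ⟨t, ht⟩ : ∃ t, q = 1 / 3 - t := ⟨1 / 3 - q, by ring⟩
    have hd0 : 0 < d := by have := one_lt_pow₀ h1 (n := 4) (by norm_num); linarith
    have ht0 : 0 < t := by have := hq.2; linarith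
    have e2 : 55 * (1 - q) ^ 2 * y ^ 24 + 91 * q ^ 2 + 3 * y ^ 16 - 286 * (1 - q) * q * y ^ 12
        - 10 * (1 - q) * y ^ 20 + 98 * q * y ^ 8 =
      432 * t ^ 2 + d * (480 * t + 1188 * t ^ 2) + d ^ 2 * (160 + 1188 * t + 1683 * t ^ 2)
        + d ^ 3 * (1112 / 3 + 1462 * t + 1386 * t ^ 2)
        + d ^ 4 * (1009 / 3 + 1050 * t + 825 * t ^ 2) + d ^ 5 * (140 + 430 * t + 330 * t ^ 2)
        + d ^ 6 * (220 / 9 + 220 / 3 * t + 55 * t ^ 2) := by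
      rw [show y ^ 24 = (y ^ 4) ^ 6 by ring, show y ^ 16 = (y ^ 4) ^ 4 by ring,
        show y ^ 12 = (y ^ 4) ^ 3 by ring, show y ^ 20 = (y ^ 4) ^ 5 by ring,
        show y ^ 8 = (y ^ 4) ^ 2 by ring, hd, ht]
      ring
    rw [e2]
    positivity

/-- Schaaf's auxiliary function. -/
noncomputable def schaaf (q y : ℝ) : ℝ :=
  pot q y - 3 * (forceD q y * force q y ^ 2)
    / (2 * (3 * forceD q y ^ 2 - force q y * forceDD q y))

theorem hasDerivAt_schaaf {q y : ℝ} (hy : y ≠ 0)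
    (hQ : 3 * forceD q y ^ 2 - force q y * forceDD q y ≠ 0) :
    HasDerivAt (schaaf q) (force q y ^ 3 * (5 * forceDD q y ^ 2 - 3 * forceD q y * forceDDD q y)
      / (2 * (3 * forceD q y ^ 2 - force q y * forceDD q y) ^ 2)) y := by
  have h0 := hasDerivAt_force (q := q) hy
  have h1 := hasDerivAt_forceD (q := q) hy
  have h2 := hasDerivAt_forceDD (q := q) hy
  have h := (hasDerivAt_pot (q := q) hy).sub (((h1.mul (h0.pow 2)).const_mul 3).div
    ((((h1.pow 2).const_mul 3).sub (h0.mul h2)).const_mul 2)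
    (by simpa using hQ))
  refine h.congr_deriv ?_
  simp only [Pi.mul_apply, Pi.sub_apply, Pi.pow_apply]
  generalize force q y = f at *
  generalize forceD q y = f1 at *
  generalize forceDD q y = f2 at *
  field_simp
  push_cast
  ring

/-- `schaaf` vanishes at 1, and by `schaaf_pos` its derivative has the sign of `force`: negative to
the left of 1, positive to the right. Positivity of `forceD` holds on the whole segment between y
and 1 because `forceD` is monotone. -/
theorem schaaf_pos_of_ne_one {q y : ℝ} (hq : q ∈ Ico (0 : ℝ) (1 / 3)) (hy : y ∈ dom q)
    (h1 : y ≠ 1) (h : 0 < forceD q y) : 0 < schaaf q y := by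
  have hS : schaaf q 1 = 0 := by simp [schaaf, pot_one, force_one]
  have key : ∀ s ∈ dom q, 0 < forceD q s → HasDerivAt (schaaf q) (force q s ^ 3 *
      ((5 * forceDD q s ^ 2 - 3 * forceD q s * forceDDD q s)
      / (2 * (3 * forceD q s ^ 2 - force q s * forceDD q s) ^ 2))) s ∧
      0 < (5 * forceDD q s ^ 2 - 3 * forceD q s * forceDDD q s)
      / (2 * (3 * forceD q s ^ 2 - force q s * forceDD q s) ^ 2) := fun s hs hf => by
    have hQ := three_forceD_sq_sub_pos hq hs hf
    have hs' := schaaf_pos hq hs.1 hf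
    refine ⟨(hasDerivAt_schaaf hs.1.ne' hQ.ne').congr_deriv (by ring), by positivity⟩
  rw [← hS]
  rcases h1.lt_or_gt with h1 | h1
  · have hk : ∀ s ∈ Icc y 1, _ := fun s hs => key s (dom_upward hq hy hs.1)
      (h.trans_le (forceD_mono hq hy.1 hs.1))
    refine strictAntiOn_of_deriv_neg (convex_Icc y 1)
      (fun s hs => (hk s hs).1.continuousAt.continuousWithinAt) (fun s hs => ?_)
      (left_mem_Icc.2 h1.le) (right_mem_Icc.2 h1.le) h1
    rw [interior_Icc] at hs
    rw [(hk s (Ioo_subset_Icc_self hs)).1.deriv]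
    refine mul_neg_of_neg_of_pos ?_ (hk s (Ioo_subset_Icc_self hs)).2
    exact Odd.pow_neg (by decide) (force_neg (dom_upward hq hy hs.1.le) hs.2)
  · have hk : ∀ s ∈ Icc 1 y, _ := fun s hs => key s (dom_upward hq (one_mem_dom hq) hs.1)
      ((forceD_one_pos hq).trans_le (forceD_mono hq one_pos hs.1))
    refine strictMonoOn_of_deriv_pos (convex_Icc 1 y)
      (fun s hs => (hk s hs).1.continuousAt.continuousWithinAt) (fun s hs => ?_)
      (left_mem_Icc.2 h1.le) (right_mem_Icc.2 h1.le) h1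
    rw [interior_Icc] at hs
    rw [(hk s (Ioo_subset_Icc_self hs)).1.deriv]
    exact mul_pos (pow_pos (force_pos hq hs.1) 3) (hk s (Ioo_subset_Icc_self hs)).2

/-- This is the numerator of the second derivative of pot / force². Where `forceD` ≤ 0 one has y < 1
and no term is negative; where `forceD` > 0 it is positivity of `schaaf` with the denominator
cleared. -/
theorem chicone_pos {q y : ℝ} (hq : q ∈ Ico (0 : ℝ) (1 / 3)) (hy : y ∈ dom q) (h1 : y ≠ 1) :
    0 < 6 * pot q y * forceD q y ^ 2 - 3 * forceD q y * force q y ^ 2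
      - 2 * pot q y * force q y * forceDD q y := by
  have hF := pot_pos hq hy h1
  rcases le_or_gt (forceD q y) 0 with h | h
  · have hy1 : y < 1 := by
      by_contra hc
      exact absurd ((forceD_one_pos hq).trans_le (forceD_mono hq one_pos (not_lt.1 hc))) h.not_gt
    have hf := force_neg hy hy1
    have := mul_pos (mul_pos hF (neg_pos.2 hf)) (forceDD_pos hq hy.1)
    have := mul_nonneg (neg_nonneg.2 h) (sq_nonneg (force q y))
    have := mul_nonneg hF.le (sq_nonneg (forceD q y))
    linarith
  · have hQ := three_forceD_sq_sub_pos hq hy h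
    have hS := schaaf_pos_of_ne_one hq hy h1 h
    unfold schaaf at hS
    rw [sub_pos, div_lt_iff₀ (by positivity)] at hS
    linarith

/-- `pot / force ^ 2`, extended smoothly across `1`. -/
noncomputable def chicone (q y : ℝ) : ℝ :=
  y ^ 8 * ((1 - q) * y ^ 8 + 2 * (1 - q) * y ^ 6 - 3 * q * y ^ 4 - 2 * q * y ^ 2 - q)
    / (6 * ((y ^ 2 + 1) * quart q y) ^ 2)

theorem contDiffAt_chicone {q y : ℝ} (hy : y ∈ dom q) : ContDiffAt ℝ 2 (chicone q) y := by
  have h2 := hy.2.ne'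
  have h3 : (y ^ 2 + 1) ≠ 0 := by positivity
  have h4 : 6 * ((y ^ 2 + 1) * quart q y) ^ 2 ≠ 0 := by positivity
  unfold chicone
  unfold quart at *
  exact ContDiffAt.div (by fun_prop) (by fun_prop) h4

theorem chicone_eq {q y : ℝ} (hy : y ∈ dom q) (h1 : y ≠ 1) :
    chicone q y = pot q y / force q y ^ 2 := by
  have h0 := hy.1.ne'
  have h2 := hy.2.ne'
  have h3 : y ^ 2 - 1 ≠ 0 := fun h => h1 (by nlinarith [hy.1])
  have h5 : y ^ 2 + 1 ≠ 0 := by positivity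
  rw [force_eq h0, show y ^ 4 - 1 = (y ^ 2 - 1) * (y ^ 2 + 1) by ring]
  unfold chicone pot
  generalize quart q y = B at *
  field_simp
  ring

/-- Away from 1 this combines amp * ampD = force with amp² = 2 pot; the cancelled form of `chicone`
makes it valid at 1 too. -/
theorem chicone_eq_ampD {q y : ℝ} (hq : q ∈ Ico (0 : ℝ) (1 / 3)) (hy : y ∈ dom q) :
    (ampD q y)⁻¹ ^ 2 = 2 * chicone q y := by
  have h0 := hy.1.ne'
  have h2 := hy.2.ne'
  have h5 : y ^ 2 + 1 ≠ 0 := by positivity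
  have hs := (sqrt_pos.2 (kap_pos hq hy)).ne'
  have hs2 := sq_sqrt (kap_pos hq hy).le
  have e : (√(kap q y)) ^ 2 * (3 * y ^ 6) = ((1 - q) * y ^ 8 + 2 * (1 - q) * y ^ 6
      - 3 * q * y ^ 4 - 2 * q * y ^ 2 - q) := by
    rw [hs2]; unfold kap; field_simp
  unfold ampD chicone
  rw [← e]
  field_simp
  norm_num

theorem deriv_chicone {q y : ℝ} (hy : y ∈ dom q) (h1 : y ≠ 1) :
    deriv (chicone q) y = (force q y ^ 2 - 2 * pot q y * forceD q y) / force q y ^ 3 := by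
  have hf : force q y ≠ 0 := by
    have h0 := hy.1.ne'
    have h2 := hy.2.ne'
    have h3 : y ^ 2 - 1 ≠ 0 := fun h => h1 (by nlinarith [hy.1])
    rw [force_eq h0, show y ^ 4 - 1 = (y ^ 2 - 1) * (y ^ 2 + 1) by ring]
    positivity
  have h : HasDerivAt (fun y => pot q y / force q y ^ 2)
      ((force q y ^ 2 - 2 * pot q y * forceD q y) / force q y ^ 3) y := by
    refine ((hasDerivAt_pot (q := q) hy.1.ne').div ((hasDerivAt_force hy.1.ne').pow 2)
      (pow_ne_zero 2 hf)).congr_deriv ?_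
    simp only [Pi.pow_apply]
    field_simp
    ring
  refine (h.congr_of_eventuallyEq ?_).deriv
  filter_upwards [(isOpen_dom q).mem_nhds hy, isOpen_ne.mem_nhds h1] with s hs hs1
    using chicone_eq hs hs1

theorem deriv_deriv_chicone_pos {q y : ℝ} (hq : q ∈ Ico (0 : ℝ) (1 / 3)) (hy : y ∈ dom q)
    (h1 : y ≠ 1) : 0 < deriv (deriv (chicone q)) y := by
  have hf : force q y ≠ 0 := by
    rcases h1.lt_or_gt with h | h
    · exact (force_neg hy h).ne
    · exact (force_pos hq h).ne'
  have h0 := hasDerivAt_force (q := q) hy.1.ne'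
  have h : HasDerivAt (fun y => (force q y ^ 2 - 2 * pot q y * forceD q y) / force q y ^ 3)
      ((6 * pot q y * forceD q y ^ 2 - 3 * forceD q y * force q y ^ 2
      - 2 * pot q y * force q y * forceDD q y) / force q y ^ 4) y := by
    refine (((h0.pow 2).sub (((hasDerivAt_pot (q := q) hy.1.ne').const_mul 2).mul
      (hasDerivAt_forceD hy.1.ne'))).div (h0.pow 3) (pow_ne_zero 3 hf)).congr_deriv ?_
    simp only [Pi.pow_apply, Pi.mul_apply, Pi.sub_apply]
    field_simp
    push_cast
    ring
  have he : deriv (chicone q) =ᶠ[𝓝 y]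
      fun y => (force q y ^ 2 - 2 * pot q y * forceD q y) / force q y ^ 3 := by
    filter_upwards [(isOpen_dom q).mem_nhds hy, isOpen_ne.mem_nhds h1] with s hs hs1
      using deriv_chicone hs hs1
  rw [(h.congr_of_eventuallyEq he).deriv]
  have := chicone_pos hq hy h1
  positivity

theorem continuousAt_deriv_chicone {q y : ℝ} (hy : y ∈ dom q) :
    ContinuousAt (deriv (chicone q)) y :=
  (((contDiffAt_chicone hy).fderiv_right (m := 1) (by norm_num)).continuousAt.clm_apply
    continuousAt_const).congr (Eventually.of_forall fun _ => rfl)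

/-- The sign of the second derivative is known only away from 1; continuity of the first derivative
glues the two sides. -/
theorem strictMonoOn_deriv_chicone {q : ℝ} (hq : q ∈ Ico (0 : ℝ) (1 / 3)) :
    StrictMonoOn (deriv (chicone q)) (dom q) := by
  have h1 : StrictMonoOn (deriv (chicone q)) (dom q ∩ Iic 1) := by
    refine strictMonoOn_of_deriv_pos ((convex_dom hq).inter (convex_Iic 1))
      (fun s hs => (continuousAt_deriv_chicone hs.1).continuousWithinAt) fun s hs => ?_
    rw [interior_inter, interior_Iic] at hs
    exact deriv_deriv_chicone_pos hq (interior_subset hs.1) hs.2.ne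
  have h2 : StrictMonoOn (deriv (chicone q)) (Ici 1) := by
    have hd : ∀ s ∈ Ici (1 : ℝ), s ∈ dom q := fun s hs => dom_upward hq (one_mem_dom hq) hs
    refine strictMonoOn_of_deriv_pos (convex_Ici 1)
      (fun s hs => (continuousAt_deriv_chicone (hd s hs)).continuousWithinAt) fun s hs => ?_
    rw [interior_Ici] at hs
    exact deriv_deriv_chicone_pos hq (hd s (show (1:ℝ) ≤ s from le_of_lt hs)) (ne_of_gt hs)
  have h := h1.union h2 (c := 1) ⟨⟨one_mem_dom hq, self_mem_Iic⟩, fun s hs => hs.2⟩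
    ⟨self_mem_Ici, fun s hs => hs⟩
  refine h.mono fun s hs => ?_
  rcases le_total s 1 with h | h
  · exact Or.inl ⟨hs, h⟩
  · exact Or.inr h

/-! ### The derivative of the inverse -/

/-- The derivative of `inv q`. -/
noncomputable def rate (q x : ℝ) : ℝ := (ampD q (inv q x))⁻¹

theorem rate_pos {q x : ℝ} (hq : q ∈ Ico (0 : ℝ) (1 / 3)) (hx : x ∈ range q) : 0 < rate q x :=
  inv_pos.2 (ampD_pos hq (inv_mem hx))

/-- Since rate² = 2 chicone ∘ inv and inv' = rate, the factor `rate` cancels. This is how convexity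
of `chicone` enters the period. -/
theorem hasDerivAt_rate {q x : ℝ} (hq : q ∈ Ico (0 : ℝ) (1 / 3)) (hx : x ∈ range q) :
    HasDerivAt (rate q) (deriv (chicone q) (inv q x)) x := by
  have hm := inv_mem hx
  have hr := rate_pos hq hx
  have hc : ∀ w ∈ range q, rate q w = √(2 * chicone q (inv q w)) := fun w hw => by
    rw [← chicone_eq_ampD hq (inv_mem hw)]
    exact (sqrt_sq (rate_pos hq hw).le).symm
  have hd : HasDerivAt (fun w => 2 * chicone q (inv q w))
      (2 * (deriv (chicone q) (inv q x) * rate q x)) x :=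
    ((((contDiffAt_chicone hm).differentiableAt (by norm_num)).hasDerivAt).comp x
      (hasDerivAt_inv hq hx)).const_mul 2
  have hne : 2 * chicone q (inv q x) ≠ 0 := by
    rw [← chicone_eq_ampD hq hm]
    exact (pow_pos hr 2).ne'
  have h := hd.sqrt hne
  rw [← hc x hx] at h
  refine (h.congr_of_eventuallyEq ?_).congr_deriv (by field_simp)
  filter_upwards [range_mem_nhds hq hx] with w hw using hc w hw

/-- The derivative is the difference of `deriv (chicone q)` at the two points of equal potential on
either side of 1. -/
theorem strictMonoOn_rate_add {q r : ℝ} (hq : q ∈ Ico (0 : ℝ) (1 / 3)) (hr : -r ∈ range q) :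
    StrictMonoOn (fun x => rate q x + rate q (-x)) (Icc 0 r) := by
  have hm : ∀ x ∈ Icc 0 r, x ∈ range q ∧ -x ∈ range q := fun x hx =>
    ⟨range_upward hq (zero_mem_range hq) hx.1, range_upward hq hr (neg_le_neg hx.2)⟩
  have hd : ∀ x ∈ Icc 0 r, HasDerivAt (fun x => rate q x + rate q (-x))
      (deriv (chicone q) (inv q x) + deriv (chicone q) (inv q (-x)) * (-1)) x := fun x hx =>
    (hasDerivAt_rate hq (hm x hx).1).add
      ((hasDerivAt_rate hq (hm x hx).2).comp x (hasDerivAt_neg x))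
  refine strictMonoOn_of_deriv_pos (convex_Icc 0 r)
    (fun x hx => (hd x hx).continuousAt.continuousWithinAt) fun x hx => ?_
  rw [interior_Icc] at hx
  have hx' := Ioo_subset_Icc_self hx
  rw [(hd x hx').deriv]
  have h1 := strictMonoOn_inv hq (hm x hx').2 (hm x hx').1 (by linarith [hx.1])
  have := strictMonoOn_deriv_chicone hq (inv_mem (hm x hx').2) (inv_mem (hm x hx').1) h1
  linarith

theorem continuousOn_rate : ContinuousOn (fun z : ℝ × ℝ => rate z.1 z.2) invDom := by
  intro z hz
  have h1 : ContinuousWithinAt (fun z : ℝ × ℝ => (z.1, inv z.1 z.2)) invDom z :=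
    continuous_fst.continuousWithinAt.prodMk (continuousOn_inv z hz)
  have h2 : ContinuousAt (fun z : ℝ × ℝ => ampD z.1 z.2) (z.1, inv z.1 z.2) :=
    continuousAt_ampD hz.1 (inv_mem hz.2)
  exact (ContinuousAt.comp_continuousWithinAt
    (f := fun z : ℝ × ℝ => (z.1, inv z.1 z.2)) h2 h1).inv₀ (ampD_pos hz.1 (inv_mem hz.2)).ne'

/-- 4 - 12q is `forceD q 1`, the squared frequency of small oscillations about y = 1. -/
theorem rate_zero {q : ℝ} (hq : q ∈ Ico (0 : ℝ) (1 / 3)) : rate q 0 ^ 2 * (4 - 12 * q) = 1 := by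
  unfold rate
  rw [inv_zero hq, chicone_eq_ampD hq (one_mem_dom hq)]
  unfold chicone quart
  have : 1 - 3 * q ≠ 0 := by have := hq.2; intro h; linarith
  have : 1 - q - q - q ≠ 0 := by intro h; apply this; linarith
  norm_num
  field_simp
  ring

end LichWell

namespace LichWell

/-! ### The explicit periodic orbits -/

/-- The parameters `(q, r)` of the periodic orbits: the orbit starts at `inv q r`. -/
def orbits : Set (ℝ × ℝ) := {z | z.1 ∈ Ico (0 : ℝ) (1 / 3) ∧ -|z.2| ∈ range z.1}

theorem mul_cos_mem_range {q r : ℝ} (h : (q, r) ∈ orbits) (s : ℝ) : r * cos s ∈ range q := by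
  refine range_upward h.1 h.2 ?_
  have : |r * cos s| ≤ |r| := by
    rw [abs_mul]
    exact mul_le_of_le_one_right (abs_nonneg r) (abs_cos_le_one s)
  exact (abs_le.1 this).1

theorem neg_mem_orbits {q r : ℝ} (h : (q, r) ∈ orbits) : (q, -r) ∈ orbits :=
  ⟨h.1, by simpa using h.2⟩

theorem orbits_of_abs_le {q r r' : ℝ} (h : (q, r) ∈ orbits) (hr : |r'| ≤ |r|) :
    (q, r') ∈ orbits :=
  ⟨h.1, range_upward h.1 h.2 (neg_le_neg hr)⟩

theorem zero_mem_orbits {q : ℝ} (hq : q ∈ Ico (0 : ℝ) (1 / 3)) : (q, (0 : ℝ)) ∈ orbits :=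
  ⟨hq, by simpa using zero_mem_range hq⟩

theorem eventually_mem_orbits {q r : ℝ} (h : (q, r) ∈ orbits) :
    ∀ᶠ z : ℝ × ℝ in 𝓝 (q, r), z.1 ∈ Ico (0 : ℝ) (1 / 3) → z ∈ orbits := by
  obtain ⟨y, hy, hy1⟩ := exists_lt_mem_dom (inv_mem h.2) (sub_one_lt (inv q (-|r|)))
  have h1 := eventually_amp_lt hy ((lt_inv_iff h.1 h.2 hy).1 hy1.2)
  have h2 : Tendsto (fun z : ℝ × ℝ => (z.1, -|z.2|)) (𝓝 (q, r)) (𝓝 (q, -|r|)) :=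
    Continuous.tendsto' (by fun_prop) _ _ rfl
  filter_upwards [h2.eventually h1] with z hz hq
  exact ⟨hq, range_upward hq ⟨y, hz.1, rfl⟩ hz.2.le⟩

/-- The time needed by the orbit to turn by the angle `θ`. -/
noncomputable def elapsed (q r θ : ℝ) : ℝ := ∫ s in (0 : ℝ)..θ, rate q (r * cos s)

theorem continuous_rate_cos :
    Continuous (fun w : orbits × ℝ => rate w.1.1.1 (w.1.1.2 * cos w.2)) := by
  have h : Continuous fun w : orbits × ℝ => (w.1.1.1, w.1.1.2 * cos w.2) := by fun_prop
  exact continuousOn_rate.comp_continuous h fun w => ⟨w.1.2.1, mul_cos_mem_range w.1.2 w.2⟩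

theorem continuous_rate {q r : ℝ} (h : (q, r) ∈ orbits) :
    Continuous fun s => rate q (r * cos s) := by
  have hc : Continuous fun s : ℝ => ((⟨(q, r), h⟩ : orbits), s) := by fun_prop
  have := continuous_rate_cos.comp hc
  exact this

theorem continuous_elapsed :
    Continuous fun w : orbits × ℝ => elapsed w.1.1.1 w.1.1.2 w.2 := by
  unfold elapsed
  refine intervalIntegral.continuous_parametric_intervalIntegral_of_continuous
    (f := fun (w : orbits × ℝ) s => rate w.1.1.1 (w.1.1.2 * cos s)) ?_ continuous_snd
  exact continuous_rate_cos.comp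
    (by fun_prop : Continuous fun w : (orbits × ℝ) × ℝ => (w.1.1, w.2))

section

variable {q r : ℝ} (h : (q, r) ∈ orbits)

include h

theorem hasDerivAt_elapsed (θ : ℝ) : HasDerivAt (elapsed q r) (rate q (r * cos θ)) θ :=
  intervalIntegral.integral_hasDerivAt_right ((continuous_rate h).intervalIntegrable _ _)
    ((continuous_rate h).stronglyMeasurableAtFilter _ _) (continuous_rate h).continuousAt

theorem strictMono_elapsed : StrictMono (elapsed q r) :=
  strictMono_of_deriv_pos fun θ => by
    rw [(hasDerivAt_elapsed h θ).deriv]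
    exact rate_pos h.1 (mul_cos_mem_range h θ)

theorem surjective_elapsed : Function.Surjective (elapsed q r) := by
  have hp : Function.Periodic (fun s => rate q (r * cos s)) (2 * π) := fun s => by
    simp only [cos_add_two_pi]
  have hi : ∀ t₁ t₂, IntervalIntegrable (fun s => rate q (r * cos s)) MeasureTheory.volume t₁ t₂ :=
    fun t₁ t₂ => (continuous_rate h).intervalIntegrable _ _
  have h0 : 0 < ∫ s in (0 : ℝ)..2 * π, rate q (r * cos s) := by
    have := strictMono_elapsed h two_pi_pos
    simpa [elapsed] using this
  exact (continuous_iff_continuousAt.2 fun θ => (hasDerivAt_elapsed h θ).continuousAt).surjective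
    (hp.tendsto_atTop_intervalIntegral_of_pos h0 two_pi_pos)
    (hp.tendsto_atBot_intervalIntegral_of_pos h0 two_pi_pos)

end

/-! ### The flow along an orbit, its symmetries and its period. -/

/-- The angle reached at time `t`. -/
noncomputable def angle (q r t : ℝ) : ℝ := Function.invFun (elapsed q r) t

/-- The position at time `t`. -/
noncomputable def pos (q r t : ℝ) : ℝ := inv q (r * cos (angle q r t))

/-- The velocity at time `t`. -/
noncomputable def vel (q r t : ℝ) : ℝ := -(r * sin (angle q r t))

/-- Half of the period. -/
noncomputable def half (q r : ℝ) : ℝ := elapsed q r π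

section

variable {q r : ℝ} (h : (q, r) ∈ orbits)

include h

theorem elapsed_angle (t : ℝ) : elapsed q r (angle q r t) = t :=
  Function.rightInverse_invFun (surjective_elapsed h) t

theorem angle_elapsed (θ : ℝ) : angle q r (elapsed q r θ) = θ :=
  Function.leftInverse_invFun (strictMono_elapsed h).injective θ

theorem lt_angle_iff (θ t : ℝ) : θ < angle q r t ↔ elapsed q r θ < t := by
  rw [← (strictMono_elapsed h).lt_iff_lt, elapsed_angle h]

theorem angle_lt_iff (θ t : ℝ) : angle q r t < θ ↔ t < elapsed q r θ := by
  rw [← (strictMono_elapsed h).lt_iff_lt, elapsed_angle h]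

end

/-- As for `inv`, a bound on the angle is equivalent to an inequality for `elapsed`, which is
jointly continuous. -/
theorem continuous_angle : Continuous fun w : orbits × ℝ => angle w.1.1.1 w.1.1.2 w.2 := by
  have hc (θ : ℝ) : Continuous fun w : orbits × ℝ => elapsed w.1.1.1 w.1.1.2 θ :=
    continuous_elapsed.comp (by fun_prop : Continuous fun w : orbits × ℝ => (w.1, θ))
  refine continuous_iff_continuousAt.2 fun w => tendsto_order.2 ⟨fun a ha => ?_, fun a ha => ?_⟩
  · have := (hc a).continuousAt.eventually_lt continuousAt_snd ((lt_angle_iff w.1.2 _ _).1 ha)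
    filter_upwards [this] with v hv using (lt_angle_iff v.1.2 _ _).2 hv
  · have := continuousAt_snd.eventually_lt (hc a).continuousAt ((angle_lt_iff w.1.2 _ _).1 ha)
    filter_upwards [this] with v hv using (angle_lt_iff v.1.2 _ _).2 hv

theorem continuous_pos : Continuous fun w : orbits × ℝ => pos w.1.1.1 w.1.1.2 w.2 := by
  have hc : Continuous fun w : orbits × ℝ => (w.1.1.1, w.1.1.2 * cos (angle w.1.1.1 w.1.1.2 w.2)) :=
    (by fun_prop : Continuous fun w : orbits × ℝ => w.1.1.1).prodMk
      ((by fun_prop : Continuous fun w : orbits × ℝ => w.1.1.2).mul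
        (continuous_cos.comp continuous_angle))
  exact continuousOn_inv.comp_continuous hc fun w => ⟨w.1.2.1, mul_cos_mem_range w.1.2 _⟩

theorem continuous_vel : Continuous fun w : orbits × ℝ => vel w.1.1.1 w.1.1.2 w.2 :=
  ((by fun_prop : Continuous fun w : orbits × ℝ => w.1.1.2).mul
    (continuous_sin.comp continuous_angle)).neg

section

variable {q r : ℝ} (h : (q, r) ∈ orbits)

include h

theorem pos_mem_dom (t : ℝ) : pos q r t ∈ dom q := inv_mem (mul_cos_mem_range h _)

theorem amp_pos (t : ℝ) : amp q (pos q r t) = r * cos (angle q r t) :=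
  amp_inv (mul_cos_mem_range h _)

theorem hasDerivAt_angle (t : ℝ) :
    HasDerivAt (angle q r) (ampD q (pos q r t)) t := by
  have hc : Continuous (angle q r) := by
    have hf : Continuous fun s : ℝ => ((⟨(q, r), h⟩ : orbits), s) := by fun_prop
    have := continuous_angle.comp hf
    exact this
  have := HasDerivAt.of_local_left_inverse hc.continuousAt (hasDerivAt_elapsed h (angle q r t))
    (rate_pos h.1 (mul_cos_mem_range h _)).ne' (Eventually.of_forall (elapsed_angle h))
  simpa [rate, pos] using this

theorem hasDerivAt_pos (t : ℝ) : HasDerivAt (pos q r) (vel q r t) t := by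
  have h1 := (hasDerivAt_inv h.1 (mul_cos_mem_range h (angle q r t))).comp t
    ((hasDerivAt_angle h t).cos.const_mul r)
  refine h1.congr_deriv ?_
  have := (ampD_pos h.1 (pos_mem_dom h t)).ne'
  unfold vel
  unfold pos at *
  field_simp

/-- The angular speed is `ampD`, so the derivative of -r sin is -amp * ampD, which is minus the
force. -/
theorem hasDerivAt_vel (t : ℝ) : HasDerivAt (vel q r) (-force q (pos q r t)) t := by
  refine (((hasDerivAt_angle h t).sin.const_mul r).neg).congr_deriv ?_
  rw [← amp_mul_ampD h.1 (pos_mem_dom h t), amp_pos h]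
  ring

omit h in
theorem elapsed_zero : elapsed q r 0 = 0 := by simp [elapsed]

theorem angle_zero : angle q r 0 = 0 := by
  conv_lhs => rw [← elapsed_zero (q := q) (r := r)]
  exact angle_elapsed h 0

theorem pos_zero : pos q r 0 = inv q r := by simp [pos, angle_zero h]

theorem vel_zero : vel q r 0 = 0 := by simp [vel, angle_zero h]

omit h in
theorem elapsed_neg (θ : ℝ) : elapsed q r (-θ) = -elapsed q r θ := by
  have := intervalIntegral.integral_comp_neg (a := 0) (b := θ) (fun s => rate q (r * cos s))
  simp only [cos_neg, neg_zero] at this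
  unfold elapsed
  rw [this, intervalIntegral.integral_symm]

theorem angle_neg (t : ℝ) : angle q r (-t) = -angle q r t := by
  apply (strictMono_elapsed h).injective
  rw [elapsed_neg, elapsed_angle h, elapsed_angle h]

theorem pos_neg (t : ℝ) : pos q r (-t) = pos q r t := by
  unfold pos
  rw [angle_neg h, cos_neg]

/-- A half turn changes the sign of the cosine, hence of r: the orbits of radius r and -r are the
same orbit shifted by half a period. -/
theorem elapsed_add_pi (θ : ℝ) : elapsed q r (θ + π) = elapsed q (-r) θ + half q r := by
  have hi : ∀ t₁ t₂, IntervalIntegrable (fun s => rate q (r * cos s)) MeasureTheory.volume t₁ t₂ :=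
    fun t₁ t₂ => (continuous_rate h).intervalIntegrable _ _
  have := intervalIntegral.integral_comp_add_right (a := 0) (b := θ)
    (fun s => rate q (r * cos s)) π
  simp only [cos_add_pi, mul_neg, zero_add] at this
  unfold half elapsed
  simp only [neg_mul]
  rw [this, add_comm (∫ x in π..θ + π, rate q (r * cos x)),
    intervalIntegral.integral_add_adjacent_intervals (hi _ _) (hi _ _)]

omit h in
theorem half_neg : half q (-r) = half q r := by
  have := intervalIntegral.integral_comp_sub_left (a := 0) (b := π)
    (fun s => rate q (r * cos s)) π
  simp only [cos_pi_sub, mul_neg, sub_self, sub_zero] at this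
  unfold half elapsed
  simp only [neg_mul]
  exact this

theorem angle_add_half (t : ℝ) : angle q r (t + half q r) = angle q (-r) t + π := by
  apply (strictMono_elapsed h).injective
  rw [elapsed_angle h, elapsed_add_pi h, elapsed_angle (neg_mem_orbits h)]

theorem pos_add_half (t : ℝ) : pos q r (t + half q r) = pos q (-r) t := by
  unfold pos
  rw [angle_add_half h, cos_add_pi]
  congr 1
  ring

theorem angle_add_period (t : ℝ) : angle q r (t + 2 * half q r) = angle q r t + 2 * π := by
  have h1 := angle_add_half h (t + half q r)
  have h2 := angle_add_half (neg_mem_orbits h) t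
  rw [half_neg, neg_neg] at h2
  rw [two_mul, ← add_assoc, h1, h2]
  ring

theorem angle_add_nat_mul_period (k : ℕ) (t : ℝ) :
    angle q r (t + k * (2 * half q r)) = angle q r t + k * (2 * π) := by
  induction k with
  | zero => simp
  | succ k ih =>
    push_cast
    rw [add_mul, one_mul, ← add_assoc, angle_add_period h, ih]
    ring

theorem pos_periodic : Function.Periodic (pos q r) (2 * half q r) := fun t => by
  unfold pos
  rw [angle_add_period h, cos_add_two_pi]

theorem half_pos : 0 < half q r := by
  have := strictMono_elapsed h pi_pos
  rwa [elapsed_zero] at this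

/-- The orbit starts at a turning point, so recovering the position alone, without the velocity,
makes the angle a multiple of 2π. -/
theorem exists_nat_of_pos_eq (hr : r ≠ 0) {t : ℝ} (ht : 0 < t) (hp : pos q r t = pos q r 0) :
    ∃ k : ℕ, 1 ≤ k ∧ t = k * (2 * half q r) := by
  have h1 : r * cos (angle q r t) = r := by
    have := congrArg (amp q) hp
    rw [amp_pos h, amp_pos h, angle_zero h, cos_zero, mul_one] at this
    exact this
  have h2 : cos (angle q r t) = 1 := mul_left_cancel₀ hr (by rw [h1, mul_one])
  obtain ⟨n, hn⟩ := (cos_eq_one_iff _).1 h2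
  have h3 : 0 < angle q r t := by rwa [lt_angle_iff h, elapsed_zero]
  have h4 : 0 < n := by
    rw [← hn] at h3
    exact_mod_cast pos_of_mul_pos_left h3 two_pi_pos.le
  lift n to ℕ using h4.le
  refine ⟨n, by exact_mod_cast h4, ?_⟩
  have h5 := angle_add_nat_mul_period h n 0
  rw [angle_zero h, zero_add, zero_add] at h5
  rw [← elapsed_angle h t, ← hn, ← elapsed_angle h (n * (2 * half q r)), h5]
  simp

/-- Folding at π/2 pairs the points of equal potential; it is the sum of the two rates that is known
to increase. -/
theorem half_eq : half q r =
    ∫ s in (0 : ℝ)..π / 2, (rate q (r * cos s) + rate q (-(r * cos s))) := by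
  have hi : ∀ t₁ t₂, IntervalIntegrable (fun s => rate q (r * cos s)) MeasureTheory.volume t₁ t₂ :=
    fun t₁ t₂ => (continuous_rate h).intervalIntegrable _ _
  have hi' : ∀ t₁ t₂, IntervalIntegrable (fun s => rate q (-(r * cos s)))
      MeasureTheory.volume t₁ t₂ :=
    fun t₁ t₂ => by simpa using (continuous_rate (neg_mem_orbits h)).intervalIntegrable _ _
  have := intervalIntegral.integral_comp_sub_left (a := 0) (b := π / 2)
    (fun s => rate q (r * cos s)) π
  simp only [cos_pi_sub, mul_neg, sub_zero] at this
  rw [intervalIntegral.integral_add (hi _ _) (hi' _ _), this, show π - π / 2 = π / 2 by ring,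
    intervalIntegral.integral_add_adjacent_intervals (hi _ _) (hi _ _)]
  rfl

end

/-! ### Monotonicity and range of the period function. -/

/-- The period increases with the amplitude. -/
theorem half_strictMono {q r r' : ℝ} (h : (q, r') ∈ orbits) (hr : 0 ≤ r) (hrr : r < r') :
    half q r < half q r' := by
  have hr' : 0 < r' := hr.trans_lt hrr
  have h' : (q, r) ∈ orbits :=
    orbits_of_abs_le h (by rw [abs_of_nonneg hr, abs_of_pos hr']; exact hrr.le)
  have hc {r : ℝ} (h : (q, r) ∈ orbits) :
      Continuous fun s => rate q (r * cos s) + rate q (-(r * cos s)) := by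
    have := continuous_rate (neg_mem_orbits h)
    simp only [neg_mul] at this
    exact (continuous_rate h).add this
  have hm := strictMonoOn_rate_add h.1 (by simpa [abs_of_pos hr'] using h.2)
  have hlt : ∀ s ∈ Ico 0 (π / 2), rate q (r * cos s) + rate q (-(r * cos s)) <
      rate q (r' * cos s) + rate q (-(r' * cos s)) := fun s hs => by
    have h0 : 0 < cos s := cos_pos_of_mem_Ioo ⟨by linarith [hs.1, pi_pos], hs.2⟩
    have h1 : r' * cos s ≤ r' := mul_le_of_le_one_right hr'.le (cos_le_one s)
    have h2 : r * cos s < r' * cos s := mul_lt_mul_of_pos_right hrr h0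
    exact hm ⟨by positivity, h2.le.trans h1⟩ ⟨by positivity, h1⟩ h2
  rw [half_eq h, half_eq h']
  -- At s = π/2 the integrands coincide, so the comparison is weak there and strictness is taken at
  -- s = 0.
  refine intervalIntegral.integral_lt_integral_of_continuousOn_of_le_of_exists_lt (by positivity)
    (hc h').continuousOn (hc h).continuousOn (fun s hs => ?_)
    ⟨0, ⟨le_rfl, by positivity⟩, hlt 0 ⟨le_rfl, by positivity⟩⟩
  rcases hs.2.eq_or_lt with rfl | h2
  · simp
  · exact (hlt s ⟨hs.1.le, h2⟩).le

theorem half_zero (q : ℝ) : half q 0 = π * rate q 0 := by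
  simp [half, elapsed]

/-- The data of the smaller equilibrium which force the period to blow up. -/
theorem exists_saddle {q : ℝ} (hq : q ∈ Ico (0 : ℝ) (1 / 3)) : ∃ m C : ℝ, 0 ≤ m ∧ m < 1 ∧ 0 < C ∧
    (∀ y, m < y → y ∈ dom q) ∧ ∀ y, m < y → -(C * (y - m)) ≤ force q y := by
  obtain ⟨hq0, hq1⟩ := hq
  rcases hq0.eq_or_lt with rfl | hq0'
  -- For q = 0 the singular term is absent and m = 0 takes the role of the lower equilibrium.
  · refine ⟨0, 1, le_rfl, one_pos, one_pos, fun y hy => ⟨hy, ?_⟩, fun y hy => ?_⟩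
    · unfold quart
      simp only [sub_zero, one_mul, zero_mul]
      positivity
    · unfold force
      simp only [sub_zero, one_mul, zero_div]
      have := pow_pos hy 5
      linarith
  · have hc : Continuous (quart q) := by unfold quart; fun_prop
    have h0 : quart q 0 < 0 := by simpa [quart] using hq0'
    have h1 := (one_mem_dom ⟨hq0, hq1⟩).2
    obtain ⟨m, hm, hm0⟩ := intermediate_value_Ioo (zero_le_one' ℝ) hc.continuousOn ⟨h0, h1⟩
    have hd : ∀ y, m < y → y ∈ dom q := fun y hy => by
      refine ⟨hm.1.trans hy, ?_⟩
      have a : 0 < m ^ 4 := pow_pos hm.1 4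
      have b : m ^ 4 < y ^ 4 := pow_lt_pow_left₀ hy hm.1.le (by norm_num)
      have e : (1 - q) * (m ^ 4) ^ 2 = q * m ^ 4 + q := by
        unfold quart at hm0; linear_combination hm0
      have e' : quart q y = (1 - q) * (y ^ 4) ^ 2 - q * y ^ 4 - q := by unfold quart; ring
      rw [e']
      have c : q < (1 - q) * m ^ 4 := by
        by_contra hc
        push Not at hc
        nlinarith
      nlinarith [mul_pos (sub_pos.2 b) (sub_pos.2 c),
        mul_pos (sub_pos.2 b) (mul_pos (by linarith : 0 < 1 - q) (a.trans b))]
    refine ⟨m, |forceD q m| + 1, hm.1.le, hm.2, by positivity, hd, fun y hy => ?_⟩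
    have hf : force q m = 0 := by rw [force_eq hm.1.ne', hm0]; simp
    have hx : ∀ x ∈ Ici m, x ≠ 0 := fun x hx => (hm.1.trans_le hx).ne'
    -- `force` is convex, so its slope to the right of m is at least `forceD q m`.
    have := (convex_Ici m).mul_sub_le_image_sub_of_le_deriv (f := force q) (C := forceD q m)
      (fun x h => (hasDerivAt_force (hx x h)).continuousAt.continuousWithinAt)
      (fun x h =>
        (hasDerivAt_force (hx x (interior_subset h))).differentiableAt.differentiableWithinAt)
      (fun x h => by
        rw [(hasDerivAt_force (hx x (interior_subset h))).deriv]
        exact forceD_mono ⟨hq0, hq1⟩ hm.1 (interior_subset h))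
      m self_mem_Ici y hy.le hy.le
    rw [hf, sub_zero] at this
    nlinarith [neg_abs_le (forceD q m), sub_pos.2 hy]

/-- On an orbit whose lowest point is y, this bounds the squared speed at y' by C (y' - m)². -/
theorem pot_le_pot_add {q m C y y' : ℝ} (hm : 0 ≤ m)
    (hf : ∀ y, m < y → -(C * (y - m)) ≤ force q y) (hy : m < y) (hyy : y ≤ y') :
    2 * pot q y ≤ 2 * pot q y' + (C * (y' - m) ^ 2 - C * (y - m) ^ 2) := by
  have hd : ∀ s ∈ Icc y y', HasDerivAt (fun s => 2 * pot q s + C * (s - m) ^ 2)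
      (2 * force q s + C * (2 * (s - m))) s := fun s hs => by
    have h0 : s ≠ 0 := (hm.trans_lt (hy.trans_le hs.1)).ne'
    refine ((hasDerivAt_pot h0).const_mul 2).add
      (((((hasDerivAt_id s).sub_const m).pow 2).const_mul C).congr_deriv ?_)
    simp
  have := monotoneOn_of_deriv_nonneg (convex_Icc y y')
    (fun s hs => (hd s hs).continuousAt.continuousWithinAt)
    (fun s hs => (hd s (interior_subset hs)).differentiableAt.differentiableWithinAt)
    (fun s hs => by
      rw [(hd s (interior_subset hs)).deriv]
      have := hf s (hy.trans_le (interior_subset hs).1)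
      linarith) (left_mem_Icc.2 hyy) (right_mem_Icc.2 hyy) hyy
  simp only at this
  linarith

/-- The period tends to infinity at the homoclinic orbit. -/
theorem exists_half_gt {q : ℝ} (hq : q ∈ Ico (0 : ℝ) (1 / 3)) (B : ℝ) :
    ∃ r, 0 < r ∧ (q, r) ∈ orbits ∧ B < half q r := by
  obtain ⟨m, C, hm0, hm1, hC, hd, hf⟩ := exists_saddle hq
  have hsC := sqrt_pos.2 hC
  -- The orbit chosen has lowest point m + (1 - m)e. The logarithm of the distance to m changes at
  -- rate at most √C, so climbing from there beyond 1 takes time at least -log e / √C > |B|.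
  obtain ⟨e, he, he0, he1⟩ : ∃ e : ℝ, log e = -(√C * |B|) - 1 ∧ 0 < e ∧ e < 1 := by
    refine ⟨exp (-(√C * |B|) - 1), log_exp _, exp_pos _, Real.exp_lt_one_iff.2 ?_⟩
    have : 0 ≤ √C * |B| := by positivity
    linarith
  have h1m : 0 < 1 - m := sub_pos.2 hm1
  obtain ⟨y, hy⟩ : ∃ y, y = m + (1 - m) * e := ⟨_, rfl⟩
  have hmy : m < y := by rw [hy]; have := mul_pos h1m he0; linarith
  have hy1 : y < 1 := by rw [hy]; have := mul_lt_mul_of_pos_left he1 h1m; linarith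
  have hyd := hd y hmy
  have hr0 : 0 < -amp q y := by
    have := strictMonoOn_amp hq hyd (one_mem_dom hq) hy1
    rw [amp_one] at this
    linarith
  have ho : (q, -amp q y) ∈ orbits :=
    ⟨hq, by simpa [abs_of_neg (neg_pos.1 hr0)] using ⟨y, hyd, rfl⟩⟩
  refine ⟨-amp q y, hr0, ho, ?_⟩
  obtain ⟨r, hr⟩ : ∃ r, r = -amp q y := ⟨_, rfl⟩
  rw [← hr] at hr0 ho ⊢
  have hge : ∀ θ, y ≤ inv q (r * cos θ) := fun θ => by
    by_contra hc
    push Not at hc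
    rw [inv_lt_iff hq (mul_cos_mem_range ho θ) hyd] at hc
    nlinarith [neg_one_le_cos θ]
  have hpos : ∀ θ, 0 < inv q (r * cos θ) - m := fun θ => by linarith [hge θ]
  have hL : ∀ θ, HasDerivAt (fun θ => log (inv q (r * cos θ) - m) + √C * elapsed q r θ)
      (rate q (r * cos θ) * (r * -sin θ) / (inv q (r * cos θ) - m)
        + √C * rate q (r * cos θ)) θ := fun θ =>
    ((((hasDerivAt_inv hq (mul_cos_mem_range ho θ)).comp θ
      ((hasDerivAt_cos θ).const_mul r)).sub_const m).log (hpos θ).ne').add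
      ((hasDerivAt_elapsed ho θ).const_mul _)
  -- In terms of time, log (position - m) decreases at rate at most √C; this is the speed bound
  -- `hk`.
  have hmono := monotone_of_deriv_nonneg (fun θ => (hL θ).differentiableAt) fun θ => by
    rw [(hL θ).deriv]
    have hk : |r * sin θ| ≤ √C * (inv q (r * cos θ) - m) := by
      apply abs_le_of_sq_le_sq _ (mul_nonneg hsC.le (hpos θ).le)
      have h1 := pot_le_pot_add hm0 hf hmy (hge θ)
      rw [← amp_sq hq hyd, ← amp_sq hq (inv_mem (mul_cos_mem_range ho θ)),
        amp_inv (mul_cos_mem_range ho θ)] at h1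
      have h2 : amp q y ^ 2 = r ^ 2 := by rw [hr]; ring
      rw [h2] at h1
      rw [mul_pow (√C), sq_sqrt hC.le]
      nlinarith [sin_sq_add_cos_sq θ, mul_nonneg hC.le (sq_nonneg (y - m))]
    have hrate := rate_pos hq (mul_cos_mem_range ho θ)
    have : -√C * rate q (r * cos θ) ≤
        rate q (r * cos θ) * (r * -sin θ) / (inv q (r * cos θ) - m) := by
      rw [le_div_iff₀ (hpos θ)]
      nlinarith [mul_le_mul_of_nonneg_left ((le_abs_self _).trans hk) hrate.le]
    linarith
  have h2 := hmono pi_pos.le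
  simp only [cos_zero, cos_pi, mul_one, elapsed_zero, mul_zero, add_zero] at h2
  have e1 : inv q (r * -1) = y := by rw [hr, mul_neg_one, neg_neg]; exact inv_amp hq hyd
  have e2 : log (y - m) = log (1 - m) + log e := by
    rw [← log_mul h1m.ne' he0.ne', hy]
    congr 1
    ring
  have e3 : log (1 - m) ≤ log (inv q r - m) := by
    apply log_le_log h1m
    have : ¬ inv q r < 1 := fun hc => by
      have hx : r ∈ range q := by simpa using mul_cos_mem_range ho 0
      rw [inv_lt_iff hq hx (one_mem_dom hq), amp_one] at hc
      exact hc.not_gt hr0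
    linarith
  rw [e1, e2, he] at h2
  change _ ≤ _ + √C * half q r at h2
  have h3 : √C * |B| < √C * half q r := by linarith
  exact (le_abs_self B).trans_lt (lt_of_mul_lt_mul_left h3 hsC.le)

theorem continuousOn_half : ContinuousOn (fun z : ℝ × ℝ => half z.1 z.2) orbits := by
  rw [continuousOn_iff_continuous_domRestrict]
  have hf : Continuous fun z : orbits => (z, π) := by fun_prop
  have := continuous_elapsed.comp hf
  exact this

theorem exists_half_eq {q B : ℝ} (hq : q ∈ Ico (0 : ℝ) (1 / 3)) (hB : half q 0 ≤ B) :
    ∃ r, 0 ≤ r ∧ (q, r) ∈ orbits ∧ half q r = B := by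
  obtain ⟨r, hr, ho, h⟩ := exists_half_gt hq B
  have hc : ContinuousOn ((fun z : ℝ × ℝ => half z.1 z.2) ∘ fun s => (q, s)) (Icc 0 r) :=
    continuousOn_half.comp (by fun_prop) fun x hx => orbits_of_abs_le ho
      (by rw [abs_of_nonneg hx.1, abs_of_pos hr]; exact hx.2)
  obtain ⟨s, hs, hsB⟩ := intermediate_value_Icc hr.le hc ⟨hB, h.le⟩
  exact ⟨s, hs.1, orbits_of_abs_le ho (by rw [abs_of_nonneg hs.1, abs_of_pos hr]; exact hs.2), hsB⟩

theorem half_inj {q r r' : ℝ} (hr : 0 ≤ r) (hr' : 0 ≤ r') (h : (q, r) ∈ orbits)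
    (h' : (q, r') ∈ orbits) (he : half q r = half q r') : r = r' := by
  rcases lt_trichotomy r r' with hl | hl | hl
  · exact absurd he (half_strictMono h' hr hl).ne
  · exact hl
  · exact absurd he (half_strictMono h hr' hl).ne'

/-- The amplitude of an orbit of prescribed period depends continuously on the well. -/
theorem continuous_of_half_eq {Z : Type*} [TopologicalSpace Z] {q r : Z → ℝ} {B : ℝ}
    (hqc : Continuous q) (hr : ∀ z, 0 ≤ r z) (ho : ∀ z, (q z, r z) ∈ orbits)
    (hB : ∀ z, half (q z) (r z) = B) : Continuous r := by
  have key : ∀ (z : Z) (s : ℝ) (hs : (q z, s) ∈ orbits),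
      Tendsto (fun w => half (q w) s) (𝓝 z) (𝓝 (half (q z) s)) ∧
      ∀ᶠ w in 𝓝 z, (q w, s) ∈ orbits := fun z s hs => by
    have hc : Continuous fun w => (q w, s) := by fun_prop
    have he : ∀ᶠ w in 𝓝 z, (q w, s) ∈ orbits := by
      have := hc.continuousAt (x := z) |>.eventually (eventually_mem_orbits hs)
      filter_upwards [this] with w hw using hw (ho w).1
    refine ⟨?_, he⟩
    have ht : Tendsto (fun w => (q w, s)) (𝓝 z) (𝓝[orbits] (q z, s)) :=
      tendsto_nhdsWithin_iff.2 ⟨hc.continuousAt, he⟩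
    have := (continuousOn_half _ hs).tendsto.comp ht
    exact this
  -- As `half` is strictly increasing in the amplitude, comparing r w with a constant amounts to
  -- comparing B with `half` at that constant, which varies continuously with w.
  refine continuous_iff_continuousAt.2 fun z => tendsto_order.2 ⟨fun a ha => ?_, fun b hb => ?_⟩
  · rcases lt_or_ge a 0 with ha0 | ha0
    · exact Eventually.of_forall fun w => ha0.trans_le (hr w)
    have hao := orbits_of_abs_le (r' := a) (ho z)
      (by rw [abs_of_nonneg ha0, abs_of_nonneg (hr z)]; exact ha.le)
    have hlt := half_strictMono (ho z) ha0 ha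
    rw [hB] at hlt
    filter_upwards [(key z a hao).1.eventually_lt_const hlt, (key z a hao).2] with w h1 h2
    by_contra hc
    push Not at hc
    rcases hc.eq_or_lt with hc | hc
    · rw [← hc, hB] at h1; exact lt_irrefl _ h1
    · have := half_strictMono h2 (hr w) hc
      rw [hB] at this
      exact h1.not_gt this
  -- The bound b may lie beyond the homoclinic amplitude, where there is no orbit, so an admissible
  -- b' just above r z replaces it.
  · obtain ⟨b', hb', hbo⟩ : ∃ b', r z < b' ∧ b' < b ∧ (q z, b') ∈ orbits := by
      have h1 : ∀ᶠ x in 𝓝[>] (r z), (q z, x) ∈ orbits := by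
        have hc : ContinuousAt (fun x : ℝ => (q z, x)) (r z) := by fun_prop
        have := hc.eventually (eventually_mem_orbits (ho z))
        filter_upwards [nhdsWithin_le_nhds this] with x hx using hx (ho z).1
      have h2 : ∀ᶠ x in 𝓝[>] (r z), x ∈ Ioo (r z) b := Ioo_mem_nhdsGT hb
      obtain ⟨x, hx, hx'⟩ := (h1.and h2).exists
      exact ⟨x, hx'.1, hx'.2, hx⟩
    have hlt := half_strictMono hbo.2 (hr z) hb'
    rw [hB] at hlt
    filter_upwards [(key z b' hbo.2).1.eventually_const_lt hlt] with w h1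
    refine lt_of_not_ge fun hc => ?_
    rcases (hbo.1.trans_le hc).le.eq_or_lt with hc' | hc'
    · exact absurd hc' (hbo.1.trans_le hc).ne
    · have := half_strictMono (ho w) ((hr z).trans hb'.le) hc'
      rw [hB] at this
      exact h1.not_gt this

end LichWell

/-! ### Families of periodic functions -/

/-- A jointly continuous family of periodic functions is continuous for the uniform norm. -/
theorem continuous_bcf_of_periodic {Z : Type*} [TopologicalSpace Z] {F : Z → ℝ →ᵇ ℝ} {c : ℝ}
    (hc : 0 < c) (hp : ∀ z, Function.Periodic (F z) c)
    (hF : Continuous fun w : Z × ℝ => F w.1 w.2) : Continuous F := by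
  refine continuous_iff_continuousAt.2 fun z => Metric.tendsto_nhds.2 fun ε hε => ?_
  have h : ∀ᶠ w in 𝓝 z, ∀ t ∈ Icc 0 c, dist (F w t) (F z t) < ε / 2 := by
    refine isCompact_Icc.eventually_forall_of_forall_eventually fun t _ => ?_
    have h1 : Continuous fun w : Z × ℝ => dist (F w.1 w.2) (F z w.2) :=
      hF.dist ((F z).continuous.comp continuous_snd)
    refine h1.continuousAt.eventually_lt continuousAt_const ?_
    simpa using hε
  filter_upwards [h] with w hw
  refine lt_of_le_of_lt ((BoundedContinuousFunction.dist_le (half_pos hε).le).2 fun t => ?_)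
    (half_lt_self hε)
  have hpd : Function.Periodic (fun t => dist (F w t) (F z t)) c := fun t => by
    simp only [hp w t, hp z t]
  obtain ⟨s, hs, hst⟩ := hpd.exists_mem_Ico₀ hc t
  rw [hst]
  exact (hw s (Ico_subset_Icc_self hs)).le

namespace C2Even

theorem isInducing_jet : IsInducing jet := ⟨rfl⟩

/-- A family in `C²_even` is continuous if its elements and their first two derivatives are jointly
continuous. -/
theorem continuous_of_jet {Z : Type*} [TopologicalSpace Z] {φ : Z → C2Even}
    (h0 : Continuous fun w : Z × ℝ => φ w.1 w.2)
    (h1 : Continuous fun w : Z × ℝ => deriv (φ w.1) w.2)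
    (h2 : Continuous fun w : Z × ℝ => deriv (deriv (φ w.1)) w.2) : Continuous φ := by
  rw [isInducing_jet.continuous_iff]
  refine Continuous.prodMk ?_ (Continuous.prodMk ?_ ?_)
  · exact continuous_bcf_of_periodic two_pi_pos (fun z => (φ z).periodic) h0
  · exact continuous_bcf_of_periodic two_pi_pos (fun z => periodic_deriv (φ z).periodic) h1
  · exact continuous_bcf_of_periodic two_pi_pos
      (fun z => periodic_deriv (periodic_deriv (φ z).periodic)) h2

theorem continuous_jet : Continuous jet := isInducing_jet.continuous

theorem continuous_eval (ψ : ℝ) : Continuous fun φ : C2Even => φ ψ :=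
  (continuous_eval_const (F := ℝ →ᵇ ℝ) ψ).comp (continuous_fst.comp continuous_jet)

theorem ext {φ χ : C2Even} (h : ∀ ψ, φ ψ = χ ψ) : φ = χ := Subtype.ext (funext h)

theorem hasDerivAt (φ : C2Even) (ψ : ℝ) : HasDerivAt φ (deriv φ ψ) ψ :=
  (φ.contDiff.differentiable (by norm_num) ψ).hasDerivAt

theorem deriv_zero (φ : C2Even) : deriv φ 0 = 0 := by
  have h1 : HasDerivAt (fun ψ => φ (-ψ)) (deriv φ 0 * (-1)) 0 :=
    HasDerivAt.comp (0 : ℝ) (by simpa using φ.hasDerivAt 0) (hasDerivAt_neg 0)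
  rw [show (fun ψ => φ (-ψ)) = (φ : ℝ → ℝ) from funext φ.even] at h1
  have := h1.unique (φ.hasDerivAt 0)
  linarith

end C2Even

/-! ### Uniqueness for second order equations -/

theorem Function.Periodic.exists_pos_bounds {φ : ℝ → ℝ} {c : ℝ} (hp : Function.Periodic φ c)
    (hc : 0 < c) (hφ : Continuous φ) (hpos : ∀ t, 0 < φ t) :
    ∃ a b, 0 < a ∧ ∀ t, φ t ∈ Icc a b := by
  have hk := hp.compact_of_continuous hc.ne' hφ
  have hn : (Set.range φ).Nonempty := ⟨φ 0, mem_range_self 0⟩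
  obtain ⟨a, ⟨s, rfl⟩, ha⟩ := hk.exists_isLeast hn
  obtain ⟨b, -, hb⟩ := hk.exists_isGreatest hn
  exact ⟨φ s, b, hpos s, fun t => ⟨ha (mem_range_self t), hb (mem_range_self t)⟩⟩

/-- The nonlinearities are singular at 0. Positive periodic functions stay in a compact subinterval
of (0, ∞), on which G is Lipschitz. The two periods may differ, so constants can be compared with
any solution. -/
theorem eq_of_second_order {G φ₁ v₁ φ₂ v₂ : ℝ → ℝ} {c₁ c₂ : ℝ}
    (hG : ContDiffOn ℝ 1 G (Ioi 0))
    (hφ₁ : ∀ t, HasDerivAt φ₁ (v₁ t) t) (hv₁ : ∀ t, HasDerivAt v₁ (G (φ₁ t)) t)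
    (hφ₂ : ∀ t, HasDerivAt φ₂ (v₂ t) t) (hv₂ : ∀ t, HasDerivAt v₂ (G (φ₂ t)) t)
    (hp₁ : Function.Periodic φ₁ c₁) (hc₁ : 0 < c₁) (hpos₁ : ∀ t, 0 < φ₁ t)
    (hp₂ : Function.Periodic φ₂ c₂) (hc₂ : 0 < c₂) (hpos₂ : ∀ t, 0 < φ₂ t)
    {t₀ : ℝ} (h0 : φ₁ t₀ = φ₂ t₀) (h0' : v₁ t₀ = v₂ t₀) : φ₁ = φ₂ := by
  obtain ⟨a₁, b₁, ha₁, h₁⟩ := hp₁.exists_pos_bounds hc₁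
    (continuous_iff_continuousAt.2 fun t => (hφ₁ t).continuousAt) hpos₁
  obtain ⟨a₂, b₂, ha₂, h₂⟩ := hp₂.exists_pos_bounds hc₂
    (continuous_iff_continuousAt.2 fun t => (hφ₂ t).continuousAt) hpos₂
  have hsub : Icc (min a₁ a₂) (max b₁ b₂) ⊆ Ioi 0 := fun x hx => (lt_min ha₁ ha₂).trans_le hx.1
  obtain ⟨K, hK⟩ : ∃ K, LipschitzOnWith K G (Icc (min a₁ a₂) (max b₁ b₂)) :=
    (hG.mono hsub).exists_lipschitzOnWith one_ne_zero (convex_Icc _ _) isCompact_Icc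
  have hL : LipschitzOnWith (max 1 K) (fun z : ℝ × ℝ => (z.2, G z.1))
      (Icc (min a₁ a₂) (max b₁ b₂) ×ˢ univ) := by
    have hfst : LipschitzOnWith (K * 1) (G ∘ Prod.fst)
        (Icc (min a₁ a₂) (max b₁ b₂) ×ˢ (univ : Set ℝ)) :=
      hK.comp LipschitzWith.prod_fst.lipschitzOnWith fun z hz => hz.1
    rw [mul_one] at hfst
    exact LipschitzWith.prod_snd.lipschitzOnWith.prodMk hfst
  have := ODE_solution_unique_univ (v := fun _ z => (z.2, G z.1))
    (s := fun _ => Icc (min a₁ a₂) (max b₁ b₂) ×ˢ univ) (f := fun t => (φ₁ t, v₁ t))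
    (g := fun t => (φ₂ t, v₂ t)) (t₀ := t₀) (fun _ => hL)
    (fun t => ⟨(hφ₁ t).prodMk (hv₁ t),
      ⟨(min_le_left _ _).trans (h₁ t).1, (h₁ t).2.trans (le_max_left _ _)⟩, trivial⟩)
    (fun t => ⟨(hφ₂ t).prodMk (hv₂ t),
      ⟨(min_le_right _ _).trans (h₂ t).1, (h₂ t).2.trans (le_max_right _ _)⟩, trivial⟩)
    (by simp only [h0, h0'])
  funext t
  exact congrArg Prod.fst (congrFun this t)

/-! ### The index -/

/-- It is enough that ϑ stays less than a right angle away from a polar angle of the curve. The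
correction is the argument of the curve rotated back by ϑ, which remains in the right half-plane, is
continuous, and agrees at the two ends. -/
theorem hasIndex_of_lift {T c : ℝ} {φ ϑ : ℝ → ℝ} {k : ℤ} (hφ : Continuous φ)
    (hφ' : Continuous (deriv φ)) (hp : Function.Periodic φ (2 * π)) (hϑ : Continuous ϑ)
    (hk : ϑ (2 * π) - ϑ 0 = 2 * π * k)
    (hpos : ∀ ψ, 0 < (φ ψ - c) * cos (ϑ ψ) - 2 * π / T * deriv φ ψ * sin (ϑ ψ)) :
    HasIndex T c φ k := by
  set w : ℝ → ℂ := fun ψ =>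
    ⟨(φ ψ - c) * cos (ϑ ψ) - 2 * π / T * deriv φ ψ * sin (ϑ ψ),
      -(2 * π / T * deriv φ ψ * cos (ϑ ψ)) - (φ ψ - c) * sin (ϑ ψ)⟩ with hw
  have hwc : Continuous w := by
    rw [hw]
    have h1 : Continuous fun ψ => (φ ψ - c) * cos (ϑ ψ) - 2 * π / T * deriv φ ψ * sin (ϑ ψ) := by
      fun_prop
    have h2 : Continuous fun ψ =>
        -(2 * π / T * deriv φ ψ * cos (ϑ ψ)) - (φ ψ - c) * sin (ϑ ψ) := by fun_prop
    exact Complex.equivRealProdCLM.symm.continuous.comp (h1.prodMk h2)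
  have hslit : ∀ ψ, w ψ ∈ Complex.slitPlane := fun ψ => Or.inl (hpos ψ)
  have harg : Continuous fun ψ => Complex.arg (w ψ) := continuous_iff_continuousAt.2 fun ψ =>
    ContinuousAt.comp (f := w) (Complex.continuousAt_arg (hslit ψ)) hwc.continuousAt
  have hre (ψ : ℝ) := Complex.norm_mul_cos_arg (w ψ)
  have him (ψ : ℝ) := Complex.norm_mul_sin_arg (w ψ)
  have hwp : w (2 * π) = w 0 := by
    have e : ϑ (2 * π) = ϑ 0 + k * (2 * π) := by linarith
    have hd := C2Even.periodic_deriv hp 0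
    have h0 := hp 0
    rw [zero_add] at hd h0
    simp only [hw, e, cos_add_int_mul_two_pi, sin_add_int_mul_two_pi, hd, h0]
  refine ⟨fun ψ => ‖w ψ‖, fun ψ => ϑ ψ + Complex.arg (w ψ), hϑ.add harg, fun ψ => ⟨?_, ?_, ?_⟩, ?_⟩
  · exact norm_pos_iff.2 (Complex.slitPlane_ne_zero (hslit ψ))
  · rw [cos_add]
    have h1 := hre ψ
    have h2 := him ψ
    simp only [hw] at h1 h2 ⊢
    linear_combination (-cos (ϑ ψ)) * h1 + sin (ϑ ψ) * h2
      - (φ ψ - c) * sin_sq_add_cos_sq (ϑ ψ)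
  · rw [sin_add]
    have h1 := hre ψ
    have h2 := him ψ
    simp only [hw] at h1 h2 ⊢
    linear_combination sin (ϑ ψ) * h1 + cos (ϑ ψ) * h2
      - (2 * π / T * deriv φ ψ) * sin_sq_add_cos_sq (ϑ ψ)
  · simp only [hwp]
    linarith

namespace LichWell

/-! ### Cardano's formula -/

/-- The shape parameter `q` of the normalised well belonging to `α`. -/
noncomputable def shape (R β α : ℝ) : ℝ := (2 - 2 * cos (cardanoAngle R β α)) / 3

theorem continuous_cardanoAngle (R β : ℝ) : Continuous (cardanoAngle R β) := by
  unfold cardanoAngle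
  fun_prop

theorem continuous_shape (R β : ℝ) : Continuous (shape R β) := by
  have := continuous_cardanoAngle R β
  unfold shape
  fun_prop

theorem continuous_phiPlus (R β : ℝ) : Continuous (phiPlus R β) := by
  have := continuous_cardanoAngle R β
  unfold phiPlus
  exact Continuous.rpow_const (by fun_prop) fun _ => Or.inr (by norm_num)

theorem continuous_phiMinus (R β : ℝ) : Continuous (phiMinus R β) := by
  have := continuous_cardanoAngle R β
  unfold phiMinus
  exact Continuous.rpow_const (by fun_prop) fun _ => Or.inr (by norm_num)

/-- Through `shape_cubic` this makes `shape` an increasing function of |α|. -/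
theorem cubic_strictMonoOn : StrictMonoOn (fun q : ℝ => (1 - q) ^ 2 * q) (Icc 0 (1 / 3)) :=
  fun q hq q' hq' h => by
    obtain ⟨h1, h2⟩ := hq
    obtain ⟨h3, h4⟩ := hq'
    have : 0 < 1 - 2 * (q + q') + (q ^ 2 + q * q' + q' ^ 2) := by
      nlinarith [mul_pos (show 0 < 1 / 3 - q by linarith) (show 0 < 1 / 3 - q by linarith),
        mul_nonneg (show 0 ≤ 1 / 3 - q by linarith) (show 0 ≤ 1 / 3 - q' by linarith),
        sq_nonneg (1 / 3 - q')]
    have := mul_pos (sub_pos.2 h) this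
    simp only
    linarith

/-- The maximum 4/27, attained at the double root x = 2/3, is what makes `alphaMax` the threshold
for constant solutions. -/
theorem cubic_le {x : ℝ} (hx : 0 ≤ x) : x ^ 2 * (1 - x) ≤ 4 / 27 := by
  have : 0 ≤ (x - 2 / 3) ^ 2 * (x + 1 / 3) := by positivity
  linarith

theorem rpow_quarter_pow {x : ℝ} (hx : 0 ≤ x) : (x ^ (1 / 4 : ℝ)) ^ 4 = x := by
  rw [← rpow_natCast, ← rpow_mul hx]
  norm_num

section

variable {R β : ℝ} (hR : 0 < R) (hβ : 0 < β)

include hR hβ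

theorem alphaMax_pos : 0 < alphaMax R β := by
  unfold alphaMax
  positivity

theorem alphaMax_sq : alphaMax R β ^ 2 * β ^ 4 / R ^ 3 = 4 / 27 := by
  have h1 : (R ^ (3 / 2 : ℝ)) ^ 2 = R ^ 3 := by
    rw [← rpow_natCast, ← rpow_mul hR.le, ← rpow_natCast]
    norm_num
  have h3 : √(3 : ℝ) ^ 2 = 3 := sq_sqrt (by norm_num)
  have h30 : 0 < √(3 : ℝ) := by positivity
  unfold alphaMax
  rw [mul_pow, h1, div_pow, mul_pow, mul_pow, h3]
  field_simp
  norm_num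

theorem abs_le_iff_of_pos {a α : ℝ} (ha : 0 ≤ a) :
    |α| ≤ a ↔ α ^ 2 * β ^ 4 / R ^ 3 ≤ a ^ 2 * β ^ 4 / R ^ 3 := by
  rw [← abs_of_nonneg ha, ← sq_le_sq, abs_of_nonneg ha]
  constructor
  · intro h; gcongr
  · intro h
    rw [div_le_div_iff_of_pos_right (by positivity)] at h
    exact le_of_mul_le_mul_right h (by positivity)

theorem abs_lt_iff_of_pos {a α : ℝ} (ha : 0 ≤ a) :
    |α| < a ↔ α ^ 2 * β ^ 4 / R ^ 3 < a ^ 2 * β ^ 4 / R ^ 3 := by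
  rw [← abs_of_nonneg ha, ← sq_lt_sq, abs_of_nonneg ha]
  constructor
  · intro h; gcongr
  · intro h
    rw [div_lt_div_iff_of_pos_right (by positivity)] at h
    exact lt_of_mul_lt_mul_right h (by positivity)

theorem abs_le_alphaMax_iff {α : ℝ} : |α| ≤ alphaMax R β ↔ α ^ 2 * β ^ 4 / R ^ 3 ≤ 4 / 27 := by
  rw [abs_le_iff_of_pos hR hβ (alphaMax_pos hR hβ).le, alphaMax_sq hR hβ]

theorem abs_lt_alphaMax_iff {α : ℝ} : |α| < alphaMax R β ↔ α ^ 2 * β ^ 4 / R ^ 3 < 4 / 27 := by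
  rw [abs_lt_iff_of_pos hR hβ (alphaMax_pos hR hβ).le, alphaMax_sq hR hβ]

section

variable {α : ℝ} (hα : |α| ≤ alphaMax R β)

include hα

omit hR hβ hα in
theorem cardanoAngle_mem : cardanoAngle R β α ∈ Icc 0 (π / 3) := by
  unfold cardanoAngle
  constructor
  · have := arccos_nonneg (1 - 27 * α ^ 2 * β ^ 4 / (2 * R ^ 3))
    positivity
  · have := arccos_le_pi (1 - 27 * α ^ 2 * β ^ 4 / (2 * R ^ 3))
    linarith

theorem cos_three_cardanoAngle :
    cos (3 * cardanoAngle R β α) = 1 - 27 / 2 * (α ^ 2 * β ^ 4 / R ^ 3) := by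
  have h := (abs_le_alphaMax_iff hR hβ).1 hα
  have h0 : 0 ≤ α ^ 2 * β ^ 4 / R ^ 3 := by positivity
  have e : 27 * α ^ 2 * β ^ 4 / (2 * R ^ 3) = 27 / 2 * (α ^ 2 * β ^ 4 / R ^ 3) := by
    field_simp
  unfold cardanoAngle
  rw [mul_div_cancel₀ _ (by norm_num : (3 : ℝ) ≠ 0), e, cos_arccos (by linarith) (by linarith)]

omit hR hβ hα in
theorem shape_mem : shape R β α ∈ Icc 0 (1 / 3) := by
  have h := cardanoAngle_mem (R := R) (β := β) (α := α)
  have h1 := cos_le_one (cardanoAngle R β α)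
  have h2 : 1 / 2 ≤ cos (cardanoAngle R β α) := by
    rw [← cos_pi_div_three]
    exact cos_le_cos_of_nonneg_of_le_pi h.1 (by linarith [pi_pos]) h.2
  unfold shape
  constructor <;> linarith

theorem shape_cubic :
    (1 - shape R β α) ^ 2 * shape R β α = α ^ 2 * β ^ 4 / R ^ 3 := by
  have h := cos_three_cardanoAngle hR hβ hα
  rw [cos_three_mul] at h
  unfold shape
  linear_combination (-2 / 27) * h

theorem shape_lt_iff {q : ℝ} (hq : q ∈ Icc (0 : ℝ) (1 / 3)) :
    shape R β α < q ↔ α ^ 2 * β ^ 4 / R ^ 3 < (1 - q) ^ 2 * q := by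
  rw [← shape_cubic hR hβ hα]
  exact (cubic_strictMonoOn.lt_iff_lt shape_mem hq).symm

theorem shape_le_iff {q : ℝ} (hq : q ∈ Icc (0 : ℝ) (1 / 3)) :
    shape R β α ≤ q ↔ α ^ 2 * β ^ 4 / R ^ 3 ≤ (1 - q) ^ 2 * q := by
  rw [← shape_cubic hR hβ hα]
  exact (cubic_strictMonoOn.le_iff_le shape_mem hq).symm

omit hR hβ hα in
theorem phiPlus_eq : phiPlus R β α = (R / β ^ 2 * (1 - shape R β α)) ^ (1 / 4 : ℝ) := by
  unfold phiPlus shape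
  congr 1
  ring

omit hα in
theorem phiPlus_pos : 0 < phiPlus R β α := by
  have := (shape_mem (R := R) (β := β) (α := α)).2
  have : 0 < 1 - shape R β α := by linarith
  rw [phiPlus_eq]
  positivity

omit hα in
theorem phiPlus_pow : β ^ 2 * phiPlus R β α ^ 4 = R * (1 - shape R β α) := by
  have := (shape_mem (R := R) (β := β) (α := α)).2
  have : 0 < 1 - shape R β α := by linarith
  rw [phiPlus_eq, rpow_quarter_pow (by positivity)]
  field_simp

/-- With `phiPlus_pow` this supplies the coefficients q and 1 - q of the normalised force. -/
theorem alpha_sq : α ^ 2 = R * shape R β α * phiPlus R β α ^ 8 := by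
  have h1 := phiPlus_pow (α := α) hR hβ
  have h2 := shape_cubic hR hβ hα
  have h3 : β ^ 4 * phiPlus R β α ^ 8 = R ^ 2 * (1 - shape R β α) ^ 2 := by
    linear_combination (β ^ 2 * phiPlus R β α ^ 4 + R * (1 - shape R β α)) * h1
  rw [eq_div_iff (by positivity)] at h2
  have hb : β ^ 4 ≠ 0 := by positivity
  apply mul_right_cancel₀ hb
  linear_combination -h2 - R * shape R β α * h3

/-- `β² φ_-⁴ / R`. -/
noncomputable def lower (R β α : ℝ) : ℝ := (1 - 2 * cos (cardanoAngle R β α + π / 3)) / 3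

omit hR hβ hα in
theorem lower_mem : lower R β α ∈ Icc 0 (2 / 3) := by
  have h := cardanoAngle_mem (R := R) (β := β) (α := α)
  have hp := pi_pos
  have h1 : cos (cardanoAngle R β α + π / 3) ≤ 1 / 2 := by
    rw [← cos_pi_div_three]
    exact cos_le_cos_of_nonneg_of_le_pi (by linarith) (by linarith [h.2]) (by linarith [h.1])
  have h2 : -(1 / 2) ≤ cos (cardanoAngle R β α + π / 3) := by
    rw [← cos_pi_div_three, ← cos_pi_sub]
    exact cos_le_cos_of_nonneg_of_le_pi (by linarith [h.1]) (by linarith) (by linarith [h.2])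
  unfold lower
  constructor <;> linarith

theorem lower_cubic :
    lower R β α ^ 2 * (1 - lower R β α) = α ^ 2 * β ^ 4 / R ^ 3 := by
  have h := cos_three_cardanoAngle hR hβ hα
  have h3 : cos (3 * (cardanoAngle R β α + π / 3)) = -cos (3 * cardanoAngle R β α) := by
    rw [← cos_add_pi]
    congr 1
    ring
  rw [h, cos_three_mul] at h3
  unfold lower
  linear_combination (2 / 27) * h3

omit hα in
theorem phiMinus_pow : β ^ 2 * phiMinus R β α ^ 4 = R * lower R β α := by
  have h := (lower_mem (R := R) (β := β) (α := α)).1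
  have e : R / (3 * β ^ 2) * (1 - 2 * cos (cardanoAngle R β α + π / 3)) =
      R / β ^ 2 * lower R β α := by
    unfold lower
    ring
  unfold phiMinus
  rw [e, rpow_quarter_pow (by positivity)]
  field_simp

omit hα in
theorem phiMinus_nonneg : 0 ≤ phiMinus R β α := by
  have h := (lower_mem (R := R) (β := β) (α := α)).1
  have e : R / (3 * β ^ 2) * (1 - 2 * cos (cardanoAngle R β α + π / 3)) =
      R / β ^ 2 * lower R β α := by
    unfold lower
    ring
  unfold phiMinus
  rw [e]
  positivity

theorem phiMinus_pos (h0 : α ≠ 0) : 0 < phiMinus R β α := by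
  refine (phiMinus_nonneg hR hβ).lt_of_ne fun h => ?_
  have h1 := phiMinus_pow (α := α) hR hβ
  rw [← h] at h1
  have h2 : lower R β α = 0 := by
    have : R * lower R β α = 0 := by rw [← h1]; ring
    exact (mul_eq_zero.1 this).resolve_left hR.ne'
  have h3 := lower_cubic hR hβ hα
  rw [h2] at h3
  have : 0 < α ^ 2 * β ^ 4 / R ^ 3 := by positivity
  linarith

/-- The third root is not positive: by Vieta its product with `lower` would be -(1-q)q ≤ 0. If the
two listed roots coincide, then q = 1/3 and the remaining root is -1/3. -/
theorem cubic_roots {x : ℝ} (hx : 0 < x) (h : x ^ 2 * (1 - x) = α ^ 2 * β ^ 4 / R ^ 3) :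
    x = 1 - shape R β α ∨ x = lower R β α := by
  obtain ⟨hq0, hq1⟩ := shape_mem (R := R) (β := β) (α := α)
  obtain ⟨hl0, hl1⟩ := lower_mem (R := R) (β := β) (α := α)
  have h1 := shape_cubic hR hβ hα
  have h2 := lower_cubic hR hβ hα
  rw [← h] at h1 h2
  generalize shape R β α = q at *
  generalize lower R β α = l at *
  by_contra hne
  push Not at hne
  obtain ⟨hne1, hne2⟩ := hne
  have a1 : (x - (1 - q)) * (x ^ 2 - q * x - (1 - q) * q) = 0 := by linear_combination h1
  have a2 : (x - l) * (x + l - (x ^ 2 + x * l + l ^ 2)) = 0 := by linear_combination -h2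
  have b1 := (mul_eq_zero.1 a1).resolve_left (sub_ne_zero.2 hne1)
  have b2 := (mul_eq_zero.1 a2).resolve_left (sub_ne_zero.2 hne2)
  by_cases hlq : l = 1 - q
  · have : q = 1 / 3 := by linarith
    subst this
    have : l = 2 / 3 := by linarith
    subst this
    have : (x - 2 / 3) * (x + 1 / 3) = 0 := by linear_combination b1
    rcases mul_eq_zero.1 this with h | h
    · exact hne2 (by linarith)
    · linarith
  · have b3 : (l - (1 - q)) * (l + x - q) = 0 := by linear_combination -b1 - b2
    have b4 := (mul_eq_zero.1 b3).resolve_left (sub_ne_zero.2 hlq)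
    have b5 : x * l = -((1 - q) * q) := by
      have : l = q - x := by linarith
      rw [this]
      linear_combination -b1
    have b6 : 0 ≤ x * l := by positivity
    have b7 : q = 0 := by nlinarith
    linarith

end

/-! ### Bifurcation values -/

variable {T : ℝ} {k : ℕ} (hk : (2 * π / T) ^ 2 * (k : ℝ) ^ 2 < R / 2)

include hk

theorem alphaBif_pos : 0 < alphaBif T R β k := by
  have h3 : 0 < √(R - 2 * ((2 * π / T) ^ 2 * (k : ℝ) ^ 2)) := sqrt_pos.2 (by linarith)
  unfold alphaBif
  positivity

theorem alphaBif_sq : alphaBif T R β k ^ 2 * β ^ 4 / R ^ 3 =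
    4 / 27 * (1 + (2 * π / T) ^ 2 * (k : ℝ) ^ 2 / R) ^ 2
      * (1 - 2 * ((2 * π / T) ^ 2 * (k : ℝ) ^ 2 / R)) := by
  have h3 : √(3 : ℝ) ^ 2 = 3 := sq_sqrt (by norm_num)
  have h30 : 0 < √(3 : ℝ) := by positivity
  unfold alphaBif
  rw [mul_pow, sq_sqrt (by linarith), mul_pow, div_pow, mul_pow, mul_pow, h3]
  field_simp
  ring

theorem alphaBif_lt_alphaMax (hT : 0 < T) (hk1 : 1 ≤ k) : alphaBif T R β k < alphaMax R β := by
  have h := (abs_lt_alphaMax_iff hR hβ (α := alphaBif T R β k)).2 ?_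
  · exact (le_abs_self _).trans_lt h
  rw [alphaBif_sq hR hβ hk]
  have hk0 : (0 : ℝ) < k := by exact_mod_cast hk1
  have hs : 0 < (2 * π / T) ^ 2 * (k : ℝ) ^ 2 / R := by positivity
  generalize (2 * π / T) ^ 2 * (k : ℝ) ^ 2 / R = s at *
  -- (1+s)²(1-2s) = 1 - 3s² - 2s³.
  nlinarith [mul_pos hs hs, mul_pos hs (mul_pos hs hs)]

omit hβ in
-- This is the shape q with 4 - 12q = 8κk²/R, at which the linearisation about φ_+ resonates with
-- the mode k.
theorem bifShape_mem : (1 - 2 * ((2 * π / T) ^ 2 * (k : ℝ) ^ 2 / R)) / 3 ∈ Icc (0 : ℝ) (1 / 3) := by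
  have h0 : 0 ≤ (2 * π / T) ^ 2 * (k : ℝ) ^ 2 / R := by positivity
  have h1 : (2 * π / T) ^ 2 * (k : ℝ) ^ 2 / R ≤ 1 / 2 := by
    rw [div_le_iff₀ hR]
    linarith
  constructor <;> linarith

theorem abs_lt_alphaBif_iff {α : ℝ} (hα : |α| ≤ alphaMax R β) : |α| < alphaBif T R β k ↔
    8 * ((2 * π / T) ^ 2 * (k : ℝ) ^ 2 / R) < 4 - 12 * shape R β α := by
  have h := shape_lt_iff hR hβ hα (bifShape_mem hR hk)
  rw [abs_lt_iff_of_pos hR hβ (alphaBif_pos hR hβ hk).le, alphaBif_sq hR hβ hk]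
  generalize (2 * π / T) ^ 2 * (k : ℝ) ^ 2 / R = s at *
  rw [show 4 / 27 * (1 + s) ^ 2 * (1 - 2 * s) =
    (1 - (1 - 2 * s) / 3) ^ 2 * ((1 - 2 * s) / 3) by ring, ← h]
  constructor <;> intro h <;> linarith

theorem abs_le_alphaBif_iff {α : ℝ} (hα : |α| ≤ alphaMax R β) : |α| ≤ alphaBif T R β k ↔
    8 * ((2 * π / T) ^ 2 * (k : ℝ) ^ 2 / R) ≤ 4 - 12 * shape R β α := by
  have h := shape_le_iff hR hβ hα (bifShape_mem hR hk)
  rw [abs_le_iff_of_pos hR hβ (alphaBif_pos hR hβ hk).le, alphaBif_sq hR hβ hk]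
  generalize (2 * π / T) ^ 2 * (k : ℝ) ^ 2 / R = s at *
  rw [show 4 / 27 * (1 + s) ^ 2 * (1 - 2 * s) =
    (1 - (1 - 2 * s) / 3) ^ 2 * ((1 - 2 * s) / 3) by ring, ← h]
  constructor <;> intro h <;> linarith

end

end LichWell

namespace LichWell

/-! ### The nonlinearity in normalised variables -/

/-- The zeroth order part of the reduced equation. -/
noncomputable def nonlin (R β α x : ℝ) : ℝ := (β ^ 2 * x ^ 5 + α ^ 2 * x ^ (-7 : ℤ) - R * x) / 8

theorem zpow_neg_seven (x : ℝ) : x ^ (-7 : ℤ) = (x ^ 7)⁻¹ := by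
  rw [zpow_neg]
  rfl

/-- In X = β²x⁴/R the sign of the nonlinearity is that of a cubic which depends on α only through
α²β⁴/R³. -/
theorem nonlin_mul {R β α x : ℝ} (hR : 0 < R) (hx : 0 < x) :
    nonlin R β α x * (8 * x ^ 7 * β ^ 4 / R ^ 3) =
      α ^ 2 * β ^ 4 / R ^ 3 - (β ^ 2 * x ^ 4 / R) ^ 2 * (1 - β ^ 2 * x ^ 4 / R) := by
  unfold nonlin
  rw [zpow_neg_seven]
  field_simp
  ring

theorem contDiffOn_nonlin (R β α : ℝ) : ContDiffOn ℝ 1 (nonlin R β α) (Ioi 0) := by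
  unfold nonlin
  simp only [zpow_neg_seven]
  have h : ContDiffOn ℝ 1 (fun x : ℝ => (x ^ 7)⁻¹) (Ioi 0) :=
    ContDiffOn.inv (by fun_prop) fun x hx => (pow_pos hx 7).ne'
  exact ((((by fun_prop : ContDiffOn ℝ 1 (fun x : ℝ => β ^ 2 * x ^ 5) (Ioi 0)).add
    (contDiffOn_const.mul h)).sub (by fun_prop)).div_const 8)

theorem contDiffOn_force (q : ℝ) : ContDiffOn ℝ 1 (fun y => -force q y) (Ioi 0) := by
  unfold force
  have h : ContDiffOn ℝ 1 (fun x : ℝ => q / x ^ 7) (Ioi 0) :=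
    ContDiffOn.div (by fun_prop) (by fun_prop) fun x hx => (pow_pos hx 7).ne'
  exact (((by fun_prop : ContDiffOn ℝ 1 (fun x : ℝ => (1 - q) * x ^ 5) (Ioi 0)).add h).sub
    contDiffOn_id).neg

/-- The frequency relating `ψ` to the normalised time. -/
noncomputable def freq (T R : ℝ) : ℝ := √(R / 8) * (T / (2 * π))

/-- The solution belonging to an orbit of the normalised well. -/
noncomputable def profile (T R β α r ψ : ℝ) : ℝ :=
  phiPlus R β α * pos (shape R β α) r (freq T R * ψ)

section

variable {T R β : ℝ} (hT : 0 < T) (hR : 0 < R) (hβ : 0 < β)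

include hT hR in
theorem freq_pos : 0 < freq T R := by
  unfold freq
  positivity

include hT hR in
theorem mul_freq_sq : (2 * π / T) ^ 2 * freq T R ^ 2 = R / 8 := by
  unfold freq
  rw [mul_pow, sq_sqrt (by positivity)]
  field_simp

include hR hβ in
theorem nonlin_phiPlus_mul {α y : ℝ} (hα : |α| ≤ alphaMax R β) (hy : 0 < y) :
    nonlin R β α (phiPlus R β α * y) = R / 8 * phiPlus R β α * force (shape R β α) y := by
  have h1 := phiPlus_pow (α := α) hR hβ
  have h2 := alpha_sq hR hβ hα
  have hc := phiPlus_pos (α := α) hR hβ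
  unfold nonlin force
  rw [zpow_neg_seven, h2]
  generalize phiPlus R β α = c at *
  generalize shape R β α = q at *
  field_simp
  linear_combination (y ^ 12) * h1

section Orbit

variable {α r : ℝ} (h : (shape R β α, r) ∈ orbits)

include h

omit h in
theorem hasDerivAt_mul_left {f : ℝ → ℝ} {f' a ψ : ℝ} (hf : HasDerivAt f f' (a * ψ)) :
    HasDerivAt (fun ψ => f (a * ψ)) (f' * a) ψ :=
  HasDerivAt.comp ψ hf (by simpa using (hasDerivAt_id ψ).const_mul a)

theorem hasDerivAt_profile (ψ : ℝ) : HasDerivAt (profile T R β α r)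
    (phiPlus R β α * (vel (shape R β α) r (freq T R * ψ) * freq T R)) ψ :=
  (hasDerivAt_mul_left (hasDerivAt_pos h _)).const_mul _

theorem deriv_profile : deriv (profile T R β α r) =
    fun ψ => phiPlus R β α * (vel (shape R β α) r (freq T R * ψ) * freq T R) :=
  funext fun ψ => (hasDerivAt_profile h ψ).deriv

theorem hasDerivAt_deriv_profile (ψ : ℝ) : HasDerivAt (deriv (profile T R β α r))
    (phiPlus R β α * (-force (shape R β α) (pos (shape R β α) r (freq T R * ψ)) * freq T R
      * freq T R)) ψ := by
  rw [deriv_profile h]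
  exact ((hasDerivAt_mul_left (hasDerivAt_vel h _)).mul_const _).const_mul _

theorem deriv_deriv_profile : deriv (deriv (profile T R β α r)) = fun ψ =>
    phiPlus R β α * (-force (shape R β α) (pos (shape R β α) r (freq T R * ψ)) * freq T R
      * freq T R) :=
  funext fun ψ => (hasDerivAt_deriv_profile h ψ).deriv

theorem profile_zero : profile T R β α r 0 = phiPlus R β α * inv (shape R β α) r := by
  unfold profile
  rw [mul_zero, pos_zero h]

include hR hβ in
theorem profile_pos (ψ : ℝ) : 0 < profile T R β α r ψ :=
  mul_pos (phiPlus_pos hR hβ) (pos_mem_dom h _).1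

include hT hR hβ in
theorem lichOp_profile (hα : |α| ≤ alphaMax R β) : lichOp T R β α (profile T R β α r) = 0 := by
  funext ψ
  have h1 := nonlin_phiPlus_mul hR hβ hα (pos_mem_dom h (freq T R * ψ)).1
  have h2 := mul_freq_sq hT hR
  have h3 : lichOp T R β α (profile T R β α r) ψ = (2 * π / T) ^ 2 *
      deriv (deriv (profile T R β α r)) ψ + nonlin R β α (profile T R β α r ψ) := rfl
  rw [h3, deriv_deriv_profile h]
  unfold profile
  rw [h1]
  simp only [Pi.zero_apply]
  linear_combination (-phiPlus R β α *
    force (shape R β α) (pos (shape R β α) r (freq T R * ψ))) * h2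

omit h in
theorem continuous_force_pos :
    Continuous fun w : orbits × ℝ => force w.1.1.1 (pos w.1.1.1 w.1.1.2 w.2) := by
  have hp := continuous_pos
  unfold force
  have h1 : ∀ w : orbits × ℝ, pos w.1.1.1 w.1.1.2 w.2 ^ 7 ≠ 0 := fun w =>
    pow_ne_zero 7 (pos_mem_dom w.1.2 w.2).1.ne'
  have h2 : Continuous fun w : orbits × ℝ => w.1.1.1 := by fun_prop
  exact (((continuous_const.sub h2).mul (hp.pow 5)).add (h2.div (hp.pow 7) h1)).sub hp

theorem contDiff_profile : ContDiff ℝ 2 (profile T R β α r) := by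
  have h2 : ContDiff ℝ 1 (deriv (profile T R β α r)) := by
    refine contDiff_one_iff_deriv.2 ⟨fun ψ => (hasDerivAt_deriv_profile h ψ).differentiableAt, ?_⟩
    rw [deriv_deriv_profile h]
    have hc : Continuous fun ψ : ℝ => ((⟨(shape R β α, r), h⟩ : orbits), freq T R * ψ) := by
      fun_prop
    have := (continuous_force_pos).comp hc
    exact continuous_const.mul ((this.neg.mul continuous_const).mul continuous_const)
  have := contDiff_succ_iff_deriv (n := 1) (𝕜 := ℝ) (f := profile T R β α r)
  rw [show (2 : WithTop ℕ∞) = 1 + 1 by norm_num, this]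
  exact ⟨fun ψ => (hasDerivAt_profile h ψ).differentiableAt, by simp, h2⟩

section Period

variable {k : ℕ} (hk1 : 1 ≤ k) (hk : k * half (shape R β α) r = π * freq T R)

include hk

omit h in
theorem freq_mul_two_pi : freq T R * (2 * π) = k * (2 * half (shape R β α) r) := by
  linear_combination (-2) * hk

omit h in
include hk1 in
theorem freq_mul_pi_div : freq T R * (π / k) = half (shape R β α) r := by
  have : (k : ℝ) ≠ 0 := by positivity
  field_simp
  linear_combination -hk

include hk1 in
theorem profile_periodic_div : Function.Periodic (profile T R β α r) (2 * π / k) := fun ψ => by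
  have e : freq T R * (ψ + 2 * π / k) = freq T R * ψ + 2 * half (shape R β α) r := by
    rw [← freq_mul_pi_div hk1 hk]
    ring
  unfold profile
  rw [e, pos_periodic h]

include hk1 in
theorem profile_mem : profile T R β α r ∈ c2EvenSubmodule := by
  refine ⟨contDiff_profile h, ?_, fun ψ => ?_⟩
  · have := (profile_periodic_div h hk1 hk).nat_mul k
    rwa [mul_div_cancel₀ _ (by positivity : (k : ℝ) ≠ 0)] at this
  · unfold profile
    rw [mul_neg, pos_neg h]

include hk1 in
theorem profile_neg (ψ : ℝ) : profile T R β α (-r) ψ = profile T R β α r (ψ + π / k) := by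
  unfold profile
  rw [mul_add, freq_mul_pi_div hk1 hk, pos_add_half h]

include hT hR hβ hk1 in
theorem hasIndex_profile (hr : r ≠ 0) : HasIndex T (phiPlus R β α) (profile T R β α r) k := by
  -- A negative radius shifts the polar angle of r(cos, sin) by π.
  obtain ⟨σ, hσ⟩ : ∃ σ : ℝ, (σ = 0 ∧ 0 < r) ∨ (σ = π ∧ r < 0) := by
    rcases hr.lt_or_gt with h | h
    · exact ⟨π, Or.inr ⟨rfl, h⟩⟩
    · exact ⟨0, Or.inl ⟨rfl, h⟩⟩
  have hmem := profile_mem h hk1 hk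
  set q := shape R β α with hq
  have hs := freq_pos hT hR
  have hang : Continuous (angle q r) :=
    continuous_iff_continuousAt.2 fun t => (hasDerivAt_angle h t).continuousAt
  refine hasIndex_of_lift (ϑ := fun ψ => angle q r (freq T R * ψ) + σ)
    hmem.1.continuous (C2Even.contDiff_deriv ⟨_, hmem⟩).continuous hmem.2.1 ?_ ?_ fun ψ => ?_
  · exact (hang.comp (continuous_const.mul continuous_id)).add continuous_const
  · have := angle_add_nat_mul_period h k 0
    simp only [zero_add, angle_zero h] at this
    simp only [mul_zero, angle_zero h, freq_mul_two_pi hk]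
    rw [← hq, this]
    push_cast
    ring
  · have hc := phiPlus_pos (α := α) hR hβ
    have hd : deriv (profile T R β α r) ψ = _ := (hasDerivAt_profile h ψ).deriv
    rw [hd]
    unfold profile vel
    rw [← hq]
    set t := freq T R * ψ
    have hx := mul_cos_mem_range h (angle q r t)
    -- Up to positive factors, this is the scalar product of the curve seen from φ_+ with the circle
    -- in amplitude coordinates. It is positive since position - 1 and `amp` have the same sign.
    have key : 0 < (pos q r t - 1) * (r * cos (angle q r t))
        + 2 * π / T * freq T R * (r * sin (angle q r t)) ^ 2 := by
      have hC : 0 < 2 * π / T * freq T R := by positivity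
      rcases lt_trichotomy (r * cos (angle q r t)) 0 with h0 | h0 | h0
      · have : pos q r t < 1 := by
          unfold pos
          rwa [inv_lt_iff h.1 hx (one_mem_dom h.1), amp_one]
        have := mul_pos (sub_pos.2 this) (neg_pos.2 h0)
        have : 0 ≤ 2 * π / T * freq T R * (r * sin (angle q r t)) ^ 2 := by positivity
        linarith
      · have h1 : cos (angle q r t) = 0 := (mul_eq_zero.1 h0).resolve_left hr
        have h2 : sin (angle q r t) ≠ 0 := fun h2 => by
          have := sin_sq_add_cos_sq (angle q r t)
          rw [h1, h2] at this
          norm_num at this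
        rw [h0, mul_zero, zero_add]
        positivity
      · have : 1 < pos q r t := by
          unfold pos
          rwa [lt_inv_iff h.1 hx (one_mem_dom h.1), amp_one]
        have := mul_pos (sub_pos.2 this) h0
        have : 0 ≤ 2 * π / T * freq T R * (r * sin (angle q r t)) ^ 2 := by positivity
        linarith
    have key2 := mul_pos hc key
    rcases hσ with ⟨rfl, hr0⟩ | ⟨rfl, hr0⟩
    · rw [add_zero]
      refine pos_of_mul_pos_left (b := r) ?_ hr0.le
      refine key2.trans_eq ?_
      ring
    · rw [cos_add_pi, sin_add_pi]
      refine pos_of_mul_pos_left (b := -r) ?_ (neg_pos.2 hr0).le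
      refine key2.trans_eq ?_
      ring

end Period

end Orbit

end

/-- An element of `C²_even` from its underlying function. -/
def ofMem (f : ℝ → ℝ) (h : f ∈ c2EvenSubmodule) : C2Even := ⟨f, h⟩

theorem coe_ofMem (f : ℝ → ℝ) (h : f ∈ c2EvenSubmodule) : (ofMem f h : ℝ → ℝ) = f := rfl

/-- `profile` as an element of `C²_even`. -/
noncomputable def wave (T R β α r : ℝ) : C2Even :=
  open Classical in
  if h : profile T R β α r ∈ c2EvenSubmodule then ofMem (profile T R β α r) h else 0

/-- Under the period condition the default value 0 of `wave` is not taken. -/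
theorem coe_wave {T R β α r : ℝ} {k : ℕ} (h : (shape R β α, r) ∈ orbits) (hk1 : 1 ≤ k)
    (hk : k * half (shape R β α) r = π * freq T R) :
    (wave T R β α r : ℝ → ℝ) = profile T R β α r := by
  unfold wave
  rw [dif_pos (profile_mem h hk1 hk), coe_ofMem]

theorem continuous_wave {T R β : ℝ} {k : ℕ} (hk1 : 1 ≤ k) {Z : Type*} [TopologicalSpace Z]
    {α r : Z → ℝ} (hα : Continuous α) (hr : Continuous r)
    (h : ∀ z, (shape R β (α z), r z) ∈ orbits)
    (hk : ∀ z, k * half (shape R β (α z)) (r z) = π * freq T R) :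
    Continuous fun z => wave T R β (α z) (r z) := by
  have hq : Continuous fun z => shape R β (α z) := (continuous_shape R β).comp hα
  have hc : Continuous fun w : Z × ℝ => phiPlus R β (α w.1) :=
    (continuous_phiPlus R β).comp (hα.comp continuous_fst)
  have hm : Continuous fun w : Z × ℝ =>
      ((⟨(shape R β (α w.1), r w.1), h w.1⟩ : orbits), freq T R * w.2) := by
    have : Continuous fun w : Z × ℝ => (⟨(shape R β (α w.1), r w.1), h w.1⟩ : orbits) :=
      ((hq.comp continuous_fst).prodMk (hr.comp continuous_fst)).subtype_mk _
    exact this.prodMk (by fun_prop)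
  have h0 := continuous_pos.comp hm
  have h1 := continuous_vel.comp hm
  refine C2Even.continuous_of_jet ?_ ?_ ?_
  · simp only [fun z => coe_wave (h z) hk1 (hk z)]
    exact hc.mul h0
  · simp only [fun z => coe_wave (h z) hk1 (hk z), fun z => deriv_profile (T := T) (h z)]
    exact hc.mul (h1.mul continuous_const)
  · simp only [fun z => coe_wave (h z) hk1 (hk z), fun z => deriv_deriv_profile (T := T) (h z)]
    have h2 := continuous_force_pos.comp hm
    exact hc.mul ((h2.neg.mul continuous_const).mul continuous_const)

end LichWell

namespace LichWell

/-! ### Constant solutions -/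

section

variable {T R β : ℝ} (hT : 0 < T) (hR : 0 < R) (hβ : 0 < β)

include hR hβ in
theorem nonlin_phiPlus {α : ℝ} (hα : |α| ≤ alphaMax R β) : nonlin R β α (phiPlus R β α) = 0 := by
  have := nonlin_phiPlus_mul hR hβ hα one_pos
  rwa [mul_one, force_one, mul_zero] at this

include hR hβ in
theorem nonlin_phiMinus {α : ℝ} (hα : |α| ≤ alphaMax R β) (hd : 0 < phiMinus R β α) :
    nonlin R β α (phiMinus R β α) = 0 := by
  have h := nonlin_mul (β := β) (α := α) hR hd
  rw [phiMinus_pow hR hβ, mul_div_cancel_left₀ _ hR.ne', lower_cubic hR hβ hα, sub_self] at h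
  exact (mul_eq_zero.1 h).resolve_right (by positivity)

include hβ in
theorem eq_of_mul_pow_eq {x y : ℝ} (hx : 0 < x) (hy : 0 ≤ y) (h : β ^ 2 * x ^ 4 = β ^ 2 * y ^ 4) :
    x = y := by
  have := mul_left_cancel₀ (by positivity : β ^ 2 ≠ 0) h
  exact (pow_left_inj₀ hx.le hy (by norm_num)).1 this

include hR hβ in
theorem eq_of_nonlin_eq_zero {α x : ℝ} (hx : 0 < x) (h : nonlin R β α x = 0) :
    |α| ≤ alphaMax R β ∧ (x = phiPlus R β α ∨ α ≠ 0 ∧ x = phiMinus R β α) := by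
  have h1 := nonlin_mul (β := β) (α := α) hR hx
  rw [h, zero_mul] at h1
  have h2 : (β ^ 2 * x ^ 4 / R) ^ 2 * (1 - β ^ 2 * x ^ 4 / R) = α ^ 2 * β ^ 4 / R ^ 3 := by linarith
  have hX : 0 < β ^ 2 * x ^ 4 / R := by positivity
  have hα : |α| ≤ alphaMax R β := by
    rw [abs_le_alphaMax_iff hR hβ, ← h2]
    exact cubic_le hX.le
  refine ⟨hα, ?_⟩
  rcases cubic_roots hR hβ hα hX h2 with h3 | h3
  · left
    rw [div_eq_iff hR.ne', mul_comm, mul_comm _ R, ← phiPlus_pow hR hβ, mul_comm] at h3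
    exact eq_of_mul_pow_eq hβ hx (phiPlus_pos hR hβ).le h3
  · have h4 := h3
    rw [div_eq_iff hR.ne', mul_comm, mul_comm _ R, ← phiMinus_pow hR hβ, mul_comm] at h4
    -- For α = 0 the cubic is X²(1 - X) = 0, whose only positive root X = 1 belongs to φ_+.
    by_cases h0 : α = 0
    · left
      have h5 : β ^ 2 * x ^ 4 / R = 1 - shape R β α := by
        have a1 := shape_cubic hR hβ hα
        rw [h0] at a1 h2 ⊢
        have a2 := (shape_mem (R := R) (β := β) (α := 0)).2
        have a3 : shape R β 0 = 0 := by
          have : (1 - shape R β 0) ^ 2 * shape R β 0 = 0 := by rw [a1]; ring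
          exact (mul_eq_zero.1 this).resolve_left (pow_ne_zero 2 (by linarith))
        have a4 : (β ^ 2 * x ^ 4 / R) ^ 2 * (1 - β ^ 2 * x ^ 4 / R) = 0 := by rw [h2]; ring
        have := (mul_eq_zero.1 a4).resolve_left (by positivity)
        rw [a3]
        linarith
      rw [div_eq_iff hR.ne', mul_comm, mul_comm _ R, ← phiPlus_pow hR hβ, mul_comm] at h5
      exact eq_of_mul_pow_eq hβ hx (phiPlus_pos hR hβ).le h5
    · exact Or.inr ⟨h0, eq_of_mul_pow_eq hβ hx (phiMinus_nonneg hR hβ) h4⟩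

include hR hβ in
-- By `nonlin_mul`, negativity puts α²β⁴/R³ strictly below a value of X²(1 - X), hence below 4/27.
theorem abs_lt_alphaMax_of_nonlin_neg {α x : ℝ} (hx : 0 < x) (h : nonlin R β α x < 0) :
    |α| < alphaMax R β := by
  have h1 := nonlin_mul (β := β) (α := α) hR hx
  have h2 : nonlin R β α x * (8 * x ^ 7 * β ^ 4 / R ^ 3) < 0 :=
    mul_neg_of_neg_of_pos h (by positivity)
  have h3 := cubic_le (x := β ^ 2 * x ^ 4 / R) (by positivity)
  rw [abs_lt_alphaMax_iff hR hβ]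
  linarith

include hR hβ in
theorem shape_lt {α : ℝ} (hα : |α| < alphaMax R β) : shape R β α ∈ Ico 0 (1 / 3) := by
  refine ⟨shape_mem.1, ?_⟩
  rw [shape_lt_iff hR hβ hα.le ⟨by norm_num, le_rfl⟩]
  rw [abs_lt_alphaMax_iff hR hβ] at hα
  linarith

theorem isEvenSolution_const {α c : ℝ} (hc : 0 < c) (h : nonlin R β α c = 0) :
    IsEvenSolution T R β α (C2Even.const c) := by
  refine ⟨fun _ => hc, funext fun ψ => ?_⟩
  have h1 : deriv (fun _ : ℝ => c) = fun _ => 0 := funext fun x => deriv_const x c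
  change (2 * π / T) ^ 2 * deriv (deriv fun _ : ℝ => c) ψ + nonlin R β α c = 0
  rw [h1, deriv_const, h]
  ring

include hT hR hβ in
theorem isEvenSolution_wave {α r : ℝ} {k : ℕ} (hα : |α| ≤ alphaMax R β)
    (h : (shape R β α, r) ∈ orbits) (hk1 : 1 ≤ k)
    (hk : k * half (shape R β α) r = π * freq T R) : IsEvenSolution T R β α (wave T R β α r) := by
  have e := coe_wave h hk1 hk
  refine ⟨fun ψ => ?_, ?_⟩
  · rw [e]; exact profile_pos hR hβ h ψ
  · rw [e]; exact lichOp_profile hT hR hβ h hα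

/-! ### All solutions -/

theorem IsCircleSolution.hasDerivAt {α : ℝ} {φ : ℝ → ℝ} (h : IsCircleSolution T R β α φ) (ψ : ℝ) :
    HasDerivAt φ (deriv φ ψ) ψ :=
  (h.1.differentiable (by norm_num) ψ).hasDerivAt

include hT in
theorem IsCircleSolution.hasDerivAt_deriv {α : ℝ} {φ : ℝ → ℝ} (h : IsCircleSolution T R β α φ)
    (ψ : ℝ) : HasDerivAt (deriv φ) (-nonlin R β α (φ ψ) / (2 * π / T) ^ 2) ψ := by
  have h1 : ContDiff ℝ (1 + 1) φ := by
    rw [show (1 + 1 : WithTop ℕ∞) = 2 by norm_num]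
    exact h.1
  have h2 := ((contDiff_succ_iff_deriv.1 h1).2.2.differentiable (by norm_num) ψ).hasDerivAt
  refine h2.congr_deriv ?_
  have h3 : (2 * π / T) ^ 2 * deriv (deriv φ) ψ + nonlin R β α (φ ψ) = 0 := congrFun h.2.2.2 ψ
  have : (2 * π / T) ^ 2 ≠ 0 := by positivity
  field_simp at h3 ⊢
  linarith

include hT in
-- Otherwise φ'' < 0 at the minimum makes it a local maximum as well, so φ is locally constant and
-- φ'' = 0 there.
theorem nonlin_nonpos_of_min {α : ℝ} {φ : ℝ → ℝ} (h : IsCircleSolution T R β α φ) {a : ℝ}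
    (ha : ∀ ψ, φ a ≤ φ ψ) : nonlin R β α (φ a) ≤ 0 := by
  by_contra hc
  push Not at hc
  have hmin : IsLocalMin φ a := Eventually.of_forall ha
  have hd : deriv φ a = 0 := hmin.deriv_eq_zero
  have hdd := IsCircleSolution.hasDerivAt_deriv hT h a
  have hneg : -nonlin R β α (φ a) / (2 * π / T) ^ 2 < 0 :=
    div_neg_of_neg_of_pos (neg_lt_zero.2 hc) (by positivity)
  have hmax : IsLocalMax φ a := isLocalMax_of_deriv_deriv_neg (by rwa [hdd.deriv]) hd
    (IsCircleSolution.hasDerivAt h a).continuousAt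
  have he : φ =ᶠ[𝓝 a] fun _ => φ a := by
    filter_upwards [hmax] with ψ hψ using le_antisymm hψ (ha ψ)
  have he2 : deriv φ =ᶠ[𝓝 a] fun _ => 0 := by
    filter_upwards [he.eventually_nhds] with ψ hψ
    rw [EventuallyEq.deriv_eq hψ, deriv_const]
  have := he2.deriv_eq
  rw [hdd.deriv, deriv_const] at this
  exact hneg.ne this

include hT hR hβ in
/-- Every solution is constant or, seen from any of its critical points, one of the explicit
ones. -/
theorem circle_solution_cases {α : ℝ} {φ : ℝ → ℝ} (h : IsCircleSolution T R β α φ) {ψ₀ : ℝ}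
    (h0 : deriv φ ψ₀ = 0) :
    (|α| ≤ alphaMax R β ∧ φ = fun _ => phiPlus R β α) ∨
    (α ≠ 0 ∧ |α| ≤ alphaMax R β ∧ φ = fun _ => phiMinus R β α) ∨
    (|α| < alphaMax R β ∧ ∃ r : ℝ, r ≠ 0 ∧ (shape R β α, r) ∈ orbits ∧
      (∃ k : ℕ, 1 ≤ k ∧ k * half (shape R β α) r = π * freq T R) ∧
      ∀ ψ, φ (ψ + ψ₀) = profile T R β α r ψ) := by
  have hκ : (2 * π / T) ^ 2 ≠ 0 := by positivity
  have hcont : Continuous φ := h.1.continuous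
  have hk := h.2.1.compact_of_continuous two_pi_pos.ne' hcont
  obtain ⟨_, ⟨a, rfl⟩, ha⟩ := hk.exists_isLeast ⟨φ 0, mem_range_self 0⟩
  have ha : ∀ ψ, φ a ≤ φ ψ := fun ψ => ha (mem_range_self ψ)
  have hda : deriv φ a = 0 := IsLocalMin.deriv_eq_zero (Eventually.of_forall ha)
  have hpos := h.2.2.1
  rcases (nonlin_nonpos_of_min hT h ha).eq_or_lt with hn | hn
  -- A minimum at a zero of the nonlinearity has the Cauchy data of a constant solution.
  · have hconst : φ = fun _ => φ a := by
      refine eq_of_second_order (G := fun x => -nonlin R β α x / (2 * π / T) ^ 2)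
        ((contDiffOn_nonlin R β α).neg.div_const _)
        (IsCircleSolution.hasDerivAt h) (IsCircleSolution.hasDerivAt_deriv hT h)
        (v₂ := fun _ => 0) (fun t => hasDerivAt_const t _) (fun t => ?_) h.2.1 two_pi_pos hpos
        (c₂ := 1) (fun _ => rfl) one_pos (fun _ => hpos a) (t₀ := a) rfl hda
      simpa [hn] using hasDerivAt_const t (0 : ℝ)
    obtain ⟨h1, h2 | ⟨h2, h3⟩⟩ := eq_of_nonlin_eq_zero hR hβ (hpos a) hn
    · exact Or.inl ⟨h1, by rw [hconst, h2]⟩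
    · exact Or.inr (Or.inl ⟨h2, h1, by rw [hconst, h3]⟩)
  · right; right
    have hα := abs_lt_alphaMax_of_nonlin_neg hR hβ (hpos a) hn
    have hq := shape_lt hR hβ hα
    have hc := phiPlus_pos (α := α) hR hβ
    have hnl : ∀ y : ℝ, 0 < y → _ := fun y hy => nonlin_phiPlus_mul (y := y) hR hβ hα.le hy
    set q := shape R β α with hqdef
    set c := phiPlus R β α with hcdef
    have hYpos : ∀ ψ, 0 < φ ψ / c := fun ψ => div_pos (hpos ψ) hc
    have hcY : ∀ ψ, c * (φ ψ / c) = φ ψ := fun ψ => mul_div_cancel₀ _ hc.ne'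
    -- Negative force places the minimum to the left of 1 and, by the factorisation of `force`,
    -- inside `dom q`; being upward closed, `dom q` then contains the whole solution.
    have hfa : force q (φ a / c) < 0 := by
      have := hnl _ (hYpos a)
      rw [hcY] at this
      rw [this] at hn
      exact neg_of_mul_neg_right hn (by positivity)
    have hya1 : φ a / c < 1 := by
      by_contra hc1
      push Not at hc1
      rcases hc1.eq_or_lt with he | hl
      · rw [← he, force_one] at hfa; exact lt_irrefl _ hfa
      · exact hfa.not_gt (force_pos hq hl)
    have hya : φ a / c ∈ dom q := by
      refine ⟨hYpos a, ?_⟩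
      rw [force_eq (hYpos a).ne'] at hfa
      have h7 := pow_pos (hYpos a) 7
      have h4 : (φ a / c) ^ 4 - 1 < 0 := sub_neg.2 (pow_lt_one₀ (hYpos a).le hya1 (by norm_num))
      by_contra hc2
      push Not at hc2
      exact hfa.not_ge (div_nonneg (mul_nonneg_of_nonpos_of_nonpos h4.le hc2) h7.le)
    have hY : ∀ ψ, φ ψ / c ∈ dom q := fun ψ =>
      dom_upward hq hya (by have := ha ψ; gcongr)
    have hs := freq_pos hT hR
    have hs2 := mul_freq_sq hT hR
    set s := freq T R with hsdef
    have hdY : ∀ ψ, HasDerivAt (fun ψ => φ ψ / c) (deriv φ ψ / c) ψ := fun ψ =>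
      (IsCircleSolution.hasDerivAt h ψ).div_const c
    have hdV : ∀ ψ, HasDerivAt (fun ψ => deriv φ ψ / c) (-(s ^ 2 * force q (φ ψ / c))) ψ :=
      fun ψ => by
        refine ((IsCircleSolution.hasDerivAt_deriv hT h ψ).div_const c).congr_deriv ?_
        have := hnl _ (hYpos ψ)
        rw [hcY] at this
        rw [this, ← hs2]
        field_simp
    have hE : ∀ x y, (deriv φ x / c) ^ 2 + s ^ 2 * (2 * pot q (φ x / c)) =
        (deriv φ y / c) ^ 2 + s ^ 2 * (2 * pot q (φ y / c)) := by
      have hd : ∀ ψ, HasDerivAt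
          (fun ψ => (deriv φ ψ / c) ^ 2 + s ^ 2 * (2 * pot q (φ ψ / c))) 0 ψ :=
        fun ψ => by
          have hp : HasDerivAt (fun ψ => pot q (φ ψ / c)) (force q (φ ψ / c) * (deriv φ ψ / c)) ψ :=
            HasDerivAt.comp (h₂ := pot q) ψ (hasDerivAt_pot (hYpos ψ).ne') (hdY ψ)
          refine (((hdV ψ).pow 2).add ((hp.const_mul 2).const_mul (s ^ 2))).congr_deriv ?_
          simp only [Nat.cast_ofNat, Nat.add_one_sub_one, pow_one]
          ring
      exact is_const_of_deriv_eq_zero (fun ψ => (hd ψ).differentiableAt) fun ψ => (hd ψ).deriv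
    -- At the critical point ψ₀ all energy is potential, so `amp` there is the signed radius. The
    -- minimum has the same energy and lies to the left of 1, hence has amplitude -|r|, which places
    -- (q, r) in `orbits`.
    obtain ⟨r, hr⟩ : ∃ r, r = amp q (φ ψ₀ / c) := ⟨_, rfl⟩
    have hamp : r ^ 2 = amp q (φ a / c) ^ 2 := by
      have := hE ψ₀ a
      rw [h0, hda, ← amp_sq hq (hY ψ₀), ← amp_sq hq (hY a)] at this
      rw [hr]
      exact mul_left_cancel₀ (pow_ne_zero 2 hs.ne') (by linarith)
    have hampa : amp q (φ a / c) < 0 := by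
      have := strictMonoOn_amp hq hya (one_mem_dom hq) hya1
      rwa [amp_one] at this
    have habs : -|r| = amp q (φ a / c) := by
      rw [(sq_eq_sq_iff_abs_eq_abs r _).1 hamp, abs_of_neg hampa, neg_neg]
    have ho : (q, r) ∈ orbits := ⟨hq, by rw [habs]; exact ⟨_, hya, rfl⟩⟩
    have hr0 : r ≠ 0 := fun h => by rw [h, abs_zero, neg_zero] at habs; exact hampa.ne habs.symm
    have hinv : inv q r = φ ψ₀ / c := by rw [hr]; exact inv_amp hq (hY ψ₀)
    have haff : ∀ t, HasDerivAt (fun t : ℝ => ψ₀ + t / s) (1 / s) t := fun t =>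
      ((hasDerivAt_id t).div_const s).const_add ψ₀
    have hper : Function.Periodic (fun t => φ (ψ₀ + t / s) / c) (s * (2 * π)) := fun t => by
      have : ψ₀ + (t + s * (2 * π)) / s = ψ₀ + t / s + 2 * π := by field_simp; ring
      simp only [this, h.2.1 _]
    have heq : (fun t => φ (ψ₀ + t / s) / c) = pos q r := by
      refine eq_of_second_order (G := fun y => -force q y) (v₁ := fun t => deriv φ (ψ₀ + t / s) / c
        * (1 / s)) (contDiffOn_force q) (fun t => ?_) (fun t => ?_) (hasDerivAt_pos ho)
        (hasDerivAt_vel ho) hper (by positivity) (fun t => hYpos _) (pos_periodic ho)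
        (mul_pos two_pos (half_pos ho)) (fun t => (pos_mem_dom ho t).1) (t₀ := 0) ?_ ?_
      · exact (hdY _).comp t (haff t)
      · refine (((hdV _).comp t (haff t)).mul_const (1 / s)).congr_deriv ?_
        field_simp
      · rw [pos_zero ho, hinv, zero_div, add_zero]
      · rw [vel_zero ho, zero_div, add_zero, h0]
        simp
    refine ⟨hα, r, hr0, ho, ?_, fun ψ => ?_⟩
    · have hp0 : pos q r (s * (2 * π)) = pos q r 0 := by
        rw [← heq]
        have := hper 0
        rwa [zero_add] at this
      obtain ⟨k, hk1, hk⟩ := exists_nat_of_pos_eq ho hr0 (by positivity) hp0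
      exact ⟨k, hk1, by linarith⟩
    · unfold profile
      rw [← hqdef, ← hcdef, ← hsdef, ← heq]
      simp only [mul_div_cancel_left₀ _ hs.ne', add_comm ψ₀, hcY]

end

end LichWell

namespace LichWell

/-! ### The bifurcating curves -/

/-- The amplitude of the solution with minimal period `2π/k`. -/
noncomputable def amplitude (T R β : ℝ) (k : ℕ) (α : ℝ) : ℝ :=
  open Classical in
  if h : ∃ r, 0 ≤ r ∧ (shape R β α, r) ∈ orbits ∧ k * half (shape R β α) r = π * freq T R
  then h.choose else 0

/-- Strict monotonicity of the period leaves nothing to choose in `amplitude`. -/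
theorem amplitude_eq {T R β : ℝ} {k : ℕ} {α r : ℝ} (hk1 : 1 ≤ k) (hr : 0 ≤ r)
    (h : (shape R β α, r) ∈ orbits) (hk : k * half (shape R β α) r = π * freq T R) :
    amplitude T R β k α = r := by
  have hex : ∃ r, 0 ≤ r ∧ (shape R β α, r) ∈ orbits ∧
    k * half (shape R β α) r = π * freq T R := ⟨r, hr, h, hk⟩
  unfold amplitude
  rw [dif_pos hex]
  obtain ⟨h1, h2, h3⟩ := hex.choose_spec
  refine half_inj h1 hr h2 h ?_
  have hk0 : (k : ℝ) ≠ 0 := by positivity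
  exact mul_left_cancel₀ hk0 (h3.trans hk.symm)

section

variable {T R β : ℝ} (hT : 0 < T) (hR : 0 < R) (hβ : 0 < β)

include hT hR in
-- Compares k small oscillations with the available time. The squared form avoids roots and yields
-- both the strict and the weak threshold.
theorem half_zero_sq {q : ℝ} {k : ℕ} (hq : q ∈ Ico (0 : ℝ) (1 / 3)) :
    8 * ((2 * π / T) ^ 2 * (k : ℝ) ^ 2 / R) * (π * freq T R) ^ 2 =
      (4 - 12 * q) * (k * half q 0) ^ 2 := by
  have h1 := rate_zero hq
  have h2 := mul_freq_sq hT hR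
  rw [half_zero]
  have e : 8 * ((2 * π / T) ^ 2 * (k : ℝ) ^ 2 / R) * (π * freq T R) ^ 2 =
      8 * (k : ℝ) ^ 2 * π ^ 2 / R * ((2 * π / T) ^ 2 * freq T R ^ 2) := by ring
  rw [e, h2]
  field_simp
  linear_combination (-(k : ℝ) ^ 2) * h1

include hT hR in
theorem half_zero_lt_iff {q : ℝ} {k : ℕ} (hq : q ∈ Ico (0 : ℝ) (1 / 3)) :
    k * half q 0 < π * freq T R ↔ 8 * ((2 * π / T) ^ 2 * (k : ℝ) ^ 2 / R) < 4 - 12 * q := by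
  have h := half_zero_sq (k := k) hT hR hq
  have hf := freq_pos hT hR
  have hh := half_pos (zero_mem_orbits hq)
  have hq1 : 0 < 4 - 12 * q := by linarith [hq.2]
  have hB : 0 < π * freq T R := by positivity
  have hA : 0 ≤ k * half q 0 := by positivity
  rw [← pow_lt_pow_iff_left₀ hA hB.le two_ne_zero]
  constructor
  · intro hl
    by_contra hc
    push Not at hc
    nlinarith [mul_lt_mul_of_pos_left hl hq1,
      mul_le_mul_of_nonneg_right hc (sq_nonneg (π * freq T R))]
  · intro hl
    have := mul_lt_mul_of_pos_right hl (pow_pos hB 2)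
    rw [h] at this
    exact lt_of_mul_lt_mul_left this hq1.le

include hT hR in
theorem half_zero_le_iff {q : ℝ} {k : ℕ} (hq : q ∈ Ico (0 : ℝ) (1 / 3)) :
    k * half q 0 ≤ π * freq T R ↔ 8 * ((2 * π / T) ^ 2 * (k : ℝ) ^ 2 / R) ≤ 4 - 12 * q := by
  have h := half_zero_sq (k := k) hT hR hq
  have hf := freq_pos hT hR
  have hh := half_pos (zero_mem_orbits hq)
  have hq1 : 0 < 4 - 12 * q := by linarith [hq.2]
  have hB : 0 < π * freq T R := by positivity
  have hA : 0 ≤ k * half q 0 := by positivity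
  rw [← pow_le_pow_iff_left₀ hA hB.le two_ne_zero]
  constructor
  · intro hl
    have := mul_le_mul_of_nonneg_left hl hq1.le
    rw [← h] at this
    exact le_of_mul_le_mul_right this (pow_pos hB 2)
  · intro hl
    have := mul_le_mul_of_nonneg_right hl (sq_nonneg (π * freq T R))
    rw [h] at this
    exact le_of_mul_le_mul_left this hq1

include hT hR hβ in
-- A finite oscillation takes strictly longer than an infinitesimal one, so the linear condition
-- holds strictly. That condition is |α| < α_{k,+}, and since q ≥ 0 it also forces κk² < R/2.
theorem admissible_of_amplitude {k : ℕ} {α r : ℝ} (hα : |α| < alphaMax R β) (hr0 : r ≠ 0)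
    (h : (shape R β α, r) ∈ orbits) (hk1 : 1 ≤ k)
    (hk : k * half (shape R β α) r = π * freq T R) :
    (2 * π / T) ^ 2 * (k : ℝ) ^ 2 < R / 2 ∧ |α| < alphaBif T R β k ∧
      (r = amplitude T R β k α ∨ r = -amplitude T R β k α) := by
  have h' : (shape R β α, |r|) ∈ orbits := ⟨h.1, by rw [abs_abs]; exact h.2⟩
  have hkr : k * half (shape R β α) |r| = π * freq T R := by
    rcases abs_choice r with he | he <;> rw [he]
    · exact hk
    · rw [half_neg]; exact hk
  have hk0 : (0 : ℝ) < k := by positivity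
  have hlt := half_strictMono h' le_rfl (abs_pos.2 hr0)
  have h1 : k * half (shape R β α) 0 < π * freq T R := by
    rw [← hkr]
    exact mul_lt_mul_of_pos_left hlt hk0
  rw [half_zero_lt_iff hT hR h.1] at h1
  have h2 : (2 * π / T) ^ 2 * (k : ℝ) ^ 2 < R / 2 := by
    have h3 : (2 * π / T) ^ 2 * (k : ℝ) ^ 2 / R < 1 / 2 := by linarith [h.1.1]
    rw [div_lt_iff₀ hR] at h3
    linarith
  refine ⟨h2, (abs_lt_alphaBif_iff hR hβ h2 hα.le).2 h1, ?_⟩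
  rw [amplitude_eq hk1 (abs_nonneg r) h' hkr]
  rcases abs_choice r with he | he <;> rw [he]
  · exact Or.inl rfl
  · exact Or.inr (neg_neg r).symm

section Curve

variable {k : ℕ} (hk1 : 1 ≤ k) (hk : (2 * π / T) ^ 2 * (k : ℝ) ^ 2 < R / 2)

include hT hR hβ hk1 hk

theorem abs_lt_alphaMax_of_le {α : ℝ} (hα : |α| ≤ alphaBif T R β k) : |α| < alphaMax R β :=
  hα.trans_lt (alphaBif_lt_alphaMax hR hβ hk hT hk1)

theorem amplitude_spec {α : ℝ} (hα : |α| ≤ alphaBif T R β k) :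
    0 ≤ amplitude T R β k α ∧ (shape R β α, amplitude T R β k α) ∈ orbits ∧
      k * half (shape R β α) (amplitude T R β k α) = π * freq T R := by
  have hm := abs_lt_alphaMax_of_le hT hR hβ hk1 hk hα
  have hq := shape_lt hR hβ hm
  have h1 := (abs_le_alphaBif_iff hR hβ hk hm.le).1 hα
  rw [← half_zero_le_iff hT hR hq] at h1
  have hk0 : (0 : ℝ) < k := by positivity
  obtain ⟨r, hr, ho, hB⟩ := exists_half_eq hq (B := π * freq T R / k) (by
    rw [le_div_iff₀ hk0]; linarith)
  have hB' : k * half (shape R β α) r = π * freq T R := by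
    rw [hB, mul_div_cancel₀ _ hk0.ne']
  rw [amplitude_eq hk1 hr ho hB']
  exact ⟨hr, ho, hB'⟩

theorem amplitude_pos {α : ℝ} (hα : |α| < alphaBif T R β k) : 0 < amplitude T R β k α := by
  obtain ⟨h0, ho, h⟩ := amplitude_spec hT hR hβ hk1 hk hα.le
  have hm := abs_lt_alphaMax_of_le hT hR hβ hk1 hk hα.le
  refine h0.lt_of_ne fun he => ?_
  have h1 := (abs_lt_alphaBif_iff hR hβ hk hm.le).1 hα
  rw [← half_zero_lt_iff hT hR ho.1] at h1
  rw [← he] at h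
  exact h1.ne h

theorem amplitude_eq_zero {α : ℝ} (hα : |α| = alphaBif T R β k) : amplitude T R β k α = 0 := by
  have hm := abs_lt_alphaMax_of_le hT hR hβ hk1 hk hα.le
  have hq := shape_lt hR hβ hm
  refine amplitude_eq hk1 le_rfl (zero_mem_orbits hq) (le_antisymm ?_ ?_)
  · rw [half_zero_le_iff hT hR hq, ← abs_le_alphaBif_iff hR hβ hk hm.le]
    exact hα.le
  · rw [← not_lt, half_zero_lt_iff hT hR hq, ← abs_lt_alphaBif_iff hR hβ hk hm.le]
    exact hα.not_lt

omit hT hR hβ hk1 hk in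
theorem sign_mul_mem_orbits {α σ r B : ℝ} (hσ : σ = 1 ∨ σ = -1)
    (h : (shape R β α, r) ∈ orbits ∧ k * half (shape R β α) r = B) :
    (shape R β α, σ * r) ∈ orbits ∧ k * half (shape R β α) (σ * r) = B := by
  rcases hσ with rfl | rfl
  · rwa [one_mul]
  · rw [neg_one_mul, half_neg]
    exact ⟨neg_mem_orbits h.1, h.2⟩

/-- The endpoints, where the amplitude is 0, are included: the limits of the curves are read off
from here. -/
theorem continuousOn_curve {σ : ℝ} (hσ : σ = 1 ∨ σ = -1) :
    ContinuousOn (fun α => wave T R β α (σ * amplitude T R β k α))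
      (Icc (-alphaBif T R β k) (alphaBif T R β k)) := by
  rw [continuousOn_iff_continuous_domRestrict]
  have hs : ∀ α : Icc (-alphaBif T R β k) (alphaBif T R β k), _ := fun α =>
    amplitude_spec hT hR hβ hk1 hk (abs_le.2 α.2)
  have hk0 : (k : ℝ) ≠ 0 := by positivity
  have hcont : Continuous fun α : Icc (-alphaBif T R β k) (alphaBif T R β k) =>
      amplitude T R β k α :=
    continuous_of_half_eq (q := fun α : Icc (-alphaBif T R β k) (alphaBif T R β k) =>
      shape R β α) (B := π * freq T R / k)
      ((continuous_shape R β).comp continuous_subtype_val) (fun α => (hs α).1)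
      (fun α => (hs α).2.1) fun α => by rw [eq_div_iff hk0, mul_comm]; exact (hs α).2.2
  exact continuous_wave hk1 (α := fun α : Icc (-alphaBif T R β k) (alphaBif T R β k) => (α : ℝ))
    continuous_subtype_val (continuous_const.mul hcont)
    (fun α => (sign_mul_mem_orbits hσ (hs α).2).1)
    fun α => (sign_mul_mem_orbits hσ (hs α).2).2

/-! ### Local uniqueness along the curves and bifurcation at their ends. -/

/-- Near a point of a curve there are no solutions but those on the curve. -/
theorem eventually_eq_curve {α₀ σ : ℝ} (hσ : σ = 1 ∨ σ = -1) (hα₀ : |α₀| < alphaBif T R β k)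
    {α : ℕ → ℝ} {x : ℕ → C2Even} (hα : Tendsto α atTop (𝓝 α₀))
    (hx : Tendsto x atTop (𝓝 (wave T R β α₀ (σ * amplitude T R β k α₀))))
    (hsol : ∀ i, IsEvenSolution T R β (α i) (x i)) :
    ∀ᶠ i in atTop, x i = wave T R β (α i) (σ * amplitude T R β k (α i)) := by
  have hm := abs_lt_alphaMax_of_le hT hR hβ hk1 hk hα₀.le
  have hr0 := amplitude_pos hT hR hβ hk1 hk hα₀
  obtain ⟨-, hspec⟩ := amplitude_spec hT hR hβ hk1 hk hα₀.le
  have hspec := sign_mul_mem_orbits hσ hspec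
  have hσ0 : σ ≠ 0 := by rcases hσ with rfl | rfl <;> norm_num
  have hσσ : σ * σ = 1 := by rcases hσ with rfl | rfl <;> norm_num
  set r := σ * amplitude T R β k α₀ with hr
  have hrne : r ≠ 0 := mul_ne_zero hσ0 hr0.ne'
  have hq := hspec.1.1
  have hrange : r ∈ range (shape R β α₀) := by simpa using mul_cos_mem_range hspec.1 0
  have hc0 := phiPlus_pos (α := α₀) hR hβ
  have hx0 : Tendsto (fun i => x i 0) atTop
      (𝓝 (phiPlus R β α₀ * inv (shape R β α₀) r)) := by
    have h1 := ((C2Even.continuous_eval 0).tendsto _).comp hx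
    have h2 : wave T R β α₀ r 0 = phiPlus R β α₀ * inv (shape R β α₀) r := by
      rw [coe_wave hspec.1 hk1 hspec.2, profile_zero hspec.1]
    rw [← h2]
    exact h1
  have hcα := ((continuous_phiPlus R β).tendsto α₀).comp hα
  have hdα := ((continuous_phiMinus R β).tendsto α₀).comp hα
  have hqα := ((continuous_shape R β).tendsto α₀).comp hα
  have hinv1 : inv (shape R β α₀) r ≠ 1 := fun h => by
    have := amp_inv hrange
    rw [h, amp_one] at this
    exact hrne this.symm
  -- The limit differs at ψ = 0 from both constants, so x i is eventually not constant.
  have hne1 : phiPlus R β α₀ * inv (shape R β α₀) r ≠ phiPlus R β α₀ := fun h =>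
    hinv1 (mul_left_cancel₀ hc0.ne' (by rw [h, mul_one]))
  have hne2 : phiPlus R β α₀ * inv (shape R β α₀) r ≠ phiMinus R β α₀ := fun h => by
    have hy := inv_mem hrange
    have h1 := nonlin_phiPlus_mul hR hβ hm.le hy.1
    rw [h, nonlin_phiMinus hR hβ hm.le (by rw [← h]; exact mul_pos hc0 hy.1)] at h1
    have h2 : force (shape R β α₀) (inv (shape R β α₀) r) = 0 :=
      (mul_eq_zero.1 h1.symm).resolve_left (by positivity)
    rcases hinv1.lt_or_gt with h3 | h3
    · exact (force_neg hy h3).ne h2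
    · exact (force_pos hq h3).ne' h2
  have hamp : Tendsto (fun i => amp (shape R β (α i)) (x i 0 / phiPlus R β (α i))) atTop (𝓝 r) := by
    have h1 : Tendsto (fun i => x i 0 / phiPlus R β (α i)) atTop
        (𝓝 (inv (shape R β α₀) r)) := by
      have := hx0.div hcα hc0.ne'
      rwa [mul_div_cancel_left₀ _ hc0.ne'] at this
    have h2 := (continuousAt_amp (z := (shape R β α₀, inv (shape R β α₀) r))
      (inv_mem hrange).1.ne').tendsto.comp (hqα.prodMk_nhds h1)
    rw [amp_inv hrange] at h2
    exact h2
  have hmem : ∀ᶠ i in atTop, (shape R β (α i), amp (shape R β (α i)) (x i 0 / phiPlus R β (α i)))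
      ∈ orbits ∨ ¬ |α i| < alphaMax R β := by
    filter_upwards [(hqα.prodMk_nhds hamp).eventually (eventually_mem_orbits hspec.1)] with i hi
    by_cases hlt : |α i| < alphaMax R β
    · exact Or.inl (hi (shape_lt hR hβ hlt))
    · exact Or.inr hlt
  have hlt : ∀ᶠ i in atTop, |α i| < alphaMax R β := hα.abs.eventually_lt_const hm
  have hhalf : Tendsto (fun i => half (shape R β (α i))
      (amp (shape R β (α i)) (x i 0 / phiPlus R β (α i)))) atTop (𝓝 (half (shape R β α₀) r)) := by
    have h1 : Tendsto (fun i => (shape R β (α i), amp (shape R β (α i))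
        (x i 0 / phiPlus R β (α i)))) atTop (𝓝[orbits] (shape R β α₀, r)) := by
      refine tendsto_nhdsWithin_iff.2 ⟨hqα.prodMk_nhds hamp, ?_⟩
      filter_upwards [hmem, hlt] with i hi hi' using hi.resolve_right (not_not.2 hi')
    have := (continuousOn_half _ hspec.1).tendsto.comp h1
    exact this
  have hk0 : (0 : ℝ) < k := by positivity
  have hfr := freq_pos hT hR
  have hh0 := half_pos hspec.1
  -- For a non-constant x i this quotient is its integer number of oscillations, so being within
  -- distance less than 1 of k forces equality.
  have hquot : Tendsto (fun i => π * freq T R / half (shape R β (α i))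
      (amp (shape R β (α i)) (x i 0 / phiPlus R β (α i)))) atTop (𝓝 k) := by
    have := (tendsto_const_nhds (x := π * freq T R)).div hhalf hh0.ne'
    have e : π * freq T R / half (shape R β α₀) r = k := by
      rw [← hspec.2, mul_div_cancel_right₀ _ hh0.ne']
    rw [e] at this
    exact this
  have hkk : ∀ᶠ i in atTop, |π * freq T R / half (shape R β (α i))
      (amp (shape R β (α i)) (x i 0 / phiPlus R β (α i))) - k| < 1 := by
    have := (hquot.sub_const (k : ℝ)).abs
    rw [sub_self, abs_zero] at this
    exact this.eventually_lt_const one_pos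
  -- The sign of the amplitude at ψ = 0 decides between the two curves.
  have hsign : ∀ᶠ i in atTop, 0 < σ * amp (shape R β (α i)) (x i 0 / phiPlus R β (α i)) := by
    refine (hamp.const_mul σ).eventually_const_lt ?_
    rw [hr, ← mul_assoc, hσσ, one_mul]
    exact hr0
  filter_upwards [hlt, hkk, hsign, (hx0.sub hcα).eventually_ne (sub_ne_zero.2 hne1),
    (hx0.sub hdα).eventually_ne (sub_ne_zero.2 hne2)] with i hlt hkk hsign hn1 hn2
  have hcirc : IsCircleSolution T R β (α i) (x i) :=
    ⟨(x i).contDiff, (x i).periodic, (hsol i).1, (hsol i).2⟩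
  rcases circle_solution_cases hT hR hβ hcirc (x i).deriv_zero with
    ⟨-, h⟩ | ⟨-, -, h⟩ | ⟨-, s, hs0, ho, ⟨l, hl1, hl⟩, h⟩
  · exact absurd (by simp [congrFun h 0]) hn1
  · exact absurd (by simp [congrFun h 0]) hn2
  · have hci := phiPlus_pos (α := α i) hR hβ
    have hs : amp (shape R β (α i)) (x i 0 / phiPlus R β (α i)) = s := by
      have h1 := h 0
      rw [add_zero, profile_zero ho] at h1
      rw [h1, mul_div_cancel_left₀ _ hci.ne']
      exact amp_inv (by simpa using mul_cos_mem_range ho 0)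
    rw [hs] at hkk hsign
    have hlk : l = k := by
      rw [← hl, mul_div_cancel_right₀ _ (half_pos ho).ne'] at hkk
      have : |(l : ℤ) - k| < 1 := by exact_mod_cast hkk
      have := Int.abs_lt_one_iff.1 this
      omega
    subst hlk
    have hx' : x i = wave T R β (α i) s := C2Even.ext fun ψ => by
      have := h ψ
      rw [add_zero] at this
      rw [this, coe_wave ho hl1 hl]
    have hσs := sign_mul_mem_orbits hσ ⟨ho, hl⟩
    rw [amplitude_eq hl1 hsign.le hσs.1 hσs.2, ← mul_assoc, hσσ, one_mul]
    exact hx'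

theorem not_isLichBifurcation {α₀ σ : ℝ} (hσ : σ = 1 ∨ σ = -1) (hα₀ : |α₀| < alphaBif T R β k) :
    ¬ IsLichBifurcation T R β α₀ (wave T R β α₀ (σ * amplitude T R β k α₀)) := by
  rintro ⟨-, -, α, x, y, hm, hα, hne, hx, hy, hF⟩
  have h1 := eventually_eq_curve hT hR hβ hk1 hk hσ hα₀ hα hx fun i => ⟨(hm i).2.1, (hF i).1⟩
  have h2 := eventually_eq_curve hT hR hβ hk1 hk hσ hα₀ hα hy fun i => ⟨(hm i).2.2, (hF i).2⟩
  obtain ⟨i, hi, hi'⟩ := (h1.and h2).exists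
  exact hne i (hi.trans hi'.symm)

theorem wave_ne {α : ℝ} (hα : |α| < alphaBif T R β k) :
    wave T R β α (1 * amplitude T R β k α) ≠ wave T R β α (-1 * amplitude T R β k α) := by
  intro he
  obtain ⟨-, hspec⟩ := amplitude_spec hT hR hβ hk1 hk hα.le
  have hr := amplitude_pos hT hR hβ hk1 hk hα
  have hp := sign_mul_mem_orbits (σ := 1) (Or.inl rfl) hspec
  have hn := sign_mul_mem_orbits (σ := -1) (Or.inr rfl) hspec
  have h := congrArg (fun φ : C2Even => φ 0) he
  simp only [coe_wave hp.1 hk1 hp.2, coe_wave hn.1 hk1 hn.2, profile_zero hp.1,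
    profile_zero hn.1] at h
  have h1 := mul_left_cancel₀ (phiPlus_pos hR hβ).ne' h
  refine (strictMonoOn_inv hspec.1.1 ?_ ?_ ?_).ne' h1
  · simpa using mul_cos_mem_range hn.1 0
  · simpa using mul_cos_mem_range hp.1 0
  · linarith

theorem wave_endpoint {α σ : ℝ} (hα : |α| = alphaBif T R β k) :
    wave T R β α (σ * amplitude T R β k α) = C2Even.const (phiPlus R β α) := by
  obtain ⟨-, ho, hB⟩ := amplitude_spec hT hR hβ hk1 hk hα.le
  rw [amplitude_eq_zero hT hR hβ hk1 hk hα] at ho hB ⊢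
  rw [mul_zero]
  refine C2Even.ext fun ψ => ?_
  rw [coe_wave ho hk1 hB]
  unfold profile pos
  rw [zero_mul, inv_zero ho.1, mul_one]
  rfl

theorem tendsto_curve {α σ : ℝ} (hσ : σ = 1 ∨ σ = -1) (hα : |α| = alphaBif T R β k) :
    Tendsto (fun α => wave T R β α (σ * amplitude T R β k α))
      (𝓝[Ioo (-alphaBif T R β k) (alphaBif T R β k)] α)
      (𝓝 (C2Even.const (phiPlus R β α))) := by
  have := continuousOn_curve hT hR hβ hk1 hk hσ α (abs_le.1 hα.le)
  rw [ContinuousWithinAt, wave_endpoint hT hR hβ hk1 hk hα] at this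
  exact this.mono_left (nhdsWithin_mono _ Ioo_subset_Icc_self)

theorem isLichBifurcation_endpoint {α : ℝ} (hα : |α| = alphaBif T R β k) :
    IsLichBifurcation T R β α (C2Even.const (phiPlus R β α)) := by
  have hb := alphaBif_pos hR hβ hk
  -- Any interior sequence tending to the endpoint would do; along it the two curves supply the
  -- distinct solutions.
  set u : ℕ → ℝ := fun i => α * (1 - 1 / ((i : ℝ) + 1)) with hu
  have hlt : ∀ i, |u i| < alphaBif T R β k := fun i => by
    have h1 : 0 < 1 / ((i : ℝ) + 1) := by positivity
    have h2 : 1 / ((i : ℝ) + 1) ≤ 1 := by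
      rw [div_le_one (by positivity)]
      linarith [(Nat.cast_nonneg i : (0 : ℝ) ≤ i)]
    rw [hu, abs_mul, hα, abs_of_nonneg (by linarith)]
    nlinarith
  have hlim : Tendsto u atTop (𝓝 α) := by
    have := (tendsto_one_div_add_atTop_nhds_zero_nat (𝕜 := ℝ)).const_sub 1 |>.const_mul α
    simpa [hu] using this
  have hlim' : Tendsto u atTop (𝓝[Ioo (-alphaBif T R β k) (alphaBif T R β k)] α) :=
    tendsto_nhdsWithin_iff.2 ⟨hlim, Eventually.of_forall fun i => abs_lt.1 (hlt i)⟩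
  have hsol : ∀ (σ : ℝ), (σ = 1 ∨ σ = -1) → ∀ i,
      IsEvenSolution T R β (u i) (wave T R β (u i) (σ * amplitude T R β k (u i))) :=
    fun σ hσ i => by
      obtain ⟨-, hspec⟩ := amplitude_spec hT hR hβ hk1 hk (hlt i).le
      have := sign_mul_mem_orbits hσ hspec
      exact isEvenSolution_wave hT hR hβ (abs_lt_alphaMax_of_le hT hR hβ hk1 hk (hlt i).le).le
        this.1 hk1 this.2
  refine ⟨mem_univ _, fun _ => phiPlus_pos hR hβ, u,
    fun i => wave T R β (u i) (1 * amplitude T R β k (u i)),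
    fun i => wave T R β (u i) (-1 * amplitude T R β k (u i)),
    fun i => ⟨mem_univ _, (hsol 1 (Or.inl rfl) i).1, (hsol (-1) (Or.inr rfl) i).1⟩, hlim,
    fun i => wave_ne hT hR hβ hk1 hk (hlt i),
    (tendsto_curve hT hR hβ hk1 hk (Or.inl rfl) hα).comp hlim',
    (tendsto_curve hT hR hβ hk1 hk (Or.inr rfl) hα).comp hlim',
    fun i => ⟨(hsol 1 (Or.inl rfl) i).2, (hsol (-1) (Or.inr rfl) i).2⟩⟩

end Curve

end

end LichWell

/-! ### Assembly of the classification. -/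

theorem proposition6p5 (T R β : ℝ) (hT : 0 < T) (hR : 0 < R) (hβ : 0 < β) :
    ∃ φp φm : ℕ → ℝ → C2Even,
      -- for each admissible `k ≥ 1`, the two curves over `(α_{k,-}, α_{k,+})`
      (∀ k : ℕ, 1 ≤ k → (2 * π / T) ^ 2 * (k : ℝ) ^ 2 < R / 2 →
        ContinuousOn (φp k) (Ioo (-alphaBif T R β k) (alphaBif T R β k)) ∧
        ContinuousOn (φm k) (Ioo (-alphaBif T R β k) (alphaBif T R β k)) ∧
        (∀ α ∈ Ioo (-alphaBif T R β k) (alphaBif T R β k),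
          -- solutions of index `k`, of period `2π/k`
          (IsEvenSolution T R β α (φp k α) ∧ IsEvenSolution T R β α (φm k α)) ∧
          (Function.Periodic (φp k α) (2 * π / k) ∧ Function.Periodic (φm k α) (2 * π / k)) ∧
          (HasIndex T (phiPlus R β α) (φp k α) k ∧ HasIndex T (phiPlus R β α) (φm k α) k) ∧
          -- distinct, and translates of each other by `π/k`
          φp k α ≠ φm k α ∧
          (∀ ψ : ℝ, φm k α ψ = φp k α (ψ + π / k)) ∧
          -- no bifurcation at interior points of the curves
          ¬ IsLichBifurcation T R β α (φp k α) ∧ ¬ IsLichBifurcation T R β α (φm k α)) ∧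
        -- the curves end at the points `(α_{k,±}, φ_+(α_{k,±}))`, which are bifurcation points
        (∀ a : ℝ, (a = alphaBif T R β k ∨ a = -alphaBif T R β k) →
          Tendsto (φp k) (𝓝[Ioo (-alphaBif T R β k) (alphaBif T R β k)] a)
            (𝓝 (C2Even.const (phiPlus R β a))) ∧
          Tendsto (φm k) (𝓝[Ioo (-alphaBif T R β k) (alphaBif T R β k)] a)
            (𝓝 (C2Even.const (phiPlus R β a))) ∧
          IsLichBifurcation T R β a (C2Even.const (phiPlus R β a)))) ∧
      -- the even solutions are exactly the constant ones and those on the curves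
      (∀ (α : ℝ) (φ : C2Even), IsEvenSolution T R β α φ ↔
        (|α| ≤ alphaMax R β ∧ φ = C2Even.const (phiPlus R β α)) ∨
        (α ≠ 0 ∧ |α| ≤ alphaMax R β ∧ φ = C2Even.const (phiMinus R β α)) ∨
        ∃ k : ℕ, 1 ≤ k ∧ (2 * π / T) ^ 2 * (k : ℝ) ^ 2 < R / 2 ∧
          α ∈ Ioo (-alphaBif T R β k) (alphaBif T R β k) ∧ (φ = φp k α ∨ φ = φm k α)) ∧
      -- every solution is a translate of an even one
      (∀ (α : ℝ) (φ : ℝ → ℝ), IsCircleSolution T R β α φ →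
        ∃ (ψ₀ : ℝ) (χ : C2Even), IsEvenSolution T R β α χ ∧ ∀ ψ : ℝ, φ (ψ + ψ₀) = χ ψ) := by
  open LichWell in
  have hIoo {α : ℝ} {k : ℕ} : α ∈ Ioo (-alphaBif T R β k) (alphaBif T R β k) ↔
    |α| < alphaBif T R β k := abs_lt.symm
  refine ⟨fun k α => wave T R β α (1 * amplitude T R β k α),
    fun k α => wave T R β α (-1 * amplitude T R β k α), fun k hk1 hk => ⟨?_, ?_, ?_, ?_⟩, ?_, ?_⟩
  · exact (continuousOn_curve hT hR hβ hk1 hk (Or.inl rfl)).mono Ioo_subset_Icc_self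
  · exact (continuousOn_curve hT hR hβ hk1 hk (Or.inr rfl)).mono Ioo_subset_Icc_self
  · intro α hα
    rw [hIoo] at hα
    have hm := abs_lt_alphaMax_of_le hT hR hβ hk1 hk hα.le
    obtain ⟨-, hspec⟩ := amplitude_spec hT hR hβ hk1 hk hα.le
    have hr := amplitude_pos hT hR hβ hk1 hk hα
    have hp := sign_mul_mem_orbits (σ := 1) (Or.inl rfl) hspec
    have hn := sign_mul_mem_orbits (σ := -1) (Or.inr rfl) hspec
    have ep := coe_wave hp.1 hk1 hp.2
    have en := coe_wave hn.1 hk1 hn.2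
    refine ⟨⟨isEvenSolution_wave hT hR hβ hm.le hp.1 hk1 hp.2,
      isEvenSolution_wave hT hR hβ hm.le hn.1 hk1 hn.2⟩, ⟨?_, ?_⟩, ⟨?_, ?_⟩,
      wave_ne hT hR hβ hk1 hk hα, fun ψ => ?_,
      not_isLichBifurcation hT hR hβ hk1 hk (Or.inl rfl) hα,
      not_isLichBifurcation hT hR hβ hk1 hk (Or.inr rfl) hα⟩
    · rw [ep]; exact profile_periodic_div hp.1 hk1 hp.2
    · rw [en]; exact profile_periodic_div hn.1 hk1 hn.2
    · rw [ep]; exact hasIndex_profile hT hR hβ hp.1 hk1 hp.2 (by linarith)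
    · rw [en]; exact hasIndex_profile hT hR hβ hn.1 hk1 hn.2 (by linarith)
    · rw [ep, en, one_mul, neg_one_mul]
      exact profile_neg hspec.1 hk1 hspec.2 ψ
  · intro a ha
    have ha' : |a| = alphaBif T R β k := by
      have hb := alphaBif_pos hR hβ hk
      rcases ha with rfl | rfl
      · exact abs_of_pos hb
      · rw [abs_neg, abs_of_pos hb]
    exact ⟨tendsto_curve hT hR hβ hk1 hk (Or.inl rfl) ha',
      tendsto_curve hT hR hβ hk1 hk (Or.inr rfl) ha',
      isLichBifurcation_endpoint hT hR hβ hk1 hk ha'⟩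
  · intro α φ
    constructor
    · intro h
      have hcirc : IsCircleSolution T R β α φ := ⟨φ.contDiff, φ.periodic, h.1, h.2⟩
      rcases circle_solution_cases hT hR hβ hcirc φ.deriv_zero with
        ⟨h1, h2⟩ | ⟨h0, h1, h2⟩ | ⟨hm, r, hr0, ho, ⟨k, hk1, hk⟩, hφ⟩
      · exact Or.inl ⟨h1, C2Even.ext (congrFun h2)⟩
      · exact Or.inr (Or.inl ⟨h0, h1, C2Even.ext (congrFun h2)⟩)
      · obtain ⟨hadm, hα, hr⟩ := admissible_of_amplitude hT hR hβ hm hr0 ho hk1 hk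
        have he : φ = wave T R β α r := C2Even.ext fun ψ => by
          have := hφ ψ
          rw [add_zero] at this
          rw [this, coe_wave ho hk1 hk]
        refine Or.inr (Or.inr ⟨k, hk1, hadm, hIoo.2 hα, ?_⟩)
        rcases hr with hr | hr
        · left; simp only [he, one_mul, ← hr]
        · right; simp only [he, neg_one_mul, ← hr]
    · rintro (⟨h1, rfl⟩ | ⟨h0, h1, rfl⟩ | ⟨k, hk1, hk, hα, h⟩)
      · exact isEvenSolution_const (phiPlus_pos hR hβ) (nonlin_phiPlus hR hβ h1)
      · have hd := phiMinus_pos hR hβ h1 h0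
        exact isEvenSolution_const hd (nonlin_phiMinus hR hβ h1 hd)
      · rw [hIoo] at hα
        have hm := abs_lt_alphaMax_of_le hT hR hβ hk1 hk hα.le
        obtain ⟨-, hspec⟩ := amplitude_spec hT hR hβ hk1 hk hα.le
        have hp := sign_mul_mem_orbits (σ := 1) (Or.inl rfl) hspec
        have hn := sign_mul_mem_orbits (σ := -1) (Or.inr rfl) hspec
        rcases h with rfl | rfl
        · exact isEvenSolution_wave hT hR hβ hm.le hp.1 hk1 hp.2
        · exact isEvenSolution_wave hT hR hβ hm.le hn.1 hk1 hn.2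
  · intro α φ h
    -- A periodic solution attains its minimum; translated to that critical point it is constant or
    -- one of the even orbits.
    have hcomp := h.2.1.compact_of_continuous two_pi_pos.ne' h.1.continuous
    obtain ⟨_, ⟨a, rfl⟩, ha⟩ := hcomp.exists_isLeast ⟨φ 0, mem_range_self 0⟩
    have hda : deriv φ a = 0 :=
      IsLocalMin.deriv_eq_zero (Eventually.of_forall fun ψ => ha (mem_range_self ψ))
    rcases circle_solution_cases hT hR hβ h hda with
      ⟨h1, h2⟩ | ⟨h0, h1, h2⟩ | ⟨hm, r, hr0, ho, ⟨k, hk1, hk⟩, hφ⟩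
    · exact ⟨0, C2Even.const (phiPlus R β α), isEvenSolution_const (phiPlus_pos hR hβ)
        (nonlin_phiPlus hR hβ h1), fun ψ => congrFun h2 _⟩
    · have hd := phiMinus_pos hR hβ h1 h0
      exact ⟨0, C2Even.const (phiMinus R β α), isEvenSolution_const hd
        (nonlin_phiMinus hR hβ h1 hd), fun ψ => congrFun h2 _⟩
    · refine ⟨a, wave T R β α r, isEvenSolution_wave hT hR hβ hm.le ho hk1 hk, fun ψ => ?_⟩
      rw [coe_wave ho hk1 hk]
      exact hφ ψ
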